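/- **Conventions.** A supermanifold of dimension $(q,n)$ is a second countable Hausdorff space with a sheaf $\mathcal O$ of $\mathbb Z_2$-graded, graded-commutative real algebras, locally isomorphic to $(U, C^\infty_U\otimes\bigwedge\mathbb R^n)$ with $U\subset\mathbb R^q$ open. Vector fields are (graded) derivations of $\mathcal O$; parities are denoted $|\cdot|$ and $[X,Y]=XY-(-1)^{|X||Y|}YX$. An even Riemannian metric $g$ is an even, graded-symmetric ($g(X,Y)=(-1)^{|X||Y|}g(Y,X)$), $\mathcal O$-bilinear pairing of vector fields whose matrix $g(\partial_{x^I},\partial_{x^J})$ is invertible in every chart $(x^I)$. Its Levi-Civita connection $\nabla^L$ is the affine connection with $\nabla^L_XY-(-1)^{|X||Y|}\nabla^L_YX=[X,Y]$ and $X\,g(Y,Z)=g(\nabla^L_XY,Z)+(-1)^{|X||Y|}g(Y,\nabla^L_XZ)$. For an even vector field $P$, the semi-symmetric non-metric connection is $\widehat\nabla_XY=\nabla^L_XY+(-1)^{|X||Y|}g(Y,P)X$. For an affine connection $\nabla$ put $R(X,Y)Z=\nabla_X\nabla_YZ-(-1)^{|X||Y|}\nabla_Y\nabla_XZ-\nabla_{[X,Y]}Z$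 and $$\mathrm{Ric}^{\nabla}(X,Y)=\sum_I(-1)^{|\partial_{x^I}|(|\partial_{x^I}|+|X|+|Y|)}\tfrac12\big[R(\partial_{x^I},X)Y+(-1)^{|X||Y|}R(\partial_{x^I},Y)X\big]^I ,$$ where $[\,\cdot\,]^I$ is the coefficient of $\partial_{x^I}$. The triple consisting of a supermanifold, an even metric $g$ and a connection $\nabla$ is Einstein with constant $k\in\mathbb R$ if $\mathrm{Ric}^\nabla(X,Y)=k\,g(X,Y)$ for all vector fields $X,Y$. **Theorem 4.3.** Let $M_2$ be a non-empty supermanifold of dimension $(q,n)\neq(0,0)$ with an even Riemannian metric $g_2$, let $h:\mathbb R\to\mathbb R$ be smooth and nowhere zero, and let $M=\mathbb R^{(1,0)}\times_\mu M_2$, $\mu=h^2$, be the product supermanifold with the metric $g_\mu=-dt\otimes dt+h^2g_2$, where $t$ is the coordinate of $\mathbb R^{(1,0)}$. Let $\widehat\nabla^\mu$ be the semi-symmetric non-metric connection of $(M,g_\mu)$ with $P=\partial_t$, and let $\lambda\in\mathbb R$. Then $(M,g_\mu,\widehat\nabla^\mu)$ is Einstein with constant $\lambda$ if and only if there is a constant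 $c_0\in\mathbb R$ such that 1. $(M_2,g_2)$ with its Levi-Civita connection is Einstein with constant $c_0$; 2. $(q-n)\left(\dfrac{h''}{h}-1\right)=\lambda$ on $\mathbb R$; 3. $\lambda h^2-h''h-(q-n-1)(h')^2+(q-n)hh'=c_0$ on $\mathbb R$. -/

import Mathlib

set_option linter.unusedSectionVars false

open TopologicalSpace
open scoped ContDiff

universe u

noncomputable section

namespace SuperGeom


/-- The sign `(-1)^a` of a parity `a`. -/
def sgn (a : ZMod 2) : ℝ := if a = 0 then 1 else -1

theorem parity_cases (i : ZMod 2) : i = 0 ∨ i = 1 := by revert i; decide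

/-- The Grassmann algebra `⋀ ℝⁿ`. -/
abbrev Grassmann (n : ℕ) : Type := ExteriorAlgebra ℝ (Fin n → ℝ)

/-- Its even (`i = 0`) and odd (`i = 1`) parts. -/
abbrev Grassmann.part (n : ℕ) (i : ZMod 2) : Submodule ℝ (Grassmann n) :=
  CliffordAlgebra.evenOdd (0 : QuadraticForm ℝ (Fin n → ℝ)) i

/-- The basis of monomials `ξ^{A₁} ⋯ ξ^{A_k}`, `A₁ < ⋯ < A_k`. -/
def monomials (n : ℕ) : Module.Basis (Finset (Fin n)) ℝ (Grassmann n) :=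
  (Pi.basisFun ℝ (Fin n)).ExteriorAlgebra

section Model

variable {E : Type} [NormedAddCommGroup E] [NormedSpace ℝ E] {n : ℕ} {V : Opens E}

/-- The coefficient of the monomial `S` of a Grassmann-valued function on `V` (zero off `V`). -/
def coef (f : V → Grassmann n) (S : Finset (Fin n)) : E → ℝ :=
  open Classical in fun x => if h : x ∈ V then (monomials n).repr (f ⟨x, h⟩) S else 0

theorem coef_of_mem (f : V → Grassmann n) (S : Finset (Fin n)) {x : E} (h : x ∈ V) :
    coef f S x = (monomials n).repr (f ⟨x, h⟩) S := dif_pos h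

/-- All the coefficients are smooth. -/
def IsSmooth (f : V → Grassmann n) : Prop :=
  ∀ S, ContDiffOn ℝ ∞ (coef f S) V

theorem IsSmooth.of_coef {f : V → Grassmann n} (F : Finset (Fin n) → E → ℝ)
    (hF : ∀ S, ContDiffOn ℝ ∞ (F S) V)
    (h : ∀ S (x : V), (monomials n).repr (f x) S = F S x) : IsSmooth f := fun S =>
  (hF S).congr fun x hx => by rw [coef_of_mem f S hx]; exact h S ⟨x, hx⟩

theorem IsSmooth.add {f g : V → Grassmann n} (hf : IsSmooth f) (hg : IsSmooth g) :
    IsSmooth (f + g) :=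
  .of_coef (fun S => coef f S + coef g S) (fun S => (hf S).add (hg S)) fun S x => by
    simp [coef_of_mem _ _ x.2]

theorem IsSmooth.map {f : V → Grassmann n} (hf : IsSmooth f)
    (L : Grassmann n →ₗ[ℝ] Grassmann n) : IsSmooth (fun x => L (f x)) :=
  .of_coef (fun S x => ∑ A, coef f A x * (monomials n).repr (L (monomials n A)) S)
    (fun S => ContDiffOn.sum fun A _ => (hf A).mul contDiffOn_const) fun S x => by
    conv_lhs => rw [← (monomials n).sum_repr (f x), map_sum, map_sum, Finsupp.finsetSum_apply]
    refine Finset.sum_congr rfl fun A _ => ?_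
    rw [map_smul, map_smul, Finsupp.smul_apply, smul_eq_mul, coef_of_mem _ _ x.2]

theorem repr_mul (a b : Grassmann n) (S : Finset (Fin n)) :
    (monomials n).repr (a * b) S = ∑ A, ∑ B, (monomials n).repr a A * (monomials n).repr b B *
      (monomials n).repr (monomials n A * monomials n B) S := by
  conv_lhs => rw [← (monomials n).sum_repr a, ← (monomials n).sum_repr b, Finset.sum_mul,
    map_sum, Finsupp.finsetSum_apply]
  refine Finset.sum_congr rfl fun A _ => ?_
  rw [Finset.mul_sum, map_sum, Finsupp.finsetSum_apply]
  refine Finset.sum_congr rfl fun B _ => ?_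
  rw [smul_mul_smul_comm, map_smul, Finsupp.smul_apply, smul_eq_mul]

theorem IsSmooth.mul {f g : V → Grassmann n} (hf : IsSmooth f) (hg : IsSmooth g) :
    IsSmooth (f * g) :=
  .of_coef (fun S x => ∑ A, ∑ B, coef f A x * coef g B x *
      (monomials n).repr (monomials n A * monomials n B) S)
    (fun S => ContDiffOn.sum fun A _ => ContDiffOn.sum fun B _ =>
      ((hf A).mul (hg B)).mul contDiffOn_const) fun S x => by
    simp only [Pi.mul_apply, repr_mul (f x) (g x) S, coef_of_mem _ _ x.2]

variable (n V) in
/-- The algebra `C^∞(V) ⊗ ⋀ ℝⁿ` of superfunctions on an open set `V`. -/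
def SuperFun : Subalgebra ℝ (V → Grassmann n) where
  carrier := {f | IsSmooth f}
  mul_mem' := IsSmooth.mul
  add_mem' := IsSmooth.add
  algebraMap_mem' r := .of_coef (fun S _ => (monomials n).repr (algebraMap ℝ _ r) S)
    (fun _ => contDiffOn_const) fun _ _ => rfl

theorem mem_superFun {f : V → Grassmann n} : f ∈ SuperFun n V ↔ IsSmooth f := Iff.rfl

theorem superFun_smooth (f : SuperFun n V) : IsSmooth f.1 := f.2

theorem dirDeriv_smooth_aux {f : V → Grassmann n} (hf : IsSmooth f) (S : Finset (Fin n)) (v : E) :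
    ContDiffOn ℝ ∞ (fun x => fderiv ℝ (coef f S) x v) V :=
  ((hf S).fderiv_of_isOpen V.2 (m := ∞) (by simp)).clm_apply contDiffOn_const

theorem coef_differentiableAt (f : SuperFun n V) (S : Finset (Fin n)) (x : V) :
    DifferentiableAt ℝ (coef f.1 S) x :=
  ((f.2 S).differentiableOn (by simp)).differentiableAt (V.2.mem_nhds x.2)

/-- The derivative of `∑ f_S ξ^S` along the constant vector field `v`: `∑ (∂_v f_S) ξ^S`. -/
def dirDerivFun (v : E) (f : V → Grassmann n) (x : V) : Grassmann n :=
  ∑ S, fderiv ℝ (coef f S) x v • monomials n S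

theorem repr_dirDerivFun (v : E) (f : V → Grassmann n) (x : V) (S : Finset (Fin n)) :
    (monomials n).repr (dirDerivFun v f x) S = fderiv ℝ (coef f S) x v := by
  unfold dirDerivFun
  rw [Module.Basis.repr_sum_self]

theorem dirDerivFun_map (v : E) (f : SuperFun n V) (L : Grassmann n →ₗ[ℝ] Grassmann n) (x : V) :
    dirDerivFun v (fun y => L (f.1 y)) x = L (dirDerivFun v f.1 x) := by
  apply (monomials n).repr.injective
  ext S
  rw [repr_dirDerivFun]
  have e : coef (fun y => L (f.1 y)) S =ᶠ[nhds (x : E)]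
      fun y => ∑ A, coef f.1 A y * (monomials n).repr (L (monomials n A)) S := by
    filter_upwards [V.2.mem_nhds x.2] with y hy
    rw [coef_of_mem _ _ hy, ← (monomials n).sum_repr (f.1 ⟨y, hy⟩), map_sum, map_sum,
      Finsupp.finsetSum_apply]
    refine Finset.sum_congr rfl fun A _ => ?_
    rw [map_smul, map_smul, Finsupp.smul_apply, smul_eq_mul, coef_of_mem _ _ hy]
  have d : HasFDerivAt (fun y => ∑ A, coef f.1 A y * (monomials n).repr (L (monomials n A)) S)
      (∑ A, (monomials n).repr (L (monomials n A)) S • fderiv ℝ (coef f.1 A) x) x :=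
    HasFDerivAt.fun_sum fun A _ => (coef_differentiableAt f A x).hasFDerivAt.mul_const _
  rw [e.fderiv_eq, d.fderiv, dirDerivFun, map_sum, map_sum, Finsupp.finsetSum_apply, sum_apply]
  refine Finset.sum_congr rfl fun A _ => ?_
  rw [map_smul, map_smul, Finsupp.smul_apply, smul_eq_mul, smul_apply,
    smul_eq_mul, mul_comm]

theorem dirDerivFun_add (v : E) (f g : SuperFun n V) (x : V) :
    dirDerivFun v (f.1 + g.1) x = dirDerivFun v f.1 x + dirDerivFun v g.1 x := by
  have h : ∀ S, coef (f.1 + g.1) S = coef f.1 S + coef g.1 S := fun S => by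
    funext y
    by_cases hy : y ∈ V <;> simp [coef, hy]
  simp only [dirDerivFun, h, ← Finset.sum_add_distrib, ← add_smul]
  refine Finset.sum_congr rfl fun S _ => ?_
  rw [fderiv_add (coef_differentiableAt f S x) (coef_differentiableAt g S x),
    add_apply]

theorem dirDerivFun_smooth (v : E) {f : V → Grassmann n} (hf : IsSmooth f) :
    IsSmooth (dirDerivFun v f) :=
  .of_coef (fun S x => fderiv ℝ (coef f S) x v) (fun S => dirDeriv_smooth_aux hf S v)
    fun S x => repr_dirDerivFun v f x S

theorem dirDerivFun_smul (v : E) (r : ℝ) (f : SuperFun n V) (x : V) :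
    dirDerivFun v (r • f.1) x = r • dirDerivFun v f.1 x := by
  have h := dirDerivFun_map v f (r • LinearMap.id) x
  simp only [LinearMap.smul_apply, LinearMap.id_apply] at h
  rw [← h]
  congr 1

/-- `dirDerivFun` as an operator on superfunctions. -/
def dirDeriv (v : E) : SuperFun n V →ₗ[ℝ] SuperFun n V where
  toFun f := ⟨dirDerivFun v f.1, mem_superFun.2 (dirDerivFun_smooth v (superFun_smooth f))⟩
  map_add' f g := Subtype.ext (funext fun x => dirDerivFun_add v f g x)
  map_smul' r f := Subtype.ext (funext fun x => dirDerivFun_smul v r f x)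

/-- Left contraction with the `A`-th dual basis vector: the derivative `∂/∂ξ^A` on `⋀ ℝⁿ`. -/
def contraction (A : Fin n) : Grassmann n →ₗ[ℝ] Grassmann n :=
  CliffordAlgebra.contractLeft (LinearMap.proj A)

/-- The odd derivative `∂/∂ξ^A` on superfunctions. -/
def oddDeriv (A : Fin n) : SuperFun n V →ₗ[ℝ] SuperFun n V where
  toFun f := ⟨fun x => contraction A (f.1 x), mem_superFun.2 ((superFun_smooth f).map _)⟩
  map_add' f g := Subtype.ext (funext fun x => map_add (contraction A) (f.1 x) (g.1 x))
  map_smul' r f := Subtype.ext (funext fun x => map_smul (contraction A) r (f.1 x))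

theorem dirDeriv_mul (v : E) (f g : SuperFun n V) :
    dirDeriv v (f * g) = dirDeriv v f * g + f * dirDeriv v g := by
  refine Subtype.ext (funext fun x => ?_)
  change dirDerivFun v (f.1 * g.1) x = dirDerivFun v f.1 x * g.1 x + f.1 x * dirDerivFun v g.1 x
  apply (monomials n).repr.injective
  ext S
  rw [repr_dirDerivFun]
  have e : coef (f.1 * g.1) S =ᶠ[nhds (x : E)] fun y => ∑ A, ∑ B, coef f.1 A y * coef g.1 B y *
      (monomials n).repr (monomials n A * monomials n B) S := by
    filter_upwards [V.2.mem_nhds x.2] with y hy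
    simp only [coef_of_mem _ _ hy, Pi.mul_apply, repr_mul (f.1 ⟨y, hy⟩) (g.1 ⟨y, hy⟩) S]
  have d : HasFDerivAt (fun y => ∑ A, ∑ B, coef f.1 A y * coef g.1 B y *
      (monomials n).repr (monomials n A * monomials n B) S)
      (∑ A, ∑ B, (monomials n).repr (monomials n A * monomials n B) S •
        (coef f.1 A x • fderiv ℝ (coef g.1 B) x + coef g.1 B x • fderiv ℝ (coef f.1 A) x)) x := by
    refine HasFDerivAt.fun_sum fun A _ => HasFDerivAt.fun_sum fun B _ => ?_
    exact ((coef_differentiableAt f A x).hasFDerivAt.mul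
      (coef_differentiableAt g B x).hasFDerivAt).mul_const _
  rw [e.fderiv_eq, d.fderiv, map_add, Finsupp.add_apply, repr_mul (dirDerivFun v f.1 x),
    repr_mul (f.1 x) (dirDerivFun v g.1 x), ← Finset.sum_add_distrib, sum_apply]
  refine Finset.sum_congr rfl fun A _ => ?_
  rw [← Finset.sum_add_distrib, sum_apply]
  refine Finset.sum_congr rfl fun B _ => ?_
  rw [repr_dirDerivFun, repr_dirDerivFun, coef_of_mem _ _ x.2, coef_of_mem _ _ x.2]
  simp only [smul_apply, add_apply, smul_eq_mul]
  ring

theorem contractLeft_mul (d : Module.Dual ℝ (Fin n → ℝ)) (a b : Grassmann n) :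
    CliffordAlgebra.contractLeft d (a * b) = CliffordAlgebra.contractLeft d a * b +
      CliffordAlgebra.involute a * CliffordAlgebra.contractLeft d b := by
  induction a using CliffordAlgebra.left_induction with
  | algebraMap r =>
    rw [CliffordAlgebra.contractLeft_algebraMap_mul, CliffordAlgebra.contractLeft_algebraMap]
    simp
  | add x y hx hy => rw [add_mul, map_add, hx, hy, map_add, map_add]; noncomm_ring
  | ι_mul x m hx =>
    rw [mul_assoc, CliffordAlgebra.contractLeft_ι_mul, hx, CliffordAlgebra.contractLeft_ι_mul,
      map_mul, CliffordAlgebra.involute_ι, sub_mul, smul_mul_assoc]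
    noncomm_ring

theorem eq_zero_of_eq_neg {a : Grassmann n} (h : a = -a) : a = 0 := by
  have h2 : (2 : ℝ) • a = 0 := by
    rw [two_smul]; nth_rewrite 1 [h]; exact neg_add_cancel a
  exact (smul_eq_zero.1 h2).resolve_left two_ne_zero

theorem mem_part_iff {i : ZMod 2} {a : Grassmann n} :
    a ∈ Grassmann.part n i ↔ CliffordAlgebra.involute a = sgn i • a := by
  obtain ⟨b, hb, c, hc, rfl⟩ := Submodule.mem_sup.1
    ((CliffordAlgebra.evenOdd_isCompl (0 : QuadraticForm ℝ (Fin n → ℝ))).sup_eq_top ▸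
      Submodule.mem_top (x := a))
  have h0 := CliffordAlgebra.involute_eq_of_mem_even hb
  have h1 := CliffordAlgebra.involute_eq_of_mem_odd hc
  rcases parity_cases i with rfl | rfl
  · rw [sgn, if_pos rfl, one_smul]
    refine ⟨CliffordAlgebra.involute_eq_of_mem_even, fun h => ?_⟩
    rw [map_add, h0, h1] at h
    have : c = 0 := eq_zero_of_eq_neg (add_left_cancel h).symm
    rw [this, add_zero]; exact hb
  · rw [sgn, if_neg one_ne_zero, neg_one_smul]
    refine ⟨CliffordAlgebra.involute_eq_of_mem_odd, fun h => ?_⟩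
    rw [map_add, h0, h1, neg_add] at h
    have : b = 0 := eq_zero_of_eq_neg (add_right_cancel h)
    rw [this, zero_add]; exact hc

theorem involute_contractLeft (d : Module.Dual ℝ (Fin n → ℝ)) (a : Grassmann n) :
    CliffordAlgebra.involute (CliffordAlgebra.contractLeft d a) =
      -CliffordAlgebra.contractLeft d (CliffordAlgebra.involute a) := by
  induction a using CliffordAlgebra.left_induction with
  | algebraMap r =>
    rw [AlgHom.commutes, CliffordAlgebra.contractLeft_algebraMap, map_zero, neg_zero]
  | add x y hx hy => rw [map_add, map_add, hx, hy, map_add, map_add, neg_add]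
  | ι_mul x m hx =>
    rw [CliffordAlgebra.contractLeft_ι_mul, map_sub, map_smul, map_mul, map_mul, hx,
      CliffordAlgebra.involute_ι, neg_mul, neg_mul, map_neg, CliffordAlgebra.contractLeft_ι_mul]
    noncomm_ring

theorem sgn_add_one (i : ZMod 2) : sgn (i + 1) = -sgn i := by
  rcases parity_cases i with rfl | rfl
  · simp [sgn]
  · have : (1 + 1 : ZMod 2) = 0 := by decide
    simp [sgn, this]

theorem contractLeft_mem (d : Module.Dual ℝ (Fin n → ℝ)) {i : ZMod 2} {a : Grassmann n}
    (h : a ∈ Grassmann.part n i) :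
    CliffordAlgebra.contractLeft d a ∈ Grassmann.part n (i + 1) := by
  rw [mem_part_iff] at h ⊢
  rw [involute_contractLeft, h, map_smul, sgn_add_one, neg_smul]

theorem dirDeriv_mem (v : E) {f : SuperFun n V} {i : ZMod 2}
    (hf : ∀ x, f.1 x ∈ Grassmann.part n i) (x : V) :
    (dirDeriv v f).1 x ∈ Grassmann.part n i := by
  change dirDerivFun v f.1 x ∈ _
  rw [mem_part_iff]
  have h1 := dirDerivFun_map v f (CliffordAlgebra.involute (Q := 0)).toLinearMap x
  have h2 := dirDerivFun_map v f (sgn i • LinearMap.id) x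
  have h3 : (fun y => (CliffordAlgebra.involute (Q := 0)).toLinearMap (f.1 y)) =
      fun y => (sgn i • (LinearMap.id : Grassmann n →ₗ[ℝ] Grassmann n)) (f.1 y) :=
    funext fun y => mem_part_iff.1 (hf y)
  rw [h3, h2] at h1
  exact h1.symm

theorem oddDeriv_mul (A : Fin n) {f : SuperFun n V} {i : ZMod 2}
    (hf : ∀ x, f.1 x ∈ Grassmann.part n i) (g : SuperFun n V) :
    oddDeriv A (f * g) = oddDeriv A f * g + sgn i • (f * oddDeriv A g) := by
  refine Subtype.ext (funext fun x => ?_)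
  have h := contractLeft_mul (LinearMap.proj A) (f.1 x) (g.1 x)
  rw [mem_part_iff.1 (hf x), smul_mul_assoc] at h
  exact h

end Model


/-- A topological space with a sheaf of `ℤ/2`-graded, graded-commutative real algebras. -/
structure SuperSpace where
  carrier : Type u
  [top : TopologicalSpace carrier]
  /-- sections over an open set -/
  sec : Opens carrier → Type u
  [ring : ∀ U, Ring (sec U)]
  [alg : ∀ U, Algebra ℝ (sec U)]
  /-- even (`0`) and odd (`1`) sections -/
  par : ∀ U, ZMod 2 → Submodule ℝ (sec U)
  res : ∀ {U V : Opens carrier}, V ≤ U → (sec U →ₐ[ℝ] sec V)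
  par_isCompl : ∀ U, IsCompl (par U 0) (par U 1)
  one_mem : ∀ U, (1 : sec U) ∈ par U 0
  mul_mem : ∀ {U : Opens carrier} {i j : ZMod 2} {a b : sec U},
    a ∈ par U i → b ∈ par U j → a * b ∈ par U (i + j)
  supercomm : ∀ {U : Opens carrier} {i j : ZMod 2} {a b : sec U},
    a ∈ par U i → b ∈ par U j → a * b = sgn (i * j) • (b * a)
  res_mem : ∀ {U V : Opens carrier} (h : V ≤ U) {i : ZMod 2} {a : sec U},
    a ∈ par U i → res h a ∈ par V i
  res_id : ∀ {U : Opens carrier} (a : sec U), res (le_refl U) a = a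
  res_res : ∀ {U V W : Opens carrier} (h : V ≤ U) (h' : W ≤ V) (a : sec U),
    res h' (res h a) = res (h'.trans h) a
  glue : ∀ {ι : Type u} (U : Opens carrier) (V : ι → Opens carrier) (hV : ∀ i, V i ≤ U),
    (∀ x ∈ U, ∃ i, x ∈ V i) → ∀ s : ∀ i, sec (V i),
    (∀ i j (W : Opens carrier) (hi : W ≤ V i) (hj : W ≤ V j), res hi (s i) = res hj (s j)) →
    ∃! a : sec U, ∀ i, res (hV i) a = s i

attribute [instance] SuperSpace.top SuperSpace.ring SuperSpace.alg

/-- A superchart of dimension `q|n`: an isomorphism of an open part of `M` with an open part of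
`ℝ^{q|n}`, i.e. a homeomorphism `map` of the underlying open sets together with parity preserving
isomorphisms of the algebras of sections that are compatible with restriction. -/
structure SuperChart (M : SuperSpace.{u}) (q n : ℕ) where
  map : OpenPartialHomeomorph M.carrier (Fin q → ℝ)
  iso : ∀ W : Opens M.carrier, (W : Set M.carrier) ⊆ map.source →
    M.sec W ≃ₐ[ℝ]
      SuperFun n (⟨map.target ∩ map.symm ⁻¹' W, map.isOpen_inter_preimage_symm W.2⟩ :
        Opens (Fin q → ℝ))
  iso_res : ∀ (U V : Opens M.carrier) (hU : (U : Set M.carrier) ⊆ map.source) (h : V ≤ U)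
    (f : M.sec U) (y : Fin q → ℝ) (hy : y ∈ map.target ∩ map.symm ⁻¹' V),
    (iso V (Set.Subset.trans h hU) (M.res h f)).1 ⟨y, hy⟩ = (iso U hU f).1 ⟨y, hy.1, h hy.2⟩
  iso_par : ∀ (W : Opens M.carrier) (hW : (W : Set M.carrier) ⊆ map.source) (i : ZMod 2)
    (f : M.sec W), f ∈ M.par W i → ∀ y, (iso W hW f).1 y ∈ Grassmann.part n i

/-- `M` is a supermanifold of dimension `q|n`. -/
structure IsSupermanifold (M : SuperSpace.{u}) (q n : ℕ) : Prop where
  t2 : T2Space M.carrier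
  secondCountable : SecondCountableTopology M.carrier
  exists_chart : ∀ x : M.carrier, ∃ c : SuperChart M q n, x ∈ c.map.source

section VectorFields

variable {M : SuperSpace.{u}}

variable (M) in
/-- Families of linear operators on the sections over the open subsets of `U`. -/
abbrev Fam (U : Opens M.carrier) : Type u :=
  ∀ W : {W : Opens M.carrier // W ≤ U}, M.sec W.1 →ₗ[ℝ] M.sec W.1

variable (M) in
/-- The vector fields of parity `i` on `U`: the derivations of parity `i` of the sheaf of
superalgebras restricted to `U`. -/
def Der (U : Opens M.carrier) (i : ZMod 2) : Submodule ℝ (Fam M U) where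
  carrier := {D |
    (∀ (W W' : Opens M.carrier) (hW : W ≤ U) (h : W' ≤ W) (a : M.sec W),
      M.res h (D ⟨W, hW⟩ a) = D ⟨W', h.trans hW⟩ (M.res h a)) ∧
    (∀ (W : Opens M.carrier) (hW : W ≤ U) (j : ZMod 2) (a : M.sec W),
      a ∈ M.par W j → D ⟨W, hW⟩ a ∈ M.par W (i + j)) ∧
    (∀ (W : Opens M.carrier) (hW : W ≤ U) (j : ZMod 2) (a b : M.sec W), a ∈ M.par W j →
      D ⟨W, hW⟩ (a * b) = D ⟨W, hW⟩ a * b + sgn (i * j) • (a * D ⟨W, hW⟩ b))}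
  add_mem' := by
    rintro D D' ⟨h1, h2, h3⟩ ⟨h1', h2', h3'⟩
    refine ⟨fun W W' hW h a => ?_, fun W hW j a ha => ?_, fun W hW j a b ha => ?_⟩
    · simp only [Pi.add_apply, LinearMap.add_apply, map_add, h1, h1']
    · exact Submodule.add_mem _ (h2 W hW j a ha) (h2' W hW j a ha)
    · simp only [Pi.add_apply, LinearMap.add_apply, h3 W hW j a b ha, h3' W hW j a b ha, add_mul,
        mul_add, smul_add]
      abel
  zero_mem' := by
    refine ⟨fun W W' hW h a => ?_, fun W hW j a ha => ?_, fun W hW j a b ha => ?_⟩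
    · simp
    · exact Submodule.zero_mem _
    · simp
  smul_mem' := by
    rintro r D ⟨h1, h2, h3⟩
    refine ⟨fun W W' hW h a => ?_, fun W hW j a ha => ?_, fun W hW j a b ha => ?_⟩
    · simp only [Pi.smul_apply, LinearMap.smul_apply, map_smul, h1]
    · exact Submodule.smul_mem _ _ (h2 W hW j a ha)
    · simp only [Pi.smul_apply, LinearMap.smul_apply, h3 W hW j a b ha, smul_add, smul_mul_assoc,
        mul_smul_comm, smul_comm r]

variable (M) in
/-- The vector fields on `U`: sums of an even and an odd one. -/
def VF (U : Opens M.carrier) : Submodule ℝ (Fam M U) := Der M U 0 ⊔ Der M U 1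

theorem der_le_vf (U : Opens M.carrier) (i : ZMod 2) : Der M U i ≤ VF M U := by
  rcases parity_cases i with rfl | rfl
  · exact le_sup_left
  · exact le_sup_right

/-- A homogeneous vector field as a vector field. -/
def vf {U : Opens M.carrier} {i : ZMod 2} (X : Der M U i) : VF M U :=
  ⟨X.1, der_le_vf U i X.2⟩

/-- The action `X(f)` of a vector field on a section. -/
def act {U : Opens M.carrier} (X : VF M U) (f : M.sec U) : M.sec U := X.1 ⟨U, le_rfl⟩ f

theorem vf_map {N : SuperSpace.{u}} {U : Opens M.carrier} {V : Opens N.carrier}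
    (L : Fam M U →ₗ[ℝ] Fam N V) (hL : ∀ i D, D ∈ Der M U i → L D ∈ Der N V i)
    {X : Fam M U} (hX : X ∈ VF M U) : L X ∈ VF N V := by
  obtain ⟨Y, hY, Z, hZ, rfl⟩ := Submodule.mem_sup.1 hX
  rw [map_add]
  exact Submodule.add_mem _ (der_le_vf V 0 (hL _ _ hY)) (der_le_vf V 1 (hL _ _ hZ))

/-- Restriction of vector fields. -/
def restr {U V : Opens M.carrier} (h : V ≤ U) (X : VF M U) : VF M V :=
  ⟨fun W => X.1 ⟨W.1, W.2.trans h⟩, vf_map (N := M)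
    (L := { toFun := fun D W => D ⟨W.1, W.2.trans h⟩, map_add' := fun _ _ => rfl,
            map_smul' := fun _ _ => rfl })
    (fun _ _ hD => ⟨fun W W' hW h' a => hD.1 W W' (hW.trans h) h' a,
      fun W hW => hD.2.1 W (hW.trans h), fun W hW => hD.2.2 W (hW.trans h)⟩) X.2⟩

theorem sgn_mul_sgn (a b : ZMod 2) : sgn a * sgn b = sgn (a + b) := by
  have h2 : (1 + 1 : ZMod 2) = 0 := by decide
  rcases parity_cases a with rfl | rfl <;> rcases parity_cases b with rfl | rfl <;> simp [sgn, h2]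

theorem smul_der_mem {U : Opens M.carrier} {i j : ZMod 2} {f : M.sec U} (hf : f ∈ M.par U j)
    {X : Fam M U} (hX : X ∈ Der M U i) :
    (fun W => LinearMap.mulLeft ℝ (M.res W.2 f) ∘ₗ X W : Fam M U) ∈ Der M U (j + i) := by
  refine ⟨fun W W' hW h a => ?_, fun W hW k a ha => ?_, fun W hW k a b ha => ?_⟩
  · simp only [LinearMap.comp_apply, LinearMap.mulLeft_apply, map_mul, M.res_res, hX.1 W W' hW h a]
  · have := M.mul_mem (M.res_mem hW hf) (hX.2.1 W hW k a ha)
    rwa [← add_assoc] at this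
  · simp only [LinearMap.comp_apply, LinearMap.mulLeft_apply]
    rw [hX.2.2 W hW k a b ha, mul_add, mul_smul_comm, ← mul_assoc, ← mul_assoc,
      M.supercomm (M.res_mem hW hf) ha, smul_mul_assoc, smul_smul, sgn_mul_sgn, mul_assoc,
      add_mul, add_comm (i * k), mul_assoc a]

/-- The product `f X` of a section and a vector field. -/
def fmul {U : Opens M.carrier} (f : M.sec U) (X : VF M U) : VF M U :=
  ⟨fun W => LinearMap.mulLeft ℝ (M.res W.2 f) ∘ₗ X.1 W, by
    obtain ⟨a, ha, b, hb, hab⟩ := Submodule.mem_sup.1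
      ((M.par_isCompl U).sup_eq_top ▸ Submodule.mem_top (x := f))
    obtain ⟨Y, hY, Z, hZ, hYZ⟩ := Submodule.mem_sup.1 X.2
    have e : (fun W => LinearMap.mulLeft ℝ (M.res W.2 f) ∘ₗ X.1 W : Fam M U) =
        ((fun W => LinearMap.mulLeft ℝ (M.res W.2 a) ∘ₗ Y W) +
        (fun W => LinearMap.mulLeft ℝ (M.res W.2 a) ∘ₗ Z W)) +
        ((fun W => LinearMap.mulLeft ℝ (M.res W.2 b) ∘ₗ Y W) +
        (fun W => LinearMap.mulLeft ℝ (M.res W.2 b) ∘ₗ Z W)) := by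
      funext W
      ext x
      rw [← hab, ← hYZ]
      simp only [Pi.add_apply, LinearMap.add_apply, LinearMap.comp_apply, LinearMap.mulLeft_apply,
        map_add]
      noncomm_ring
    rw [e]
    exact Submodule.add_mem _
      (Submodule.add_mem _ (der_le_vf U _ (smul_der_mem ha hY)) (der_le_vf U _ (smul_der_mem ha hZ)))
      (Submodule.add_mem _ (der_le_vf U _ (smul_der_mem hb hY))
        (der_le_vf U _ (smul_der_mem hb hZ)))⟩

/-- The Lie bracket `[X, Y] = X Y - (-1)^{|X||Y|} Y X` of homogeneous vector fields. -/
def bracket {U : Opens M.carrier} {i j : ZMod 2} (X : Der M U i) (Y : Der M U j) :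
    Der M U (i + j) :=
  ⟨fun W => X.1 W ∘ₗ Y.1 W - sgn (i * j) • (Y.1 W ∘ₗ X.1 W), by
    obtain ⟨X, x1, x2, x3⟩ := X
    obtain ⟨Y, y1, y2, y3⟩ := Y
    refine ⟨fun W W' hW h a => ?_, fun W hW k a ha => ?_, fun W hW k a b ha => ?_⟩
    · simp only [LinearMap.sub_apply, LinearMap.smul_apply, LinearMap.comp_apply, map_sub,
        map_smul, x1, y1]
    · have h1 := x2 W hW _ _ (y2 W hW k a ha)
      have h2 := y2 W hW _ _ (x2 W hW k a ha)
      rw [← add_assoc] at h1 h2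
      rw [add_comm j i] at h2
      exact Submodule.sub_mem _ h1 (Submodule.smul_mem _ _ h2)
    · simp only [LinearMap.sub_apply, LinearMap.smul_apply, LinearMap.comp_apply]
      rw [y3 W hW k a b ha, x3 W hW k a b ha, map_add, map_add, map_smul, map_smul,
        x3 W hW _ _ b (y2 W hW k a ha), y3 W hW _ _ b (x2 W hW k a ha), x3 W hW k a _ ha,
        y3 W hW k a _ ha]
      have h2 : (1 + 1 : ZMod 2) = 0 := by decide
      rcases parity_cases i with rfl | rfl <;> rcases parity_cases j with rfl | rfl <;> rcases parity_cases k with rfl | rfl <;>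
        simp [sgn, h2] <;> noncomm_ring⟩

end VectorFields


section Charts

/-- The parity of a coordinate of `ℝ^{q|n}`; `inl` are the even ones, `inr` the odd ones. -/
def idxPar {q n : ℕ} : Fin q ⊕ Fin n → ZMod 2
  | .inl _ => 0
  | .inr _ => 1

variable {q n : ℕ} {V : Opens (Fin q → ℝ)}

/-- The coordinate functions of `ℝ^{q|n}`. -/
def modelCoord (V : Opens (Fin q → ℝ)) : Fin q ⊕ Fin n → SuperFun n V
  | .inl a => ⟨fun y => algebraMap ℝ (Grassmann n) (y.1 a), mem_superFun.2 <|
      .of_coef (fun S y => y a * (monomials n).repr 1 S)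
        (fun S => (contDiff_apply ℝ ℝ a).contDiffOn.mul contDiffOn_const) fun S y => by
          rw [Algebra.algebraMap_eq_smul_one, map_smul, Finsupp.smul_apply, smul_eq_mul]⟩
  | .inr A => ⟨fun _ => ExteriorAlgebra.ι ℝ (Pi.single A 1), mem_superFun.2 <|
      .of_coef (fun S _ => (monomials n).repr (ExteriorAlgebra.ι ℝ (Pi.single A 1)) S)
        (fun _ => contDiffOn_const) fun _ _ => rfl⟩

/-- The coordinate derivations of `ℝ^{q|n}`. -/
def modelDeriv (V : Opens (Fin q → ℝ)) : Fin q ⊕ Fin n → (SuperFun n V →ₗ[ℝ] SuperFun n V)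
  | .inl a => dirDeriv (Pi.single a 1)
  | .inr A => oddDeriv A

theorem modelDeriv_local {V V' : Opens (Fin q → ℝ)} (h : V' ≤ V) (I : Fin q ⊕ Fin n)
    (f : SuperFun n V) (f' : SuperFun n V')
    (hf : ∀ (y : Fin q → ℝ) (hy : y ∈ V'), f'.1 ⟨y, hy⟩ = f.1 ⟨y, h hy⟩)
    (y : Fin q → ℝ) (hy : y ∈ V') :
    (modelDeriv V' I f').1 ⟨y, hy⟩ = (modelDeriv V I f).1 ⟨y, h hy⟩ := by
  rcases I with a | A
  · change dirDerivFun _ f'.1 ⟨y, hy⟩ = dirDerivFun _ f.1 ⟨y, h hy⟩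
    apply (monomials n).repr.injective
    ext S
    rw [repr_dirDerivFun, repr_dirDerivFun]
    have e : coef f'.1 S =ᶠ[nhds y] coef f.1 S := by
      filter_upwards [V'.2.mem_nhds hy] with z hz
      rw [coef_of_mem _ _ hz, coef_of_mem _ _ (h hz), hf z hz]
    change fderiv ℝ (coef f'.1 S) y _ = fderiv ℝ (coef f.1 S) y _
    rw [e.fderiv_eq]
  · change contraction A (f'.1 ⟨y, hy⟩) = contraction A (f.1 ⟨y, h hy⟩)
    rw [hf y hy]

theorem modelDeriv_mem (I : Fin q ⊕ Fin n) {f : SuperFun n V} {j : ZMod 2}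
    (hf : ∀ y, f.1 y ∈ Grassmann.part n j) (y : V) :
    (modelDeriv V I f).1 y ∈ Grassmann.part n (idxPar I + j) := by
  rcases I with a | A
  · have := dirDeriv_mem (Pi.single a 1) hf y
    rw [idxPar, zero_add]; exact this
  · rw [idxPar, add_comm]; exact contractLeft_mem _ (hf y)

theorem sgn_zero : sgn 0 = 1 := if_pos rfl

theorem modelDeriv_mul (I : Fin q ⊕ Fin n) {f : SuperFun n V} {j : ZMod 2}
    (hf : ∀ y, f.1 y ∈ Grassmann.part n j) (g : SuperFun n V) :
    modelDeriv V I (f * g) = modelDeriv V I f * g + sgn (idxPar I * j) • (f * modelDeriv V I g) := by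
  rcases I with a | A
  · rw [idxPar, zero_mul, sgn_zero, one_smul]; exact dirDeriv_mul _ f g
  · rw [idxPar, one_mul]; exact oddDeriv_mul A hf g

variable {M : SuperSpace.{u}}

/-- The domain of a chart. -/
abbrev SuperChart.dom (c : SuperChart M q n) : Opens M.carrier := ⟨c.map.source, c.map.open_source⟩

/-- The image of `W` (intersected with the domain) under a chart. -/
abbrev SuperChart.img (c : SuperChart M q n) (W : Opens M.carrier) : Opens (Fin q → ℝ) :=
  ⟨c.map.target ∩ c.map.symm ⁻¹' W, c.map.isOpen_inter_preimage_symm W.2⟩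

/-- The coordinate functions `x^I` of a chart. -/
def SuperChart.coord (c : SuperChart M q n) (I : Fin q ⊕ Fin n) : M.sec c.dom :=
  (c.iso c.dom subset_rfl).symm (modelCoord (c.img c.dom) I)

theorem SuperChart.symm_mem (c : SuperChart M q n) {W : Opens M.carrier} (hW : W ≤ c.dom)
    {i : ZMod 2} {f : SuperFun n (c.img W)} (hf : ∀ y, f.1 y ∈ Grassmann.part n i) :
    (c.iso W hW).symm f ∈ M.par W i := by
  obtain ⟨a, ha, b, hb, hab⟩ := Submodule.mem_sup.1
    ((M.par_isCompl W).sup_eq_top ▸ Submodule.mem_top (x := (c.iso W hW).symm f))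
  have hf' : f = c.iso W hW a + c.iso W hW b := by
    rw [← map_add, hab, AlgEquiv.apply_symm_apply]
  have hdis := (CliffordAlgebra.evenOdd_isCompl
    (0 : QuadraticForm ℝ (Fin n → ℝ))).disjoint
  have key : ∀ (k l : ZMod 2) (a b : M.sec W), k ≠ l → a ∈ M.par W k → b ∈ M.par W l →
      f = c.iso W hW a + c.iso W hW b → (∀ y, f.1 y ∈ Grassmann.part n k) → b = 0 := by
    intro k l a b hkl ha hb e hk
    apply (c.iso W hW).injective
    rw [map_zero]
    refine Subtype.ext (funext fun y => ?_)
    have h1 := c.iso_par W hW _ a ha y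
    have h2 := c.iso_par W hW _ b hb y
    have h3 : (c.iso W hW b).1 y = f.1 y - (c.iso W hW a).1 y := by
      rw [e]; exact (add_sub_cancel_left ((c.iso W hW a).1 y) ((c.iso W hW b).1 y)).symm
    have h4 : (c.iso W hW b).1 y ∈ Grassmann.part n k := by
      rw [h3]; exact Submodule.sub_mem _ (hk y) h1
    rcases parity_cases k with rfl | rfl <;> rcases parity_cases l with rfl | rfl
    · exact absurd rfl hkl
    · exact Submodule.disjoint_def.1 hdis _ h4 h2
    · exact Submodule.disjoint_def.1 hdis _ h2 h4
    · exact absurd rfl hkl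
  rcases parity_cases i with rfl | rfl
  · rw [← hab, key 0 1 a b (by decide) ha hb hf' hf, add_zero]; exact ha
  · rw [← hab, key 1 0 b a (by decide) hb ha (by rw [hf', add_comm]) hf, zero_add]; exact hb

/-- The natural frame `∂/∂x^I` of a chart. -/
def SuperChart.frame (c : SuperChart M q n) (I : Fin q ⊕ Fin n) : Der M c.dom (idxPar I) :=
  ⟨fun W => (c.iso W.1 W.2).symm.toLinearMap ∘ₗ modelDeriv (c.img W.1) I ∘ₗ
      (c.iso W.1 W.2).toLinearMap, by
    refine ⟨fun W W' hW h a => ?_, fun W hW k a ha => ?_, fun W hW k a b ha => ?_⟩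
    · apply (c.iso W' (h.trans hW)).injective
      refine Subtype.ext (funext fun y => ?_)
      refine (c.iso_res W W' hW h _ y.1 y.2).trans ?_
      simp only [LinearMap.comp_apply, AlgEquiv.toLinearMap_apply, AlgEquiv.apply_symm_apply]
      exact (modelDeriv_local (V := c.img W) (V' := c.img W') (fun z hz => ⟨hz.1, h hz.2⟩) I _ _
        (fun z hz => c.iso_res W W' hW h a z hz) y.1 y.2).symm
    · exact c.symm_mem hW (modelDeriv_mem I (c.iso_par W hW k a ha))
    · apply (c.iso W hW).injective
      simp only [LinearMap.comp_apply, AlgEquiv.toLinearMap_apply, AlgEquiv.apply_symm_apply,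
        map_mul, map_add, map_smul]
      exact modelDeriv_mul I (c.iso_par W hW k a ha) _⟩

end Charts

section Geometry

variable {M : SuperSpace.{u}}

variable (M) in
/-- Pairings of vector fields, over every open set. -/
abbrev Pairing : Type u := ∀ U : Opens M.carrier, VF M U → VF M U → M.sec U

/-- An even Riemannian metric on a supermanifold of dimension `q|n`. Non-degenerate means that in
every chart the matrix `⟨∂_I, ∂_J⟩` is invertible. -/
structure IsRiemannianMetric (q n : ℕ) (g : Pairing M) : Prop where
  res : ∀ {U V : Opens M.carrier} (h : V ≤ U) (X Y : VF M U),
    M.res h (g U X Y) = g V (restr h X) (restr h Y)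
  add_left : ∀ (U : Opens M.carrier) (X Y Z : VF M U), g U (X + Y) Z = g U X Z + g U Y Z
  add_right : ∀ (U : Opens M.carrier) (X Y Z : VF M U), g U X (Y + Z) = g U X Y + g U X Z
  smul_left : ∀ (U : Opens M.carrier) (f : M.sec U) (X Y : VF M U),
    g U (fmul f X) Y = f * g U X Y
  even : ∀ (U : Opens M.carrier) {i j : ZMod 2} (X : Der M U i) (Y : Der M U j),
    g U (vf X) (vf Y) ∈ M.par U (i + j)
  symm : ∀ (U : Opens M.carrier) {i j : ZMod 2} (X : Der M U i) (Y : Der M U j),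
    g U (vf X) (vf Y) = sgn (i * j) • g U (vf Y) (vf X)
  nondegenerate : ∀ c : SuperChart M q n, IsUnit
    (Matrix.of fun I J => g c.dom (vf (c.frame I)) (vf (c.frame J)))

variable (M) in
/-- Affine connections. -/
structure AffineConnection where
  nabla : ∀ U : Opens M.carrier, VF M U → VF M U → VF M U
  res : ∀ {U V : Opens M.carrier} (h : V ≤ U) (X Y : VF M U),
    restr h (nabla U X Y) = nabla V (restr h X) (restr h Y)
  degree : ∀ (U : Opens M.carrier) {i j : ZMod 2} (X : Der M U i) (Y : Der M U j),
    (nabla U (vf X) (vf Y)).1 ∈ Der M U (i + j)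
  add_left : ∀ (U : Opens M.carrier) (X Y Z : VF M U),
    nabla U (X + Y) Z = nabla U X Z + nabla U Y Z
  add_right : ∀ (U : Opens M.carrier) (X Y Z : VF M U),
    nabla U X (Y + Z) = nabla U X Y + nabla U X Z
  smul_left : ∀ (U : Opens M.carrier) (f : M.sec U) (X Y : VF M U),
    nabla U (fmul f X) Y = fmul f (nabla U X Y)
  leibniz : ∀ (U : Opens M.carrier) {i j : ZMod 2} (X : Der M U i) (f : M.sec U) (Y : VF M U),
    f ∈ M.par U j → nabla U (vf X) (fmul f Y) =
      fmul (act (vf X) f) Y + sgn (i * j) • fmul f (nabla U (vf X) Y)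

/-- `D` is the Levi-Civita connection of `g`: torsion free and metric compatible. -/
structure IsLeviCivita (g : Pairing M) (D : AffineConnection M) : Prop where
  torsion_free : ∀ (U : Opens M.carrier) {i j : ZMod 2} (X : Der M U i) (Y : Der M U j),
    D.nabla U (vf X) (vf Y) - sgn (i * j) • D.nabla U (vf Y) (vf X) - vf (bracket X Y) = 0
  metric : ∀ (U : Opens M.carrier) {i j : ZMod 2} (X : Der M U i) (Y : Der M U j) (Z : VF M U),
    act (vf X) (g U (vf Y) Z) =
      g U (D.nabla U (vf X) (vf Y)) Z + sgn (i * j) • g U (vf Y) (D.nabla U (vf X) Z)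

/-- `D'` is the semi-symmetric non-metric connection of `g` and the even vector field `P`:
`D'_X Y = D_X Y + (-1)^{|X||Y|} g(Y, P) X`, where `D` is the Levi-Civita connection of `g`. -/
def IsSemiSymmetricNonMetric (g : Pairing M) (P : VF M ⊤) (D' : AffineConnection M) : Prop :=
  ∃ D : AffineConnection M, IsLeviCivita g D ∧
    ∀ (U : Opens M.carrier) {i j : ZMod 2} (X : Der M U i) (Y : Der M U j),
      D'.nabla U (vf X) (vf Y) = D.nabla U (vf X) (vf Y) +
        sgn (i * j) • fmul (g U (vf Y) (restr le_top P)) (vf X)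

/-- The curvature `R(X, Y) Z`. -/
def curvature (D : AffineConnection M) {U : Opens M.carrier} {i j : ZMod 2} (X : Der M U i)
    (Y : Der M U j) (Z : VF M U) : VF M U :=
  D.nabla U (vf X) (D.nabla U (vf Y) Z) - sgn (i * j) • D.nabla U (vf Y) (D.nabla U (vf X) Z) -
    D.nabla U (vf (bracket X Y)) Z

/-- The Ricci tensor `Ric(X, Y)`, computed in the natural frame of a chart. The coefficient of
`∂/∂x^I` in a vector field `Z` is `Z(x^I)`. -/
def ricci {q n : ℕ} (D : AffineConnection M) (c : SuperChart M q n) {i j : ZMod 2}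
    (X : Der M c.dom i) (Y : Der M c.dom j) : M.sec c.dom :=
  ∑ I : Fin q ⊕ Fin n, sgn (idxPar I * (idxPar I + i + j)) • (1 / 2 : ℝ) •
    act (curvature D (c.frame I) X (vf Y) +
      sgn (i * j) • curvature D (c.frame I) Y (vf X)) (c.coord I)

/-- `Ric = k g` for the connection `D`. -/
def IsEinstein (q n : ℕ) (g : Pairing M) (D : AffineConnection M) (k : ℝ) : Prop :=
  ∀ (c : SuperChart M q n) {i j : ZMod 2} (X : Der M c.dom i) (Y : Der M c.dom j),
    ricci D c X Y = k • g c.dom (vf X) (vf Y)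

end Geometry


section Product

variable {M : SuperSpace.{u}} {q n : ℕ}

/-- The slice `{x | (t, x) ∈ W}`. -/
def slice (W : Opens (ℝ × M.carrier)) (t : ℝ) : Opens M.carrier :=
  ⟨{x | (t, x) ∈ W}, W.2.preimage (by fun_prop)⟩

theorem slice_mono {W W' : Opens (ℝ × M.carrier)} (h : W' ≤ W) (t : ℝ) :
    slice W' t ≤ slice W t := fun _ hx => h hx

/-- The part of `ℝ × ℝ^q` that corresponds to `W` under the chart `c`. -/
def prodImg (c : SuperChart M q n) (W : Opens (ℝ × M.carrier)) : Opens (ℝ × (Fin q → ℝ)) :=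
  ⟨{p | p.2 ∈ c.map.target ∧ (p.1, c.map.symm p.2) ∈ W}, by
    have h : ContinuousOn (fun p : ℝ × (Fin q → ℝ) => (p.1, c.map.symm p.2))
        {p | p.2 ∈ c.map.target} :=
      continuousOn_fst.prodMk (c.map.continuousOn_symm.comp continuousOn_snd fun _ hp => hp)
    exact h.isOpen_inter_preimage (c.map.open_target.preimage continuous_snd) W.2⟩

/-- Evaluation at `y`, in the chart `c`, of a section over `U`. -/
def evalAt (c : SuperChart M q n) (U : Opens M.carrier) (y : Fin q → ℝ)
    (hy : y ∈ c.map.target ∧ c.map.symm y ∈ U) : M.sec U →ₐ[ℝ] Grassmann n :=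
  (((Pi.evalAlgHom ℝ (fun _ : c.img (U ⊓ c.dom) => Grassmann n)
    ⟨y, hy.1, hy.2, c.map.map_target hy.1⟩).comp (SuperFun n (c.img (U ⊓ c.dom))).val).comp
    (c.iso (U ⊓ c.dom) inf_le_right).toAlgHom).comp (M.res inf_le_left)

/-- A family `(s_t)` of sections over the slices of `W`, read in the chart `c` as a
Grassmann-valued function of `(t, y)`. -/
def chartExpr (c : SuperChart M q n) (W : Opens (ℝ × M.carrier)) :
    (∀ t, M.sec (slice W t)) →ₐ[ℝ] (prodImg c W → Grassmann n) :=
  AlgHom.pi fun p => (evalAt c (slice W p.1.1) p.1.2 p.2).comp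
    (Pi.evalAlgHom ℝ (fun t => M.sec (slice W t)) p.1.1)

variable (M q n) in
/-- The sections of `ℝ^{1|0} × M` over `W`: the families `(s_t)` of sections of `M` over the slices
of `W` that depend smoothly on `t`, i.e. that are in every chart of `M` superfunctions of
`(t, y)`. -/
def prodSec (W : Opens (ℝ × M.carrier)) : Subalgebra ℝ (∀ t, M.sec (slice W t)) :=
  ⨅ c : SuperChart M q n, (SuperFun n (prodImg c W)).comap (chartExpr c W)

theorem mem_prodSec {W : Opens (ℝ × M.carrier)} {s : ∀ t, M.sec (slice W t)} :
    s ∈ prodSec M q n W ↔ ∀ c : SuperChart M q n, IsSmooth (chartExpr c W s) := by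
  rw [prodSec, Algebra.mem_iInf]
  exact Iff.rfl

theorem evalAt_res (c : SuperChart M q n) {U V : Opens M.carrier} (h : V ≤ U) (y : Fin q → ℝ)
    (hy : y ∈ c.map.target ∧ c.map.symm y ∈ V) (f : M.sec U) :
    evalAt c V y hy (M.res h f) = evalAt c U y ⟨hy.1, h hy.2⟩ f := by
  change (c.iso (V ⊓ c.dom) inf_le_right (M.res inf_le_left (M.res h f))).1 ⟨y, _⟩ =
    (c.iso (U ⊓ c.dom) inf_le_right (M.res inf_le_left f)).1 ⟨y, _⟩
  have e : M.res (inf_le_left : V ⊓ c.dom ≤ V) (M.res h f) =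
      M.res (inf_le_inf_right c.dom h) (M.res (inf_le_left : U ⊓ c.dom ≤ U) f) := by
    rw [M.res_res, M.res_res]
  rw [e]
  exact c.iso_res _ _ inf_le_right (inf_le_inf_right c.dom h) _ y ⟨hy.1, hy.2, c.map.map_target hy.1⟩

theorem evalAt_mem (c : SuperChart M q n) {U : Opens M.carrier} (y : Fin q → ℝ)
    (hy : y ∈ c.map.target ∧ c.map.symm y ∈ U) {i : ZMod 2} {f : M.sec U} (hf : f ∈ M.par U i) :
    evalAt c U y hy f ∈ Grassmann.part n i :=
  c.iso_par _ _ i _ (M.res_mem _ hf) _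

/-- Restriction of families. -/
def prodRes {W W' : Opens (ℝ × M.carrier)} (h : W' ≤ W) :
    prodSec M q n W →ₐ[ℝ] prodSec M q n W' :=
  ((AlgHom.pi fun t => (M.res (slice_mono h t)).comp
    (Pi.evalAlgHom ℝ (fun t => M.sec (slice W t)) t)).comp (prodSec M q n W).val).codRestrict _
    fun s => mem_prodSec.2 fun c S => by
      refine ((mem_prodSec.1 s.2 c S).mono fun p hp => ⟨hp.1, h hp.2⟩).congr fun p hp => ?_
      have hp' : p ∈ prodImg c W := ⟨hp.1, h hp.2⟩
      rw [coef_of_mem _ _ hp, coef_of_mem _ _ hp']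
      exact congrArg (fun a => (monomials n).repr a S)
        (evalAt_res c (slice_mono h p.1) p.2 hp (s.1 p.1))

theorem prod_split {W : Opens (ℝ × M.carrier)} (s : prodSec M q n W) :
    ∃ a b : prodSec M q n W, (∀ t, a.1 t ∈ M.par (slice W t) 0) ∧
      (∀ t, b.1 t ∈ M.par (slice W t) 1) ∧ a + b = s := by
  have h : ∀ t, ∃ a b, a ∈ M.par (slice W t) 0 ∧ b ∈ M.par (slice W t) 1 ∧ a + b = s.1 t := by
    intro t
    obtain ⟨a, ha, b, hb, hab⟩ := Submodule.mem_sup.1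
      ((M.par_isCompl (slice W t)).sup_eq_top ▸ Submodule.mem_top (x := s.1 t))
    exact ⟨a, b, ha, hb, hab⟩
  choose a b ha hb hab using h
  have hs : a + b = s.1 := funext hab
  let L : Grassmann n →ₗ[ℝ] Grassmann n := Submodule.projection _ _
    (CliffordAlgebra.evenOdd_isCompl (0 : QuadraticForm ℝ (Fin n → ℝ)))
  have hA : a ∈ prodSec M q n W := mem_prodSec.2 fun c => by
    have e : chartExpr c W a = fun p => L (chartExpr c W s.1 p) := by
      funext p
      have h1 : chartExpr c W a p ∈ Grassmann.part n 0 := evalAt_mem c (U := slice W p.1.1) p.1.2 p.2 (ha _)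
      have h2 : chartExpr c W b p ∈ Grassmann.part n 1 := evalAt_mem c (U := slice W p.1.1) p.1.2 p.2 (hb _)
      have h3 : chartExpr c W s.1 p = chartExpr c W a p + chartExpr c W b p := by
        rw [← hs, map_add]; rfl
      rw [h3, map_add]
      have h4 : L (chartExpr c W a p) = chartExpr c W a p :=
        Submodule.projection_apply_of_mem_left _ h1
      have h5 : L (chartExpr c W b p) = 0 := (Submodule.projection_apply_eq_zero_iff _).2 h2
      rw [h4, h5, add_zero]
    rw [e]
    exact (mem_prodSec.1 s.2 c).map L
  have hB : b ∈ prodSec M q n W := by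
    have : b = s.1 - a := by rw [← hs, add_sub_cancel_left]
    rw [this]
    exact Subalgebra.sub_mem _ s.2 hA
  exact ⟨⟨a, hA⟩, ⟨b, hB⟩, ha, hb, Subtype.ext hs⟩

variable (M q n) in
/-- The product `ℝ^{1|0} × M` with a supermanifold `M` of dimension `q|n`. -/
def lineProd : SuperSpace.{u} where
  carrier := ℝ × M.carrier
  sec W := prodSec M q n W
  par W i :=
    { carrier := {s | ∀ t, s.1 t ∈ M.par (slice W t) i}
      add_mem' := fun ha hb t => Submodule.add_mem _ (ha t) (hb t)
      zero_mem' := fun _ => Submodule.zero_mem _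
      smul_mem' := fun r _ ha t => Submodule.smul_mem _ r (ha t) }
  res h := prodRes h
  par_isCompl W := by
    refine ⟨Submodule.disjoint_def.2 fun s h0 h1 => ?_, ?_⟩
    · exact Subtype.ext (funext fun t =>
        Submodule.disjoint_def.1 (M.par_isCompl (slice W t)).disjoint _ (h0 t) (h1 t))
    · rw [codisjoint_iff, eq_top_iff]
      intro s _
      obtain ⟨a, b, ha, hb, hab⟩ := prod_split s
      exact Submodule.mem_sup.2 ⟨a, ha, b, hb, hab⟩
  one_mem W t := M.one_mem _
  mul_mem ha hb t := M.mul_mem (ha t) (hb t)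
  supercomm ha hb := Subtype.ext (funext fun t => M.supercomm (ha t) (hb t))
  res_mem h _ _ ha t := M.res_mem _ (ha t)
  res_id a := Subtype.ext (funext fun t => M.res_id _)
  res_res h h' a := Subtype.ext (funext fun t => M.res_res _ _ _)
  glue {ι} U V hV hcov s hs := by
    have hc : ∀ t, ∀ x ∈ slice U t, ∃ i, x ∈ slice (V i) t := fun t x hx => hcov (t, x) hx
    have hcomp : ∀ t i j (W : Opens M.carrier) (hi : W ≤ slice (V i) t) (hj : W ≤ slice (V j) t),
        M.res hi ((s i).1 t) = M.res hj ((s j).1 t) := by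
      intro t i j W hi hj
      have h1 := congrFun (congrArg Subtype.val
        (hs i j (V i ⊓ V j) inf_le_left inf_le_right)) t
      have h2 : W ≤ slice (V i ⊓ V j) t := fun x hx => ⟨hi hx, hj hx⟩
      have h3 := congrArg (M.res h2) h1
      change M.res h2 (M.res _ ((s i).1 t)) = M.res h2 (M.res _ ((s j).1 t)) at h3
      rwa [M.res_res, M.res_res] at h3
    have hex := fun t => M.glue (slice U t) (fun i => slice (V i) t)
      (fun i => slice_mono (hV i) t) (hc t) (fun i => (s i).1 t) (hcomp t)
    choose a ha hua using hex
    have hA : a ∈ prodSec M q n U := mem_prodSec.2 fun c S p hp => by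
      obtain ⟨i, hi⟩ := hcov (p.1, c.map.symm p.2) hp.2
      have hpi : p ∈ prodImg c (V i) := ⟨hp.1, hi⟩
      have h1 := (mem_prodSec.1 (s i).2 c S).contDiffAt ((prodImg c (V i)).2.mem_nhds hpi)
      refine (h1.congr_of_eventuallyEq ?_).contDiffWithinAt
      filter_upwards [(prodImg c (V i)).2.mem_nhds hpi] with z hz
      have hz' : z ∈ prodImg c U := ⟨hz.1, hV i hz.2⟩
      rw [coef_of_mem _ _ hz, coef_of_mem _ _ hz']
      refine congrArg (fun a => (monomials n).repr a S) ?_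
      have h2 := evalAt_res c (slice_mono (hV i) z.1) z.2 hz (a z.1)
      rw [ha z.1 i] at h2
      exact h2.symm
    refine ⟨⟨a, hA⟩, fun i => Subtype.ext (funext fun t => ha t i), fun b hb => ?_⟩
    exact Subtype.ext (funext fun t => hua t (b.1 t) fun i =>
      congrFun (congrArg Subtype.val (hb i)) t)

variable (q n) in
/-- The cylinder `ℝ × V`. -/
def cyl (V : Opens M.carrier) : Opens (lineProd M q n).carrier :=
  ⟨{p | p.2 ∈ V}, V.2.preimage continuous_snd⟩

/-- The coordinate `t` of `ℝ^{1|0}` as a section of the product. -/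
def timeSec (W : Opens (lineProd M q n).carrier) : (lineProd M q n).sec W :=
  ⟨fun t => algebraMap ℝ _ t, mem_prodSec.2 fun c =>
    .of_coef (fun S p => p.1 * (monomials n).repr 1 S)
      (fun S => contDiffOn_fst.mul contDiffOn_const) fun S p => by
        have h : chartExpr c W (fun t => algebraMap ℝ _ t) p =
            algebraMap ℝ (Grassmann n) p.1.1 := (evalAt c (slice W p.1.1) p.1.2 p.2).commutes _
        rw [h, Algebra.algebraMap_eq_smul_one, map_smul, Finsupp.smul_apply, smul_eq_mul]⟩

/-- The pull-back under the projection `ℝ^{1|0} × M → M`, restricted to `W ⊆ ℝ × V`. -/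
def pull {V : Opens M.carrier} {W : Opens (lineProd M q n).carrier} (h : W ≤ cyl q n V) :
    M.sec V →ₐ[ℝ] (lineProd M q n).sec W :=
  (AlgHom.pi fun t => M.res (show slice W t ≤ V from fun _ hx => h hx)).codRestrict
    (prodSec M q n W) fun f => mem_prodSec.2 fun c S => by
      have hV : ContDiffOn ℝ ∞ (coef (c.iso (V ⊓ c.dom) inf_le_right (M.res inf_le_left f)).1 S ∘
          (Prod.snd : ℝ × (Fin q → ℝ) → _)) (prodImg c W) :=
        (superFun_smooth (c.iso (V ⊓ c.dom) inf_le_right (M.res inf_le_left f)) S).comp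
          contDiffOn_snd fun p hp => ⟨hp.1, h hp.2, c.map.map_target hp.1⟩
      refine hV.congr fun p hp => ?_
      rw [coef_of_mem _ _ hp, Function.comp_apply,
        coef_of_mem _ _ (show p.2 ∈ c.img (V ⊓ c.dom) from
          ⟨hp.1, h hp.2, c.map.map_target hp.1⟩)]
      exact congrArg (fun a => (monomials n).repr a S)
        (evalAt_res c (show slice W p.1 ≤ V from fun _ hx => h hx) p.2 hp f)

theorem le_slice {W : Opens (lineProd M q n).carrier} {t : ℝ} {V : Opens M.carrier}
    (hV : V ≤ slice W t) :
    V ≤ slice (W ⊓ cyl q n V) t := fun _ hx => ⟨hV hx, hx⟩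

/-- The component along `M`, at time `t`, of an operator on sections of the product:
`f ↦ X(π₂^* f)` restricted to the slice at `t`. -/
def vertFam (W : Opens (lineProd M q n).carrier) (t : ℝ) :
    Fam (lineProd M q n) W →ₗ[ℝ] Fam M (slice W t) where
  toFun D V :=
    { toFun := fun f => M.res (le_slice V.2)
        ((D ⟨W ⊓ cyl q n V.1, inf_le_left⟩ (pull inf_le_right f)).1 t)
      map_add' := fun f g => by rw [map_add, map_add]; exact map_add _ _ _
      map_smul' := fun r f => by rw [map_smul, map_smul]; exact map_smul _ _ _ }
  map_add' D D' := by
    funext V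
    refine LinearMap.ext fun f => ?_
    exact map_add (M.res (le_slice V.2)) _ _
  map_smul' r D := by
    funext V
    refine LinearMap.ext fun f => ?_
    exact map_smul (M.res (le_slice V.2)) r _

theorem res_pull {V V' : Opens M.carrier} {W W' : Opens (lineProd M q n).carrier} (h : W ≤ cyl q n V)
    (h' : W' ≤ cyl q n V') (hV : V' ≤ V) (hW : W' ≤ W) (f : M.sec V) :
    (lineProd M q n).res hW (pull h f) = pull h' (M.res hV f) :=
  Subtype.ext (funext fun _ => (M.res_res _ _ _).trans (M.res_res _ _ _).symm)

theorem pull_mem {V : Opens M.carrier} {W : Opens (lineProd M q n).carrier} (h : W ≤ cyl q n V) {i : ZMod 2}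
    {f : M.sec V} (hf : f ∈ M.par V i) : pull h f ∈ (lineProd M q n).par W i :=
  fun _ => M.res_mem _ hf

theorem res_slice_pull {W : Opens (lineProd M q n).carrier} {t : ℝ} {V : Opens M.carrier}
    (hV : V ≤ slice W t) (f : M.sec V) :
    M.res (le_slice hV) ((pull (q := q) (n := n) (inf_le_right : W ⊓ cyl q n V ≤ cyl q n V) f).1 t) = f :=
  (M.res_res _ _ _).trans (M.res_id f)

theorem vertFam_mem (W : Opens (lineProd M q n).carrier) (t : ℝ) (i : ZMod 2)
    (D : Fam (lineProd M q n) W) (hD : D ∈ Der (lineProd M q n) W i) :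
    vertFam W t D ∈ Der M (slice W t) i := by
  refine ⟨fun V V' hV h f => ?_, fun V hV j f hf => ?_, fun V hV j f g hf => ?_⟩
  · change M.res h (M.res (le_slice hV) ((D ⟨W ⊓ cyl q n V, _⟩ (pull inf_le_right f)).1 t)) =
      M.res (le_slice (h.trans hV)) ((D ⟨W ⊓ cyl q n V', _⟩ (pull inf_le_right (M.res h f))).1 t)
    have hc : W ⊓ cyl q n V' ≤ W ⊓ cyl q n V := fun p hp => ⟨hp.1, h hp.2⟩
    rw [← res_pull (inf_le_right : W ⊓ cyl q n V ≤ cyl q n V) inf_le_right h hc f,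
      ← hD.1 (W ⊓ cyl q n V) (W ⊓ cyl q n V') inf_le_left hc]
    exact (M.res_res _ _ _).trans (M.res_res _ _ _).symm
  · exact M.res_mem _ (hD.2.1 (W ⊓ cyl q n V) inf_le_left j _ (pull_mem _ hf) t)
  · change M.res (le_slice hV) ((D ⟨W ⊓ cyl q n V, _⟩ (pull inf_le_right (f * g))).1 t) = _
    rw [map_mul, hD.2.2 (W ⊓ cyl q n V) inf_le_left j _ _ (pull_mem _ hf)]
    refine (map_add (M.res (le_slice hV)) _ _).trans ?_
    refine congrArg₂ (· + ·) ((map_mul (M.res (le_slice hV)) _ _).trans ?_)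
      ((map_smul (M.res (le_slice hV)) _ _).trans (congrArg (sgn (i * j) • ·)
        ((map_mul (M.res (le_slice hV)) _ _).trans ?_)))
    · exact congrArg (_ * ·) (res_slice_pull hV g)
    · exact congrArg (· * _) (res_slice_pull hV f)

/-- The component along `M`, at time `t`, of a vector field on the product. -/
def vert {W : Opens (lineProd M q n).carrier} (X : VF (lineProd M q n) W) (t : ℝ) : VF M (slice W t) :=
  ⟨vertFam W t X.1, vf_map (M := lineProd M q n) (N := M) (vertFam W t) (vertFam_mem W t) X.2⟩

open Classical in
variable (q n) in
/-- The warped product metric `-dt ⊗ dt + h² g` on `ℝ^{1|0} × M`: the value at `(X, Y)` is the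
family of sections `-X(t) Y(t) + h(t)² g(X_t, Y_t)`, where `X_t`, `Y_t` are the components along
`M`. (The family is smooth in `t`; the value `0` off the smooth families is never used.) -/
def warped (h : ℝ → ℝ) (g : Pairing M) : Pairing (lineProd M q n) := fun W X Y =>
  let s : ∀ t, M.sec (slice W t) := fun t =>
    -((act X (timeSec W)).1 t * (act Y (timeSec W)).1 t) +
      h t ^ 2 • g (slice W t) (vert X t) (vert Y t)
  if hs : s ∈ prodSec M q n W then ⟨s, hs⟩ else 0

/-- `T` is the vector field `∂_t` on `ℝ^{1|0} × M`: even, `T(t) = 1`, and `T(π₂^* f) = 0` for the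
sections `f` of `M`. -/
structure IsPartialT (T : VF (lineProd M q n) ⊤) : Prop where
  even : T.1 ∈ Der (lineProd M q n) ⊤ 0
  time : act T (timeSec ⊤) = 1
  pull : ∀ V : Opens M.carrier, T.1 ⟨cyl q n V, le_top⟩ ∘ₗ (pull (le_refl (cyl q n V))).toLinearMap = 0

open Classical in
variable (M q n) in
/-- The vector field `∂_t` on `ℝ^{1|0} × M`. -/
def partialT : VF (lineProd M q n) ⊤ :=
  if h : ∃ T : VF (lineProd M q n) ⊤, IsPartialT T then h.choose else 0

end Product

end SuperGeom

end

/-! Locally the product has a frame consisting of ∂_t and the lifts of a frame of M₂, and everything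
is computed on such fields. For the Levi-Civita connection of g_μ and lifts X, Y, the Koszul formula
gives ∇_∂t ∂t = 0, ∇_∂t X = ∇_X ∂t = (h'/h) X and ∇_X Y = h h' g₂(X,Y) ∂t + ∇²_X Y. Since g_μ(∂t,∂t)
= -1 and lifts are orthogonal to ∂t, the semi-symmetric term only changes ∇_∂t ∂t, to -∂t, and ∇_X
∂t, to (h'/h - 1) X (`hasWarpedForm`). For every connection of this shape the Leibniz rule yields
the curvature (`HasWarpedForm.curvature_lift` and its companions). Taking supertraces, where the
superdimension q - n plays the role of the dimension, one finds Ric(∂t,∂t) = -(q-n)(h''/h - 1),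
Ric(∂t,X) = 0, Ric(X,Y) = Ric₂(X,Y) + (h h'' - h h' + (q-n-1)(h'² - h h')) g₂(X,Y). These are
compared with the values -λ, 0 and λ h² g₂(X,Y) of λ g_μ. The first comparison is condition 2. The
last one says that at every time t, Ric₂ is g₂ times the left-hand side of condition 3. Neither Ric₂
nor g₂ depends on t, and g₂ has a non-zero entry (`exists_metric_ne_zero`), so that this factor is a
constant c₀ (`isEinstein_warped_iff`).

Most of the work is foundational. A section of the product is a family of sections of M₂ that is
smooth in every chart; that one chart suffices (`contDiffAt_chartExpr`) rests on
`isSmooth_apply_family`: Hadamard's lemma is a Taylor expansion with remainder, and the expansion of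
a superfunction stops because elements of zero body are nilpotent. This gives the product charts
(`prodChart`). Derivations are determined by their values on coordinates (`der_eq_zero`), whence
frame expansions and, by gluing, the field ∂_t (`exists_isPartialT`).

Both sides of the equivalence assert that a connection exists, so Levi-Civita connections must be
constructed: the Koszul formula is solved in charts, and uniqueness lets the solutions be glued
(`exists_isLeviCivita`). For the warped metric, non-degeneracy is only needed, and only shown, in
product charts; this is why `IsEvenPairing` and `LocallyNondegenerate` are kept apart. Finally, the
Einstein condition refers to all charts of the product, and `supertrace_eq` reduces it to the
product charts. -/

noncomputable section

namespace SuperGeom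

/-! ### Smooth dependence of integrals on parameters; Hadamard's lemma. -/

section ParametricIntegral

open MeasureTheory Set Filter Topology

variable {E F : Type} [NormedAddCommGroup E] [NormedSpace ℝ E] [NormedAddCommGroup F]
  [NormedSpace ℝ F]

theorem intervalIntegrable_slice {Ω : Set (E × ℝ)} {H : E × ℝ → F} (hH : ContinuousOn H Ω) {x : E}
    (hx : ∀ s ∈ Icc (0 : ℝ) 1, (x, s) ∈ Ω) :
    IntervalIntegrable (fun s => H (x, s)) volume 0 1 := by
  refine ContinuousOn.intervalIntegrable ?_
  rw [uIcc_of_le zero_le_one]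
  exact hH.comp (by fun_prop) fun s hs => hx s hs

/-- The norm is bounded on the compact slice over `x`, and by the tube lemma the bound plus one
persists on nearby slices. This supplies the constant dominating functions used below. -/
theorem eventually_norm_le_of_continuousOn {Ω : Set (E × ℝ)} (hΩ : IsOpen Ω) {H : E × ℝ → F}
    (hH : ContinuousOn H Ω) {x : E} (hx : ∀ s ∈ Icc (0 : ℝ) 1, (x, s) ∈ Ω) :
    ∃ C : ℝ, ∀ᶠ y in 𝓝 x, ∀ s ∈ Icc (0 : ℝ) 1, (y, s) ∈ Ω ∧ ‖H (y, s)‖ ≤ C := by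
  have hc : ContinuousOn (fun s : ℝ => H (x, s)) (Icc 0 1) := hH.comp (by fun_prop) hx
  obtain ⟨C, hC⟩ := isCompact_Icc.exists_bound_of_continuousOn hc
  refine ⟨C + 1, isCompact_Icc.eventually_forall_of_forall_eventually fun s hs => ?_⟩
  have h1 : ContinuousAt H (x, s) := hH.continuousAt (hΩ.mem_nhds (hx s hs))
  have h2 : ∀ᶠ z in 𝓝 (x, s), ‖H z‖ < C + 1 :=
    h1.norm.eventually_lt continuousAt_const (by linarith [hC s hs])
  filter_upwards [hΩ.mem_nhds (hx s hs), h2] with z hz hz'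
  exact ⟨hz, hz'.le⟩

theorem continuousOn_integral_slice {Ω : Set (E × ℝ)} (hΩ : IsOpen Ω) {O : Set E}
    {H : E × ℝ → F} (hH : ContinuousOn H Ω) (hO : ∀ x ∈ O, ∀ s ∈ Icc (0 : ℝ) 1, (x, s) ∈ Ω) :
    ContinuousOn (fun x => ∫ s in (0 : ℝ)..1, H (x, s)) O := by
  intro x hx
  obtain ⟨C, hC⟩ := eventually_norm_le_of_continuousOn hΩ hH (hO x hx)
  refine ContinuousAt.continuousWithinAt ?_
  refine intervalIntegral.continuousAt_of_dominated_interval (bound := fun _ => C) ?_ ?_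
    intervalIntegrable_const ?_
  · filter_upwards [hC] with y hy
    exact (intervalIntegrable_slice hH fun s hs => (hy s hs).1).def'.aestronglyMeasurable
  · filter_upwards [hC] with y hy
    refine Eventually.of_forall fun s hs => ?_
    rw [uIoc_of_le zero_le_one] at hs
    exact (hy s ⟨hs.1.le, hs.2⟩).2
  · refine Eventually.of_forall fun s hs => ?_
    rw [uIoc_of_le zero_le_one] at hs
    have h1 : ContinuousAt H (x, s) := hH.continuousAt (hΩ.mem_nhds (hO x hx s ⟨hs.1.le, hs.2⟩))
    exact ContinuousAt.comp (f := fun y => (y, s)) h1 (by fun_prop)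

theorem hasFDerivAt_integral_slice {Ω : Set (E × ℝ)} (hΩ : IsOpen Ω)
    {H : E × ℝ → F} (hH : ContDiffOn ℝ 1 H Ω) {x : E}
    (hO : ∀ s ∈ Icc (0 : ℝ) 1, (x, s) ∈ Ω) :
    HasFDerivAt (fun x => ∫ s in (0 : ℝ)..1, H (x, s))
      (∫ s in (0 : ℝ)..1, (fderiv ℝ H (x, s)).comp (ContinuousLinearMap.inl ℝ E ℝ)) x := by
  have hd : ContinuousOn (fun z => (fderiv ℝ H z).comp (ContinuousLinearMap.inl ℝ E ℝ)) Ω :=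
    (hH.continuousOn_fderiv_of_isOpen hΩ le_rfl).clm_comp continuousOn_const
  obtain ⟨C, hC⟩ := eventually_norm_le_of_continuousOn hΩ hd hO
  refine intervalIntegral.hasFDerivAt_integral_of_dominated_of_fderiv_le (bound := fun _ => C)
    (F' := fun x s => (fderiv ℝ H (x, s)).comp (ContinuousLinearMap.inl ℝ E ℝ)) hC ?_
    (intervalIntegrable_slice hH.continuousOn hO)
    (intervalIntegrable_slice hd hO).def'.aestronglyMeasurable ?_ intervalIntegrable_const ?_
  · filter_upwards [hC] with y hy
    exact (intervalIntegrable_slice hH.continuousOn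
      fun s hs => (hy s hs).1).def'.aestronglyMeasurable
  · refine Eventually.of_forall fun s hs y hy => ?_
    rw [uIoc_of_le zero_le_one] at hs
    exact (hy s ⟨hs.1.le, hs.2⟩).2
  · refine Eventually.of_forall fun s hs y hy => ?_
    rw [uIoc_of_le zero_le_one] at hs
    have h1 : HasFDerivAt H (fderiv ℝ H (y, s)) (y, s) :=
      ((hH.differentiableOn one_ne_zero).differentiableAt
        (hΩ.mem_nhds (hy s ⟨hs.1.le, hs.2⟩).1)).hasFDerivAt
    exact h1.comp y (hasFDerivAt_prodMk_left y s)

/-- Induction on the order of differentiability: the derivative is again such an integral, but of a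
function with values in a space of linear maps. The target space therefore varies in the induction.
-/
theorem contDiffOn_nat_integral_slice (m : ℕ) {Ω : Set (E × ℝ)} (hΩ : IsOpen Ω) {O : Set E}
    (hOo : IsOpen O) {F : Type} [NormedAddCommGroup F] [NormedSpace ℝ F]
    {H : E × ℝ → F} (hH : ContDiffOn ℝ m H Ω)
    (hO : ∀ x ∈ O, ∀ s ∈ Icc (0 : ℝ) 1, (x, s) ∈ Ω) :
    ContDiffOn ℝ m (fun x => ∫ s in (0 : ℝ)..1, H (x, s)) O := by
  induction m generalizing F with
  | zero =>
    rw [Nat.cast_zero, contDiffOn_zero] at *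
    exact continuousOn_integral_slice hΩ hH hO
  | succ m ih =>
    have h1 : ContDiffOn ℝ 1 H Ω := hH.of_le (by exact_mod_cast Nat.le_add_left 1 m)
    rw [Nat.cast_add, Nat.cast_one, contDiffOn_succ_iff_fderiv_of_isOpen hOo]
    refine ⟨fun x hx =>
      (hasFDerivAt_integral_slice hΩ h1 (hO x hx)).differentiableAt.differentiableWithinAt,
      by simp, ?_⟩
    have h2 : ContDiffOn ℝ m
        (fun z => (fderiv ℝ H z).comp (ContinuousLinearMap.inl ℝ E ℝ)) Ω :=
      (hH.fderiv_of_isOpen hΩ (by simp)).clm_comp contDiffOn_const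
    exact (ih h2).congr fun x hx => (hasFDerivAt_integral_slice hΩ h1 (hO x hx)).fderiv

theorem contDiffOn_integral_slice {Ω : Set (E × ℝ)} (hΩ : IsOpen Ω) {O : Set E}
    (hOo : IsOpen O) {H : E × ℝ → F} (hH : ContDiffOn ℝ ∞ H Ω)
    (hO : ∀ x ∈ O, ∀ s ∈ Icc (0 : ℝ) 1, (x, s) ∈ Ω) :
    ContDiffOn ℝ ∞ (fun x => ∫ s in (0 : ℝ)..1, H (x, s)) O :=
  contDiffOn_infty.2 fun m =>
    contDiffOn_nat_integral_slice m hΩ hOo (hH.of_le (by exact_mod_cast le_top)) hO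

/-- **Hadamard's lemma** with parameters. -/
theorem exists_hadamard {q : ℕ} {P : Type} [NormedAddCommGroup P] [NormedSpace ℝ P] {O : Set P}
    (hO : IsOpen O) {B : Set (Fin q → ℝ)} (hB : IsOpen B) (hc : Convex ℝ B)
    {F : P × (Fin q → ℝ) → ℝ} (hF : ContDiffOn ℝ ∞ F (O ×ˢ B)) :
    ∃ G : Fin q → (P × (Fin q → ℝ)) × (Fin q → ℝ) → ℝ,
      (∀ i, ContDiffOn ℝ ∞ (G i) ((O ×ˢ B) ×ˢ B)) ∧
      ∀ p ∈ O, ∀ a ∈ B, ∀ x ∈ B, F (p, x) = F (p, a) + ∑ i, (x i - a i) * G i ((p, a), x) := by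
  have hOB := hO.prod hB
  -- The segment from `a` to `x`. The functions `G i` are the integrals of the partial derivatives
  -- of `F` along it, hence smooth in the base point `a` as well; the later expansions at a moving
  -- point need this.
  let l : ((P × (Fin q → ℝ)) × (Fin q → ℝ)) × ℝ → P × (Fin q → ℝ) :=
    fun z => (z.1.1.1, z.1.1.2 + z.2 • (z.1.2 - z.1.1.2))
  have hl : ContDiff ℝ ∞ l := by fun_prop
  have hmem : ∀ z ∈ (O ×ˢ B) ×ˢ B, ∀ s ∈ Icc (0 : ℝ) 1, (z, s) ∈ l ⁻¹' (O ×ˢ B) := by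
    intro z hz s hs
    exact ⟨hz.1.1, hc.add_smul_sub_mem hz.1.2 hz.2 hs⟩
  have hdF : ∀ i : Fin q, ContDiffOn ℝ ∞
      (fun z => fderiv ℝ F (l z) (0, Pi.single i 1)) (l ⁻¹' (O ×ˢ B)) := fun i =>
    (((hF.fderiv_of_isOpen hOB (m := ∞) (by simp)).comp hl.contDiffOn fun _ h => h)).clm_apply
      contDiffOn_const
  refine ⟨fun i z => ∫ s in (0 : ℝ)..1, fderiv ℝ F (l (z, s)) (0, Pi.single i 1), fun i =>
    contDiffOn_integral_slice (hOB.preimage hl.continuous) (hOB.prod hB) (hdF i) hmem, ?_⟩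
  · intro p hp a ha x hx
    have hz : ((p, a), x) ∈ (O ×ˢ B) ×ˢ B := ⟨⟨hp, ha⟩, hx⟩
    have hder : ∀ s ∈ uIcc (0 : ℝ) 1, HasDerivAt (fun s => F (l (((p, a), x), s)))
        (fderiv ℝ F (l (((p, a), x), s)) (0, x - a)) s := by
      intro s hs
      rw [uIcc_of_le zero_le_one] at hs
      have h1 : HasFDerivAt F _ (l (((p, a), x), s)) :=
        ((hF.differentiableOn (by simp)).differentiableAt
          (hOB.mem_nhds (hmem _ hz s hs))).hasFDerivAt
      have h2 : HasDerivAt (fun s : ℝ => l (((p, a), x), s)) (0, x - a) s := by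
        refine (hasDerivAt_const s p).prodMk ?_
        simpa using ((hasDerivAt_id s).smul_const (x - a)).const_add a
      exact h1.comp_hasDerivAt s h2
    have hsum : ∀ L : P × (Fin q → ℝ) →L[ℝ] ℝ,
        L (0, x - a) = ∑ i, (x i - a i) * L (0, Pi.single i 1) := by
      intro L
      have : ((0 : P), x - a) = ∑ i, (x i - a i) • ((0 : P), (Pi.single i 1 : Fin q → ℝ)) := by
        refine Prod.ext (by simp [Prod.fst_sum]) ?_
        rw [Prod.snd_sum]
        conv_lhs => rw [pi_eq_sum_univ' (x - a)]
        rfl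
      rw [this, map_sum]
      simp only [map_smul, smul_eq_mul]
    have integrable : ∀ i : Fin q, IntervalIntegrable
        (fun s => fderiv ℝ F (l (((p, a), x), s)) (0, Pi.single i 1)) volume 0 1 := fun i =>
      intervalIntegrable_slice (hdF i).continuousOn (hmem _ hz)
    have key := intervalIntegral.integral_eq_sub_of_hasDerivAt hder (by
      simp only [hsum]
      simpa only [Finset.sum_fn] using IntervalIntegrable.sum Finset.univ
        fun i _ => (integrable i).const_mul (x i - a i))
    simp only [hsum] at key
    rw [intervalIntegral.integral_finsetSum fun i _ => (integrable i).const_mul _] at key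
    simp only [intervalIntegral.integral_const_mul] at key
    have e1 : l (((p, a), x), 1) = (p, x) := by simp [l]
    have e0 : l (((p, a), x), 0) = (p, a) := by simp [l]
    rw [e1, e0] at key
    rw [key]; ring

end ParametricIntegral

/-! ### The body and the degree filtration of the Grassmann algebra. -/

section GrassmannBody

variable {n : ℕ}

theorem monomials_empty : monomials n ∅ = 1 := by
  rw [monomials, ExteriorAlgebra.basis_apply_ofCard (n := 0) _ Finset.card_empty]
  exact ExteriorAlgebra.ιMulti_zero_apply _

/-- The body `⋀ ℝⁿ → ℝ`. -/
def body : Grassmann n →ₐ[ℝ] ℝ := ExteriorAlgebra.algebraMapInv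

theorem body_algebraMap (r : ℝ) : body (algebraMap ℝ (Grassmann n) r) = r :=
  ExteriorAlgebra.algebraMap_leftInverse _ r

theorem body_ι (v : Fin n → ℝ) : body (ExteriorAlgebra.ι ℝ v) = 0 := by
  simp [body, ExteriorAlgebra.algebraMapInv]

theorem body_monomials {S : Finset (Fin n)} (hS : S ≠ ∅) : body (monomials n S) = 0 := by
  obtain ⟨k, hk⟩ := Nat.exists_eq_succ_of_ne_zero (mt Finset.card_eq_zero.1 hS)
  rw [monomials, ExteriorAlgebra.basis_apply_ofCard _ hk]
  change body (ExteriorAlgebra.ιMulti ℝ (k + 1) _) = 0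
  rw [ExteriorAlgebra.ιMulti_succ_apply, map_mul, body_ι, zero_mul]

theorem body_eq_repr (a : Grassmann n) : body a = (monomials n).repr a ∅ := by
  conv_lhs => rw [← (monomials n).sum_repr a, map_sum]
  rw [Finset.sum_eq_single ∅]
  · rw [map_smul, monomials_empty, map_one, smul_eq_mul, mul_one]
  · intro S _ hS
    rw [map_smul, body_monomials hS, smul_zero]
  · intro h; exact absurd (Finset.mem_univ _) h

/-- A product of two monomials is zero or, up to sign, the monomial of the disjoint union; so
degrees add. -/
theorem repr_monomials_mul {A B S : Finset (Fin n)} (h : A.card + B.card ≠ S.card) :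
    (monomials n).repr (monomials n A * monomials n B) S = 0 := by
  let s : Set.powersetCard (Fin n) A.card := Set.powersetCard.ofCard rfl
  let t : Set.powersetCard (Fin n) B.card := Set.powersetCard.ofCard rfl
  by_cases hd : Disjoint s.val t.val
  · have := ExteriorAlgebra.basis_mul_of_disjoint (Pi.basisFun ℝ (Fin n)) s t hd
    change monomials n A * monomials n B = _ at this
    rw [this]
    have hne : ((Set.powersetCard.disjUnion hd : Set.powersetCard (Fin n) _) : Finset (Fin n)) ≠ S := by
      rintro rfl
      exact h (Set.powersetCard.disjUnion hd).2.symm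
    change (monomials n).repr (_ • monomials n _) S = 0
    rw [Units.smul_def, map_zsmul, Module.Basis.repr_self, Finsupp.smul_apply,
      Finsupp.single_eq_of_ne hne.symm, smul_zero]
  · have := ExteriorAlgebra.basis_mul_of_not_disjoint (Pi.basisFun ℝ (Fin n)) s t hd
    change monomials n A * monomials n B = _ at this
    rw [this, map_zero, Finsupp.zero_apply]

/-- The elements of `⋀ ℝⁿ` without monomials of degree less than `m`. -/
def VanishesBelow (m : ℕ) (a : Grassmann n) : Prop :=
  ∀ S : Finset (Fin n), S.card < m → (monomials n).repr a S = 0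

theorem VanishesBelow.mul {k m : ℕ} {a b : Grassmann n} (ha : VanishesBelow k a)
    (hb : VanishesBelow m b) : VanishesBelow (k + m) (a * b) := by
  intro S hS
  rw [repr_mul]
  refine Finset.sum_eq_zero fun A _ => Finset.sum_eq_zero fun B _ => ?_
  by_cases hA : A.card < k
  · rw [ha A hA]; simp
  by_cases hB : B.card < m
  · rw [hb B hB]; simp
  rw [repr_monomials_mul (by omega), mul_zero]

theorem vanishesBelow_zero (a : Grassmann n) : VanishesBelow 0 a := fun _ h => absurd h (by omega)

theorem vanishesBelow_one {a : Grassmann n} (h : body a = 0) : VanishesBelow 1 a := by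
  intro S hS
  rw [Finset.card_eq_zero.1 (Nat.lt_one_iff.1 hS), ← body_eq_repr, h]

theorem VanishesBelow.eq_zero {m : ℕ} (hm : n < m) {a : Grassmann n} (h : VanishesBelow m a) :
    a = 0 := by
  apply (monomials n).repr.injective
  ext S
  rw [h S (lt_of_le_of_lt (by simpa using Finset.card_le_univ S) hm), map_zero, Finsupp.zero_apply]

/-- Together with `VanishesBelow.eq_zero` this makes every element of zero body nilpotent, with
exponent `n + 1`. -/
theorem VanishesBelow.pow {a : Grassmann n} (h : body a = 0) (m : ℕ) : VanishesBelow m (a ^ m) := by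
  induction m with
  | zero => exact vanishesBelow_zero _
  | succ m ih => rw [pow_succ]; exact ih.mul (vanishesBelow_one h)

end GrassmannBody

/-! ### Invertible superfunctions. -/

section SmoothSuperfunctions

variable {E : Type} [NormedAddCommGroup E] [NormedSpace ℝ E] {n : ℕ} {V : Opens E}

/-- A smooth function as a superfunction. -/
def scal (V : Opens E) (f : E → ℝ) (hf : ContDiffOn ℝ ∞ f V) : SuperFun n V :=
  ⟨fun x => algebraMap ℝ _ (f x), mem_superFun.2 <| .of_coef
    (fun S x => f x * (monomials n).repr 1 S) (fun _ => hf.mul contDiffOn_const) fun S x => by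
      rw [Algebra.algebraMap_eq_smul_one, map_smul, Finsupp.smul_apply, smul_eq_mul]⟩

theorem body_eq_coef (f : V → Grassmann n) (x : V) : body (f x) = coef f ∅ x := by
  rw [coef_of_mem f ∅ x.2, body_eq_repr]

/-- Divided by its body, `f` differs from 1 by a nilpotent element, and 1 minus a nilpotent is
invertible. -/
theorem isUnit_superFun (f : SuperFun n V) (h : ∀ x, body (f.1 x) ≠ 0) : IsUnit f := by
  let b : SuperFun n V := scal V (coef f.1 ∅) (f.2 ∅)
  have hne : ∀ x ∈ V, coef f.1 ∅ x ≠ 0 := fun x hx => by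
    have := h ⟨x, hx⟩; rwa [body_eq_coef] at this
  let b' : SuperFun n V := scal V (fun x => (coef f.1 ∅ x)⁻¹) ((f.2 ∅).inv hne)
  have hb : b' * b = 1 := by
    refine Subtype.ext (funext fun x => ?_)
    change algebraMap ℝ _ _ * algebraMap ℝ _ _ = (1 : Grassmann n)
    rw [← map_mul, inv_mul_cancel₀ (hne x x.2), map_one]
  have hb2 : b * b' = 1 := by
    refine Subtype.ext (funext fun x => ?_)
    change algebraMap ℝ _ _ * algebraMap ℝ _ _ = (1 : Grassmann n)
    rw [← map_mul, mul_inv_cancel₀ (hne x x.2), map_one]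
  have hn : (1 - b' * f) ^ (n + 1) = 0 := by
    refine Subtype.ext (funext fun x => ?_)
    refine (VanishesBelow.pow (a := (1 - b' * f).1 x) ?_ (n + 1)).eq_zero (Nat.lt_succ_self n)
    change body (1 - algebraMap ℝ _ _ * f.1 x) = 0
    rw [map_sub, map_one, map_mul, body_algebraMap, body_eq_coef, inv_mul_cancel₀ (hne x x.2),
      sub_self]
  have hu : IsUnit (b' * f) := by
    have := IsNilpotent.isUnit_one_sub ⟨n + 1, hn⟩
    rwa [sub_sub_cancel] at this
  have hu' : IsUnit b := ⟨⟨b, b', hb2, hb⟩, rfl⟩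
  have := hu'.mul hu
  rwa [← mul_assoc, hb2, one_mul] at this

theorem IsSmooth.sum {ι : Type*} {s : Finset ι} {f : ι → V → Grassmann n}
    (hf : ∀ i ∈ s, IsSmooth (f i)) : IsSmooth (fun x => ∑ i ∈ s, f i x) := by
  have := Subalgebra.sum_mem (SuperFun n V) fun i hi => mem_superFun.2 (hf i hi)
  rw [Finset.sum_fn] at this
  exact this

end SmoothSuperfunctions

/-! ### Smooth families of algebra homomorphisms into the Grassmann algebra. -/

section SmoothFamilies

variable {n : ℕ}

/-- The product of two open sets. -/
abbrev oprod {X Y : Type} [TopologicalSpace X] [TopologicalSpace Y] (O : Opens X) (V : Opens Y) :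
    Opens (X × Y) := ⟨(O : Set X) ×ˢ (V : Set Y), O.2.prod V.2⟩

theorem IsSmooth.comp {E₁ E₂ : Type} [NormedAddCommGroup E₁] [NormedSpace ℝ E₁]
    [NormedAddCommGroup E₂] [NormedSpace ℝ E₂] {V₁ : Opens E₁} {V₂ : Opens E₂}
    {f : V₂ → Grassmann n} (hf : IsSmooth f) (g : E₁ → E₂) (hg : ContDiffOn ℝ ∞ g V₁)
    (hm : ∀ x ∈ V₁, g x ∈ V₂) : IsSmooth (fun x : V₁ => f ⟨g x, hm x x.2⟩) :=
  .of_coef (fun S => coef f S ∘ g) (fun S => (hf S).comp hg hm) fun S x => by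
    rw [Function.comp_apply, coef_of_mem _ _ (hm x x.2)]

theorem isSmooth_algebraMap {E : Type} [NormedAddCommGroup E] [NormedSpace ℝ E] {V : Opens E}
    {f : E → ℝ} (hf : ContDiffOn ℝ ∞ f V) :
    IsSmooth (fun x : V => algebraMap ℝ (Grassmann n) (f x)) :=
  superFun_smooth (scal V f hf)

theorem IsSmooth.sub {E : Type} [NormedAddCommGroup E] [NormedSpace ℝ E] {V : Opens E}
    {f g : V → Grassmann n} (hf : IsSmooth f) (hg : IsSmooth g) :
    IsSmooth (fun x => f x - g x) :=
  (SuperFun n V).sub_mem (mem_superFun.2 hf) (mem_superFun.2 hg)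

/-- A constant superfunction. -/
def gconst {E : Type} [NormedAddCommGroup E] [NormedSpace ℝ E] (V : Opens E) (a : Grassmann n) :
    SuperFun n V :=
  ⟨fun _ => a, mem_superFun.2 <| .of_coef (fun S _ => (monomials n).repr a S)
    (fun _ => contDiffOn_const) fun _ _ => rfl⟩

variable {E' : Type} [NormedAddCommGroup E'] [NormedSpace ℝ E'] {V' : Opens E'} {q : ℕ}
  {B : Opens (Fin q → ℝ)}

theorem contDiffOn_slice {P : Type} [NormedAddCommGroup P] [NormedSpace ℝ P] {O : Opens P}
    {E : Type} [NormedAddCommGroup E] [NormedSpace ℝ E] {B : Opens E} {F : P × E → ℝ}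
    (hF : ContDiffOn ℝ ∞ F ((O : Set P) ×ˢ (B : Set E))) {p : P} (hp : p ∈ O) :
    ContDiffOn ℝ ∞ (fun x => F (p, x)) B :=
  hF.comp (by fun_prop) fun _ hx => ⟨hp, hx⟩

variable (Φ : V' → (SuperFun n B →ₐ[ℝ] Grassmann n)) (φ : E' → Fin q → ℝ)

/-- The components of `φ` are the bodies of the images of the coordinate functions. -/
theorem contDiffOn_of_body (hφ : ∀ y ∈ V', φ y ∈ B) (hΦ : ∀ f, IsSmooth fun y => Φ y f)
    (hb : ∀ y f, body (Φ y f) = body (f.1 ⟨φ y, hφ y y.2⟩)) : ContDiffOn ℝ ∞ φ V' := by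
  rw [contDiffOn_pi]
  intro i
  refine (hΦ (scal B (fun x => x i) (by fun_prop)) ∅).congr fun y hy => ?_
  have := hb ⟨y, hy⟩ (scal B (fun x => x i) (by fun_prop))
  rw [← body_eq_coef (fun y => Φ y (scal B (fun x => x i) (by fun_prop))) ⟨y, hy⟩]
  exact (this.trans (body_algebraMap _)).symm

/-- No continuity of `Φ y` is available, so its value on a smooth function is controlled by a finite
Taylor expansion. Hadamard's lemma at the point `φ y` splits off `F(p, φ y)` and leaves terms with a
factor `Φ y (x i) - φ y i`, which has zero body. Each expansion thus raises the Grassmann degree `m`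
of the prefactor `w` by one; `k` counts the expansions still to be made, and for `k = 0` the degree
exceeds `n`. -/
theorem isSmooth_mul_apply_scal (hB : Convex ℝ (B : Set (Fin q → ℝ)))
    (hφ : ∀ y ∈ V', φ y ∈ B) (hΦ : ∀ f, IsSmooth fun y => Φ y f)
    (hb : ∀ y f, body (Φ y f) = body (f.1 ⟨φ y, hφ y y.2⟩)) (k m : ℕ) (hkm : n < k + m)
    {P : Type} [NormedAddCommGroup P] [NormedSpace ℝ P] (O : Opens P) (F : P × (Fin q → ℝ) → ℝ)
    (hF : ContDiffOn ℝ ∞ F ((O : Set P) ×ˢ (B : Set (Fin q → ℝ))))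
    (w : V' → Grassmann n) (hw : IsSmooth w) (hw' : ∀ y, VanishesBelow m (w y)) :
    IsSmooth (V := oprod O V') fun z => w ⟨z.1.2, z.2.2⟩ *
      Φ ⟨z.1.2, z.2.2⟩ (scal B (fun x => F (z.1.1, x)) (contDiffOn_slice hF z.2.1)) := by
  have hφs := contDiffOn_of_body Φ φ hφ hΦ hb
  have snd_mem : ∀ z ∈ oprod O V', z.2 ∈ V' := fun z hz => hz.2
  induction k generalizing m P w with
  | zero =>
    have : (fun z : (oprod O V') => w ⟨z.1.2, z.2.2⟩ *
        Φ ⟨z.1.2, z.2.2⟩ (scal B (fun x => F (z.1.1, x)) (contDiffOn_slice hF z.2.1))) = 0 := by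
      funext z
      rw [(hw' _).eq_zero (by omega), zero_mul]; rfl
    rw [this]
    exact (SuperFun n _).zero_mem
  | succ k ih =>
    obtain ⟨G, hG, hFG⟩ := exists_hadamard O.2 B.2 hB hF
    let x : Fin q → SuperFun n B := fun i => scal B (fun x => x i) (by fun_prop)
    let ν : Fin q → V' → Grassmann n := fun i y => Φ y (x i) - algebraMap ℝ _ (φ y i)
    have hν : ∀ i, IsSmooth (ν i) := fun i =>
      (hΦ (x i)).sub (isSmooth_algebraMap (f := fun y => φ y i) (contDiffOn_pi.1 hφs i))
    have hν' : ∀ i y, body (ν i y) = 0 := fun i y => by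
      change body (Φ y (x i) - algebraMap ℝ _ (φ y i)) = 0
      rw [map_sub, hb, body_algebraMap]
      change body (algebraMap ℝ (Grassmann n) (φ y i)) - _ = 0
      rw [body_algebraMap, sub_self]
    have key : (fun z : (oprod O V') => w ⟨z.1.2, z.2.2⟩ *
        Φ ⟨z.1.2, z.2.2⟩ (scal B (fun x => F (z.1.1, x)) (contDiffOn_slice hF z.2.1))) =
        fun z => w ⟨z.1.2, z.2.2⟩ * algebraMap ℝ _ (F (z.1.1, φ z.1.2)) +
        ∑ i, (w ⟨z.1.2, z.2.2⟩ * ν i ⟨z.1.2, z.2.2⟩) * Φ ⟨z.1.2, z.2.2⟩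
          (scal B (fun x => G i ((z.1.1, φ z.1.2), x))
            (contDiffOn_slice (O := oprod O B) (hG i) ⟨z.2.1, hφ _ z.2.2⟩)) := by
      funext z
      have e : (scal B (fun x => F (z.1.1, x)) (contDiffOn_slice hF z.2.1) : SuperFun n B) =
          algebraMap ℝ _ (F (z.1.1, φ z.1.2)) +
          ∑ i, (x i - algebraMap ℝ _ (φ z.1.2 i)) * scal B (fun x => G i ((z.1.1, φ z.1.2), x))
            (contDiffOn_slice (O := oprod O B) (hG i) ⟨z.2.1, hφ _ z.2.2⟩) := by
        refine Subtype.ext (funext fun y => ?_)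
        rw [Subalgebra.coe_add, AddSubmonoidClass.coe_finsetSum, Pi.add_apply, Finset.sum_apply]
        change algebraMap ℝ _ (F (z.1.1, y)) = algebraMap ℝ (Grassmann n) _ +
          ∑ i, (algebraMap ℝ _ (y.1 i) - algebraMap ℝ _ (φ z.1.2 i)) * algebraMap ℝ _ _
        rw [hFG z.1.1 z.2.1 _ (hφ _ z.2.2) y y.2, map_add, map_sum]
        simp only [map_mul, map_sub]
      rw [e, map_add, map_sum, mul_add, Finset.mul_sum, AlgHom.commutes]
      simp only [map_mul, map_sub, AlgHom.commutes, mul_assoc, ν]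
    rw [key]
    have hwz : IsSmooth (V := oprod O V') fun z => w ⟨z.1.2, z.2.2⟩ :=
      hw.comp Prod.snd contDiffOn_snd snd_mem
    have hφz : ContDiffOn ℝ ∞ (fun z : P × E' => φ z.2) (oprod O V') :=
      hφs.comp contDiffOn_snd snd_mem
    refine IsSmooth.add (hwz.mul (isSmooth_algebraMap (V := oprod O V')
      (f := fun z => F (z.1, φ z.2)) ?_)) (IsSmooth.sum fun i _ => ?_)
    · exact hF.comp (contDiffOn_fst.prodMk hφz) fun z hz => ⟨hz.1, hφ _ hz.2⟩
    -- The remainder `G i` also depends on the base point `φ y`. This point is made an independent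
    -- parameter in `B` for the induction hypothesis, and is put back by composition.
    · have h1 := ih (m + 1) (by omega) (oprod O B) (G i) (hG i) (fun y => w y * ν i y)
        (hw.mul (hν i)) (fun y => (hw' y).mul (vanishesBelow_one (hν' i y))) fun z hz => hz.2
      exact h1.comp (V₁ := oprod O V') (fun z => ((z.1, φ z.2), z.2))
        ((contDiffOn_fst.prodMk hφz).prodMk contDiffOn_snd)
        fun z hz => ⟨⟨hz.1, hφ _ hz.2⟩, hz.2⟩

/-- A smooth family of algebra homomorphisms into `⋀ ℝⁿ` maps smooth families of superfunctions to
smooth families. -/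
theorem isSmooth_apply_family (hB : Convex ℝ (B : Set (Fin q → ℝ)))
    (hφ : ∀ y ∈ V', φ y ∈ B) (hΦ : ∀ f, IsSmooth fun y => Φ y f)
    (hb : ∀ y f, body (Φ y f) = body (f.1 ⟨φ y, hφ y y.2⟩))
    {P : Type} [NormedAddCommGroup P] [NormedSpace ℝ P] (O : Opens P) (f : O → SuperFun n B)
    (hf : IsSmooth (V := oprod O B) fun z => (f ⟨z.1.1, z.2.1⟩).1 ⟨z.1.2, z.2.2⟩) :
    IsSmooth (V := oprod O V') fun z => Φ ⟨z.1.2, z.2.2⟩ (f ⟨z.1.1, z.2.1⟩) := by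
  set J : oprod O B → Grassmann n :=
    fun z => (f ⟨z.1.1, z.2.1⟩).1 ⟨z.1.2, z.2.2⟩ with hJ
  have key : (fun z : (oprod O V') => Φ ⟨z.1.2, z.2.2⟩ (f ⟨z.1.1, z.2.1⟩)) =
      fun z => ∑ S, (1 * Φ ⟨z.1.2, z.2.2⟩ (scal B (fun x => coef J S (z.1.1, x))
        (contDiffOn_slice (hf S) z.2.1))) * Φ ⟨z.1.2, z.2.2⟩ (gconst B (monomials n S)) := by
    funext z
    have e : f ⟨z.1.1, z.2.1⟩ = ∑ S, scal B (fun x => coef J S (z.1.1, x))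
        (contDiffOn_slice (hf S) z.2.1) * gconst B (monomials n S) := by
      refine Subtype.ext (funext fun y => ?_)
      rw [AddSubmonoidClass.coe_finsetSum, Finset.sum_apply]
      change _ = ∑ S, algebraMap ℝ (Grassmann n) _ * monomials n S
      rw [← (monomials n).sum_repr ((f ⟨z.1.1, z.2.1⟩).1 y)]
      refine Finset.sum_congr rfl fun S _ => ?_
      beta_reduce
      rw [coef_of_mem J S (x := (z.1.1, y.1)) ⟨z.2.1, y.2⟩, Algebra.smul_def]
    rw [e, map_sum]
    simp only [map_mul, one_mul]
  rw [key]
  refine IsSmooth.sum fun S _ => IsSmooth.mul ?_ ?_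
  -- Starting from the prefactor 1, of degree 0, `n + 1` expansions exhaust all Grassmann degrees.
  · exact isSmooth_mul_apply_scal Φ φ hB hφ hΦ hb (n + 1) 0 (by omega) O (coef J S) (hf S) (fun _ => 1)
      ((SuperFun n V').one_mem) (fun _ => vanishesBelow_zero _)
  · exact (hΦ (gconst B (monomials n S))).comp (V₁ := oprod O V') Prod.snd contDiffOn_snd fun z hz => hz.2

end SmoothFamilies

/-! ### Derivations of superfunctions on a convex domain. -/

section ModelDerivations

variable {q n : ℕ} {V : Opens (Fin q → ℝ)}

theorem scal_mem (f : (Fin q → ℝ) → ℝ) (hf : ContDiffOn ℝ ∞ f V) (y : V) :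
    (scal (n := n) V f hf).1 y ∈ Grassmann.part n 0 := by
  rw [mem_part_iff, sgn_zero, one_smul]
  exact AlgHom.commutes _ _

theorem ι_mem (v : Fin n → ℝ) : ExteriorAlgebra.ι ℝ v ∈ Grassmann.part n 1 := by
  rw [mem_part_iff]
  exact (CliffordAlgebra.involute_ι v).trans (by simp [sgn])

theorem superFun_eq_sum (f : SuperFun n V) :
    f = ∑ S, scal V (coef f.1 S) (f.2 S) * gconst V (monomials n S) := by
  refine Subtype.ext (funext fun y => ?_)
  rw [AddSubmonoidClass.coe_finsetSum, Finset.sum_apply]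
  change _ = ∑ S, algebraMap ℝ (Grassmann n) _ * monomials n S
  rw [← (monomials n).sum_repr (f.1 y)]
  refine Finset.sum_congr rfl fun S _ => ?_
  rw [coef_of_mem f.1 S y.2, Algebra.smul_def]

/-- A derivation of the superfunctions on a convex open set that kills the coordinates is zero. -/
theorem derivation_eq_zero (hV : Convex ℝ (V : Set (Fin q → ℝ))) {i : ZMod 2}
    (δ : SuperFun n V →ₗ[ℝ] SuperFun n V)
    (hδ : ∀ (j : ZMod 2) (f g : SuperFun n V), (∀ y, f.1 y ∈ Grassmann.part n j) →
      δ (f * g) = δ f * g + sgn (i * j) • (f * δ g))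
    (hc : ∀ I, δ (modelCoord V I) = 0) (f : SuperFun n V) : δ f = 0 := by
  have hone : δ 1 = 0 := by
    have h := hδ 0 1 1 fun y => by
      rw [mem_part_iff, sgn_zero, one_smul]; exact map_one _
    rw [mul_one, mul_one, one_mul, mul_zero, sgn_zero, one_smul] at h
    exact left_eq_add.1 h
  have halg : ∀ r : ℝ, δ (algebraMap ℝ _ r) = 0 := fun r => by
    rw [Algebra.algebraMap_eq_smul_one, map_smul, hone, smul_zero]
  have heven : ∀ (f : (Fin q → ℝ) → ℝ) (hf : ContDiffOn ℝ ∞ f V) (g : SuperFun n V),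
      δ (scal V f hf * g) = δ (scal V f hf) * g + scal V f hf * δ g := fun f hf g => by
    rw [hδ 0 _ g (scal_mem f hf), mul_zero, sgn_zero, one_smul]
  -- In Hadamard's expansion at `a`, `δ` kills the constant and every factor `x k - a k`; what the
  -- Leibniz rule leaves is multiplied by `x k - a k`, and so vanishes at `a`. The point `a` is
  -- arbitrary.
  have hscal : ∀ (f : (Fin q → ℝ) → ℝ) (hf : ContDiffOn ℝ ∞ f V),
      δ (scal (n := n) V f hf) = 0 := by
    intro f hf
    refine Subtype.ext (funext fun a => ?_)
    obtain ⟨G, hG, hFG⟩ := exists_hadamard (P := ℝ) isOpen_univ V.2 hV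
      (F := fun z => f z.2) (hf.comp contDiffOn_snd fun z hz => hz.2)
    have hGa : ∀ k, ContDiffOn ℝ ∞ (fun x => G k (((0 : ℝ), a.1), x)) V := fun k =>
      (hG k).comp (by fun_prop) fun x hx => ⟨⟨Set.mem_univ _, a.2⟩, hx⟩
    have hx : ∀ k, ContDiffOn ℝ ∞ (fun x : Fin q → ℝ => x k - a.1 k) V := fun k => by fun_prop
    have e : (scal V f hf : SuperFun n V) = algebraMap ℝ _ (f a) +
        ∑ k, scal V (fun x => x k - a.1 k) (hx k) * scal V _ (hGa k) := by
      refine Subtype.ext (funext fun y => ?_)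
      rw [Subalgebra.coe_add, AddSubmonoidClass.coe_finsetSum, Pi.add_apply, Finset.sum_apply]
      change algebraMap ℝ _ (f y) = algebraMap ℝ (Grassmann n) _ +
          ∑ k, algebraMap ℝ _ (y.1 k - a.1 k) * algebraMap ℝ _ _
      have := hFG 0 (Set.mem_univ _) a a.2 y y.2
      simp only at this
      rw [this, map_add, map_sum]
      simp only [map_mul]
    have hxk : ∀ k, δ (scal V (fun x => x k - a.1 k) (hx k)) = 0 := fun k => by
      have : (scal V (fun x => x k - a.1 k) (hx k) : SuperFun n V) =
          modelCoord V (Sum.inl k) - algebraMap ℝ _ (a.1 k) :=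
        Subtype.ext (funext fun y => map_sub _ _ _)
      rw [this, map_sub, hc, halg, sub_zero]
    rw [e, map_add, halg, zero_add, map_sum, AddSubmonoidClass.coe_finsetSum, Finset.sum_apply]
    refine Finset.sum_eq_zero fun k _ => ?_
    rw [heven, hxk, zero_mul, zero_add]
    change algebraMap ℝ (Grassmann n) (a.1 k - a.1 k) * _ = 0
    rw [sub_self, map_zero, zero_mul]
  have hconst : ∀ a : Grassmann n, δ (gconst V a) = 0 := by
    intro a
    induction a using CliffordAlgebra.left_induction with
    | algebraMap r => exact halg r
    | add x y hx hy =>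
      have : gconst V (x + y) = gconst V x + gconst V y := rfl
      rw [this, map_add, hx, hy, add_zero]
    | ι_mul x m hx =>
      have hm : δ (gconst V (CliffordAlgebra.ι (0 : QuadraticForm ℝ (Fin n → ℝ)) m)) = 0 := by
        have : gconst V (CliffordAlgebra.ι (0 : QuadraticForm ℝ (Fin n → ℝ)) m) =
            ∑ A, m A • modelCoord V (Sum.inr A) := by
          refine Subtype.ext (funext fun y => ?_)
          rw [AddSubmonoidClass.coe_finsetSum, Finset.sum_apply]
          change ExteriorAlgebra.ι ℝ m = ∑ A, m A • ExteriorAlgebra.ι ℝ (Pi.single A 1)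
          conv_lhs => rw [pi_eq_sum_univ' m, map_sum]
          simp only [map_smul]
        rw [this, map_sum]
        exact Finset.sum_eq_zero fun A _ => by rw [map_smul, hc, smul_zero]
      have : gconst V (CliffordAlgebra.ι (0 : QuadraticForm ℝ (Fin n → ℝ)) m * x) =
          gconst V (CliffordAlgebra.ι 0 m) * gconst V x := rfl
      rw [this, hδ 1 _ _ fun y => ι_mem m, hm, hx, zero_mul, mul_zero, smul_zero, add_zero]
  rw [superFun_eq_sum f, map_sum]
  exact Finset.sum_eq_zero fun S _ => by rw [heven, hscal, hconst, zero_mul, mul_zero, add_zero]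

theorem modelDeriv_coord (I J : Fin q ⊕ Fin n) :
    modelDeriv V I (modelCoord V J) = if I = J then 1 else 0 := by
  have hd : ∀ (v : Fin q → ℝ) (f : (Fin q → ℝ) → ℝ) (hf : ContDiffOn ℝ ∞ f V) (a : Grassmann n)
      (y : V), dirDerivFun v (fun y : V => f y • a) y = fderiv ℝ f y v • a := by
    intro v f hf a y
    apply (monomials n).repr.injective
    ext S
    rw [repr_dirDerivFun, map_smul, Finsupp.smul_apply, smul_eq_mul]
    have e : coef (fun y : V => f y • a) S =ᶠ[nhds (y : Fin q → ℝ)]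
        fun z => f z * (monomials n).repr a S := by
      filter_upwards [V.2.mem_nhds y.2] with z hz
      rw [coef_of_mem _ _ hz, map_smul, Finsupp.smul_apply, smul_eq_mul]
    have hfd : DifferentiableAt ℝ f y :=
      (hf.differentiableOn (by simp)).differentiableAt (V.2.mem_nhds y.2)
    rw [e.fderiv_eq, fderiv_mul_const hfd, smul_apply, smul_eq_mul, mul_comm]
  refine Subtype.ext (funext fun y => ?_)
  rcases I with a | A <;> rcases J with b | C
  · change dirDerivFun _ (fun y : V => algebraMap ℝ (Grassmann n) (y.1 b)) y = _
    simp only [Algebra.algebraMap_eq_smul_one]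
    rw [hd _ (fun y => y b) (by fun_prop)]
    have : fderiv ℝ (fun y : Fin q → ℝ => y b) y = ContinuousLinearMap.proj b :=
      (ContinuousLinearMap.proj (R := ℝ) (φ := fun _ : Fin q => ℝ) b).fderiv
    rw [this]
    by_cases h : a = b
    · subst h; simp
    · simp [h, Ne.symm h]
  · have := hd (Pi.single a 1) (fun _ => 1) contDiffOn_const (ExteriorAlgebra.ι ℝ (Pi.single C 1)) y
    simp only [one_smul] at this
    refine this.trans ?_
    simp
  · change CliffordAlgebra.contractLeft _ (algebraMap ℝ _ _) = _
    rw [CliffordAlgebra.contractLeft_algebraMap]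
    simp
  · change CliffordAlgebra.contractLeft _ (CliffordAlgebra.ι 0 _) = _
    rw [CliffordAlgebra.contractLeft_ι]
    by_cases h : A = C
    · subst h; simp
    · simp [h]

end ModelDerivations

/-! ### Local equality and parity splitting of sections. -/

section Sheaf

variable {M : SuperSpace.{u}}

/-- Both sections glue the restrictions of `b`, and the gluing axiom includes uniqueness. -/
theorem sec_ext {U : Opens M.carrier} {a b : M.sec U}
    (h : ∀ x ∈ U, ∃ (V : Opens M.carrier) (hV : V ≤ U), x ∈ V ∧ M.res hV a = M.res hV b) :
    a = b := by
  choose V hV hx he using h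
  obtain ⟨s, -, hs⟩ := M.glue U (fun i : {x // x ∈ U} => V i.1 i.2) (fun i => hV i.1 i.2)
    (fun x hxU => ⟨⟨x, hxU⟩, hx x hxU⟩) (fun i => M.res (hV i.1 i.2) b) (fun i j W hi hj => by
      rw [M.res_res, M.res_res])
  rw [hs a fun i => he i.1 i.2, hs b fun i => rfl]

theorem sec_ext_cover {ι : Type*} {U : Opens M.carrier} (V : ι → Opens M.carrier)
    (hcov : ∀ x ∈ U, ∃ i, x ∈ V i) {a b : M.sec U}
    (h : ∀ i, M.res (inf_le_left : U ⊓ V i ≤ U) a = M.res inf_le_left b) : a = b :=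
  sec_ext fun x hx => (hcov x hx).elim fun i hi => ⟨U ⊓ V i, inf_le_left, ⟨hx, hi⟩, h i⟩

theorem exists_parity_split {U : Opens M.carrier} (f : M.sec U) :
    ∃ a b, a ∈ M.par U 0 ∧ b ∈ M.par U 1 ∧ a + b = f := by
  obtain ⟨a, ha, b, hb, hab⟩ := Submodule.mem_sup.1
    ((M.par_isCompl U).sup_eq_top ▸ Submodule.mem_top (x := f))
  exact ⟨a, b, ha, hb, hab⟩

theorem eq_zero_of_mem_par {U : Opens M.carrier} {i : ZMod 2} {f : M.sec U} (h : f ∈ M.par U i)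
    (h' : f ∈ M.par U (i + 1)) : f = 0 := by
  rcases parity_cases i with rfl | rfl
  · exact Submodule.disjoint_def.1 (M.par_isCompl U).disjoint _ h h'
  · exact Submodule.disjoint_def.1 (M.par_isCompl U).disjoint _ h' h

end Sheaf

/-! ### Values of sections in charts; derivations in coordinates. -/

section ChartEvaluation

variable {M : SuperSpace.{u}} {q n : ℕ}

theorem evalAt_eq (c : SuperChart M q n) {W : Opens M.carrier} (hW : W ≤ c.dom) (y : Fin q → ℝ)
    (hy : y ∈ c.map.target ∧ c.map.symm y ∈ W) (f : M.sec W) :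
    evalAt c W y hy f = (c.iso W hW f).1 ⟨y, hy⟩ :=
  c.iso_res W (W ⊓ c.dom) hW inf_le_left f y ⟨hy.1, hy.2, c.map.map_target hy.1⟩

theorem eq_of_evalAt (c : SuperChart M q n) {W : Opens M.carrier} (hW : W ≤ c.dom) {f g : M.sec W}
    (h : ∀ y hy, evalAt c W y hy f = evalAt c W y hy g) : f = g := by
  apply (c.iso W hW).injective
  refine Subtype.ext (funext fun y => ?_)
  exact ((evalAt_eq c hW y.1 y.2 f).symm.trans (h y.1 y.2)).trans (evalAt_eq c hW y.1 y.2 g)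

/-- The open set of `M` over an open set of the model. -/
def SuperChart.preimg (c : SuperChart M q n) (B : Opens (Fin q → ℝ)) : Opens M.carrier :=
  ⟨c.map.source ∩ c.map ⁻¹' B, c.map.isOpen_inter_preimage B.2⟩

theorem SuperChart.preimg_le (c : SuperChart M q n) (B : Opens (Fin q → ℝ)) :
    c.preimg B ≤ c.dom := fun _ hx => hx.1

theorem SuperChart.img_preimg (c : SuperChart M q n) {B : Opens (Fin q → ℝ)}
    (hB : (B : Set (Fin q → ℝ)) ⊆ c.map.target) : c.img (c.preimg B) = B := by
  ext y
  constructor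
  · rintro ⟨h1, -, h2⟩
    have : c.map (c.map.symm y) ∈ B := h2
    rwa [c.map.right_inv h1] at this
  · intro hy
    exact ⟨hB hy, c.map.map_target (hB hy), by
      change c.map (c.map.symm y) ∈ B
      rwa [c.map.right_inv (hB hy)]⟩

/-- The body at a point is intrinsic, since it can be recovered from invertibility. If the two
values differed, then `f` minus the body in `c'` would have non-zero body in `c`, hence be a unit
near the point by `isUnit_superFun`; but in `c'` its body is zero there. -/
theorem body_evalAt (c c' : SuperChart M q n) (U : Opens M.carrier) (y y' : Fin q → ℝ)
    (hy : y ∈ c.map.target ∧ c.map.symm y ∈ U) (hy' : y' ∈ c'.map.target ∧ c'.map.symm y' ∈ U)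
    (h : c.map.symm y = c'.map.symm y') (f : M.sec U) :
    body (evalAt c U y hy f) = body (evalAt c' U y' hy' f) := by
  set r := body (evalAt c' U y' hy' f) with hr
  by_contra hne
  set g := f - algebraMap ℝ _ r with hg
  have hg' : body (evalAt c' U y' hy' g) = 0 := by
    rw [hg, map_sub, AlgHom.commutes, map_sub, body_algebraMap, hr, sub_self]
  have hgc : body (evalAt c U y hy g) ≠ 0 := by
    rw [hg, map_sub, AlgHom.commutes, map_sub, body_algebraMap]
    exact sub_ne_zero.2 hne
  let F := c.iso (U ⊓ c.dom) inf_le_right (M.res inf_le_left g)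
  have hcont : ContinuousOn (coef F.1 ∅) (c.img (U ⊓ c.dom)) := (F.2 ∅).continuousOn
  -- The region where the body of `g`, read in `c`, does not vanish; it is open because this body is
  -- continuous.
  let B : Opens (Fin q → ℝ) := ⟨c.img (U ⊓ c.dom) ∩ coef F.1 ∅ ⁻¹' {0}ᶜ,
    hcont.isOpen_inter_preimage (c.img (U ⊓ c.dom)).2 isOpen_compl_singleton⟩
  have hBt : (B : Set (Fin q → ℝ)) ⊆ c.map.target := fun z hz => hz.1.1
  have himg := c.img_preimg hBt
  have hWU : c.preimg B ≤ U := fun x hx => by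
    have h1 : c.map x ∈ B := hx.2
    have h2 : c.map.symm (c.map x) ∈ U := h1.1.2.1
    rwa [c.map.left_inv hx.1] at h2
  have hyB : y ∈ B := by
    refine ⟨⟨hy.1, hy.2, c.map.map_target hy.1⟩, ?_⟩
    change coef F.1 ∅ y ≠ 0
    rw [coef_of_mem F.1 ∅ (show y ∈ c.img (U ⊓ c.dom) from ⟨hy.1, hy.2, c.map.map_target hy.1⟩),
      ← body_eq_repr]
    exact hgc
  have hyW : y ∈ c.map.target ∧ c.map.symm y ∈ c.preimg B := by
    have : y ∈ c.img (c.preimg B) := by rw [himg]; exact hyB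
    exact this
  have hyW' : y' ∈ c'.map.target ∧ c'.map.symm y' ∈ c.preimg B := ⟨hy'.1, h ▸ hyW.2⟩
  have hu : IsUnit (c.iso (c.preimg B) (c.preimg_le B) (M.res hWU g)) := by
    refine isUnit_superFun _ fun z => ?_
    have hz : z.1 ∈ B := himg.le z.2
    have e := (evalAt_eq c (c.preimg_le B) z.1 z.2 _).symm.trans (evalAt_res c hWU z.1 z.2 g)
    rw [e]
    have := hz.2
    change coef F.1 ∅ z.1 ≠ 0 at this
    rw [coef_of_mem F.1 ∅ hz.1, ← body_eq_repr] at this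
    exact this
  have hu' : IsUnit (M.res hWU g) := by
    have := hu.map (c.iso (c.preimg B) (c.preimg_le B)).symm
    rwa [AlgEquiv.symm_apply_apply] at this
  have hu'' := (hu'.map (evalAt c' (c.preimg B) y' hyW')).map (body (n := n))
  rw [evalAt_res c' hWU y' hyW' g, hg'] at hu''
  exact not_isUnit_zero hu''

theorem SuperChart.iso_coord (c : SuperChart M q n) {W : Opens M.carrier} (hW : W ≤ c.dom)
    (I : Fin q ⊕ Fin n) : c.iso W hW (M.res hW (c.coord I)) = modelCoord (c.img W) I := by
  refine Subtype.ext (funext fun y => ?_)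
  refine (c.iso_res c.dom W subset_rfl hW _ y.1 y.2).trans ?_
  rw [SuperChart.coord, AlgEquiv.apply_symm_apply]
  rcases I with a | A <;> rfl

theorem SuperChart.coord_mem (c : SuperChart M q n) (I : Fin q ⊕ Fin n) :
    c.coord I ∈ M.par c.dom (idxPar I) := by
  refine c.symm_mem le_rfl fun y => ?_
  rcases I with a | A
  · exact scal_mem (fun y => y a) (by fun_prop) y
  · exact ι_mem _

theorem SuperChart.frame_coord (c : SuperChart M q n) {W : Opens M.carrier} (hW : W ≤ c.dom)
    (I J : Fin q ⊕ Fin n) :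
    (c.frame I).1 ⟨W, hW⟩ (M.res hW (c.coord J)) = if I = J then 1 else 0 := by
  change (c.iso W hW).symm (modelDeriv (c.img W) I (c.iso W hW (M.res hW (c.coord J)))) = _
  rw [c.iso_coord, modelDeriv_coord]
  split_ifs <;> simp

theorem add_self_parity (i : ZMod 2) : i + i = 0 := by revert i; decide

/-- A vector field that kills the coordinates is zero. -/
theorem der_eq_zero (c : SuperChart M q n) {W : Opens M.carrier} (hW : W ≤ c.dom) {i : ZMod 2}
    {D : Fam M W} (hD : D ∈ Der M W i)
    (h : ∀ I, D ⟨W, le_rfl⟩ (M.res hW (c.coord I)) = 0) : D = 0 := by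
  funext W'
  obtain ⟨W', hW'⟩ := W'
  refine LinearMap.ext fun f => ?_
  change D ⟨W', hW'⟩ f = 0
  refine eq_of_evalAt c (hW'.trans hW) fun y hy => ?_
  -- Equality is tested at one point `y`. A ball about it is convex, as `derivation_eq_zero`
  -- requires, and `D` restricted to the ball becomes a derivation of model superfunctions.
  obtain ⟨r, hr, hball⟩ := Metric.isOpen_iff.1 (c.img W').2 y hy
  let B : Opens (Fin q → ℝ) := ⟨Metric.ball y r, Metric.isOpen_ball⟩
  have himg : c.img (c.preimg B) = B := c.img_preimg fun z hz => (hball hz).1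
  have hconv : Convex ℝ (c.img (c.preimg B) : Set (Fin q → ℝ)) := by
    rw [himg]; exact convex_ball y r
  have hBW : c.preimg B ≤ W' := fun x hx => by
    have h2 : c.map.symm (c.map x) ∈ W' := (hball hx.2).2
    rwa [c.map.left_inv hx.1] at h2
  have hyB : y ∈ c.map.target ∧ c.map.symm y ∈ c.preimg B := by
    have : y ∈ c.img (c.preimg B) := by rw [himg]; exact Metric.mem_ball_self hr
    exact this
  let e := c.iso (c.preimg B) (c.preimg_le B)
  have hz := derivation_eq_zero hconv (i := i)
    (e.toLinearMap ∘ₗ D ⟨c.preimg B, hBW.trans hW'⟩ ∘ₗ e.symm.toLinearMap)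
    (fun j f g hf => by
      have := hD.2.2 (c.preimg B) (hBW.trans hW') j (e.symm f) (e.symm g)
        (c.symm_mem (c.preimg_le B) hf)
      simp only [LinearMap.comp_apply, AlgEquiv.toLinearMap_apply, map_mul]
      rw [this]
      simp only [map_add, map_mul, map_smul, AlgEquiv.apply_symm_apply])
    (fun I => by
      simp only [LinearMap.comp_apply, AlgEquiv.toLinearMap_apply]
      rw [← c.iso_coord (c.preimg_le B) I]
      change e (D ⟨c.preimg B, hBW.trans hW'⟩ (e.symm (e _))) = 0
      rw [AlgEquiv.symm_apply_apply, ← M.res_res hW (hBW.trans hW'), ← hD.1 W _ le_rfl, h I,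
        map_zero, map_zero])
    (e (M.res hBW f))
  simp only [LinearMap.comp_apply, AlgEquiv.toLinearMap_apply, AlgEquiv.symm_apply_apply] at hz
  have hz' : D ⟨c.preimg B, hBW.trans hW'⟩ (M.res hBW f) = 0 := by
    apply e.injective; rw [hz, map_zero]
  rw [← evalAt_res c hBW y hyB, hD.1 W' _ hW' hBW f, hz', map_zero, map_zero]

/-- The difference of the two sides kills all coordinates. Each summand is itself a derivation of
parity `i`, as the parity of the index enters twice, once through the coefficient and once through
the frame field. -/
theorem der_apply_eq_sum (c : SuperChart M q n) {W : Opens M.carrier} (hW : W ≤ c.dom) {i : ZMod 2}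
    {D : Fam M W} (hD : D ∈ Der M W i) (W' : Opens M.carrier) (hW' : W' ≤ W) (f : M.sec W') :
    D ⟨W', hW'⟩ f = ∑ I, M.res hW' (D ⟨W, le_rfl⟩ (M.res hW (c.coord I))) *
      (c.frame I).1 ⟨W', hW'.trans hW⟩ f := by
  let S : (Fin q ⊕ Fin n) → Fam M W := fun I W' =>
    LinearMap.mulLeft ℝ (M.res W'.2 (D ⟨W, le_rfl⟩ (M.res hW (c.coord I)))) ∘ₗ
      (c.frame I).1 ⟨W'.1, W'.2.trans hW⟩
  have hS : ∀ I, S I ∈ Der M W i := fun I => by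
    have h1 := hD.2.1 W le_rfl _ _ (M.res_mem hW (c.coord_mem I))
    have h2 : (fun W' => (c.frame I).1 ⟨W'.1, W'.2.trans hW⟩ : Fam M W) ∈ Der M W (idxPar I) :=
      ⟨fun W W' hW' h' a => (c.frame I).2.1 W W' (hW'.trans hW) h' a,
      fun W' hW' => (c.frame I).2.2.1 W' (hW'.trans hW),
      fun W' hW' => (c.frame I).2.2.2 W' (hW'.trans hW)⟩
    have h3 := smul_der_mem h1 h2
    rwa [add_assoc, add_self_parity, add_zero] at h3
  have hz := der_eq_zero c hW (D := D - ∑ I, S I)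
    (Submodule.sub_mem _ hD (Submodule.sum_mem _ fun I _ => hS I)) (fun I => by
      rw [Pi.sub_apply, Finset.sum_apply, LinearMap.sub_apply, LinearMap.sum_apply, sub_eq_zero]
      simp only [S, LinearMap.comp_apply, LinearMap.mulLeft_apply, c.frame_coord hW, M.res_id]
      simp)
  have := congrArg (fun E : Fam M W => E ⟨W', hW'⟩ f) hz
  simp only [Pi.sub_apply, Finset.sum_apply, LinearMap.sub_apply, LinearMap.sum_apply] at this
  rw [← sub_eq_zero]
  exact this

end ChartEvaluation

/-! ### Smoothness of families is independent of the chart. -/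

section ChartChange

variable {M : SuperSpace.{u}} {q n : ℕ}

theorem isSmooth_evalAt (c : SuperChart M q n) (U : Opens M.carrier) (f : M.sec U) :
    IsSmooth (V := c.img U) fun y => evalAt c U y.1 y.2 f :=
  (superFun_smooth (c.iso (U ⊓ c.dom) inf_le_right (M.res inf_le_left f))).comp (V₁ := c.img U) id
    contDiffOn_id fun _ hy => ⟨hy.1, hy.2, c.map.map_target hy.1⟩

/-- A family of sections that is smooth in one chart is smooth in every other one. -/
theorem contDiffAt_chartExpr (c c' : SuperChart M q n) {W : Opens (ℝ × M.carrier)}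
    {s : ∀ t, M.sec (slice W t)} (hs : IsSmooth (chartExpr c W s)) (S : Finset (Fin n))
    {p : ℝ × (Fin q → ℝ)} (hp : p ∈ prodImg c' W) (hpc : c'.map.symm p.2 ∈ c.dom) :
    ContDiffAt ℝ ∞ (coef (chartExpr c' W s) S) p := by
  obtain ⟨t₀, y₀⟩ := p
  have hmem : (t₀, c.map (c'.map.symm y₀)) ∈ prodImg c W :=
    ⟨c.map.map_source hpc, by
      change (t₀, c.map.symm (c.map (c'.map.symm y₀))) ∈ W
      rw [c.map.left_inv hpc]; exact hp.2⟩
  -- A time interval times a ball inside the image of `W` separates the parameter from the convex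
  -- domain.
  obtain ⟨r, hr, hball⟩ := Metric.isOpen_iff.1 (prodImg c W).2 _ hmem
  rw [← ball_prod_same] at hball
  let O : Opens ℝ := ⟨Metric.ball t₀ r, Metric.isOpen_ball⟩
  let B₀ : Opens (Fin q → ℝ) := ⟨Metric.ball (c.map (c'.map.symm y₀)) r, Metric.isOpen_ball⟩
  have himg : c.img (c.preimg B₀) = B₀ := c.img_preimg fun z hz =>
    (hball (show (t₀, z) ∈ _ from ⟨Metric.mem_ball_self hr, hz⟩)).1
  set U := c.preimg B₀ with hU
  have hUc : U ≤ c.dom := c.preimg_le B₀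
  have hUW : ∀ t ∈ O, U ≤ slice W t := fun t ht x hx => by
    have h : (t, c.map.symm (c.map x)) ∈ W := (hball (show (t, c.map x) ∈ _ from ⟨ht, hx.2⟩)).2
    rw [c.map.left_inv hx.1] at h
    exact h
  have hconv : Convex ℝ (c.img U : Set (Fin q → ℝ)) := by rw [himg]; exact convex_ball _ _
  have hy₀ : y₀ ∈ c'.img U := ⟨hp.1, hpc, Metric.mem_ball_self hr⟩
  have hφ : ∀ y ∈ c'.img U, c.map (c'.map.symm y) ∈ c.img U := fun y hy =>
    ⟨c.map.map_source (hUc hy.2), by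
      change c.map.symm (c.map (c'.map.symm y)) ∈ U
      rw [c.map.left_inv (hUc hy.2)]; exact hy.2⟩
  -- The homomorphism at `y` takes a superfunction in the coordinates of `c`, turns it into a
  -- section, and evaluates that in `c'`. On bodies it is evaluation at the changed point, by
  -- `body_evalAt`.
  have key := isSmooth_apply_family (V' := c'.img U) (B := c.img U)
    (fun y => (evalAt c' U y.1 y.2).comp (c.iso U hUc).symm.toAlgHom)
    (fun y => c.map (c'.map.symm y)) hconv hφ
    (fun f => isSmooth_evalAt c' U ((c.iso U hUc).symm f))
    (fun y f => by
      have h1 := body_evalAt c c' U (c.map (c'.map.symm y.1)) y.1 (hφ _ y.2) y.2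
        (c.map.left_inv (hUc y.2.2)) ((c.iso U hUc).symm f)
      have h2 := evalAt_eq c hUc _ (hφ _ y.2) ((c.iso U hUc).symm f)
      rw [AlgEquiv.apply_symm_apply] at h2
      exact h1.symm.trans (congrArg body h2))
    O (fun t => c.iso U hUc (M.res (hUW t.1 t.2) (s t.1))) (by
      have h2 := hs.comp (V₁ := oprod O (c.img U)) id contDiffOn_id fun z hz =>
        ⟨hz.2.1, hUW z.1 hz.1 hz.2.2⟩
      convert h2 using 2 with z
      exact (evalAt_eq c hUc z.1.2 z.2.2 _).symm.trans (evalAt_res c (hUW z.1.1 z.2.1) z.1.2 z.2.2 _))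
  have hopen : (oprod O (c'.img U) : Set (ℝ × (Fin q → ℝ))) ∈ nhds (t₀, y₀) :=
    (oprod O (c'.img U)).2.mem_nhds ⟨Metric.mem_ball_self hr, hy₀⟩
  refine ((key S).contDiffAt hopen).congr_of_eventuallyEq ?_
  filter_upwards [hopen] with z hz
  have hz' : z ∈ prodImg c' W := ⟨hz.2.1, hUW z.1 hz.1 hz.2.2⟩
  rw [coef_of_mem _ _ hz', coef_of_mem _ _ hz]
  refine congrArg (fun a => (monomials n).repr a S) ?_
  change _ = evalAt c' U z.2 hz.2 ((c.iso U hUc).symm (c.iso U hUc (M.res (hUW z.1 hz.1) (s z.1))))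
  rw [AlgEquiv.symm_apply_apply]
  exact (evalAt_res c' (hUW z.1 hz.1) z.2 hz.2 (s z.1)).symm

/-- Membership in `prodSec` asks for smoothness in all charts; over the domain of one chart, that
chart decides. -/
theorem mem_prodSec_of_chart (c : SuperChart M q n) {W : Opens (ℝ × M.carrier)}
    (hW : ∀ p ∈ W, p.2 ∈ c.dom) {s : ∀ t, M.sec (slice W t)} (hs : IsSmooth (chartExpr c W s)) :
    s ∈ prodSec M q n W := mem_prodSec.2 fun c' S _ hp =>
  (contDiffAt_chartExpr c c' hs S hp (hW _ hp.2)).contDiffWithinAt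

end ChartChange

/-! ### The chart of the product defined by a chart of the factor. -/

section ProductChart

variable {M : SuperSpace.{u}} {q n : ℕ}

theorem contDiff_cons (t : ℝ) : ContDiff ℝ ∞ (fun y : Fin q → ℝ => (Fin.cons t y : Fin (q + 1) → ℝ)) :=
  contDiff_pi.2 fun i => by
    refine Fin.cases ?_ (fun i => ?_) i
    · simpa using contDiff_const
    · simpa using contDiff_apply ℝ ℝ i

theorem contDiff_uncons : ContDiff ℝ ∞ (fun z : Fin (q + 1) → ℝ => (z 0, Fin.tail z)) :=
  (contDiff_apply ℝ ℝ 0).prodMk (contDiff_pi.2 fun i => contDiff_apply ℝ ℝ i.succ)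

theorem contDiff_cons₂ :
    ContDiff ℝ ∞ (fun z : ℝ × (Fin q → ℝ) => (Fin.cons z.1 z.2 : Fin (q + 1) → ℝ)) :=
  contDiff_pi.2 fun i => by
    refine Fin.cases ?_ (fun i => ?_) i
    · simpa using contDiff_fst
    · exact (contDiff_apply ℝ ℝ i).comp contDiff_snd

/-- The underlying map of the product chart. -/
def prodMap (c : SuperChart M q n) :
    OpenPartialHomeomorph (lineProd M q n).carrier (Fin (q + 1) → ℝ) where
  toFun p := Fin.cons p.1 (c.map p.2)
  invFun z := (z 0, c.map.symm (Fin.tail z))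
  source := {p | p.2 ∈ c.map.source}
  target := {z | Fin.tail z ∈ c.map.target}
  map_source' p hp := by
    change Fin.tail (Fin.cons p.1 (c.map p.2) : Fin (q + 1) → ℝ) ∈ c.map.target
    rw [Fin.tail_cons]; exact c.map.map_source hp
  map_target' z hz := c.map.map_target hz
  left_inv' p hp := by
    refine Prod.ext rfl ?_
    change c.map.symm (Fin.tail (Fin.cons p.1 (c.map p.2) : Fin (q + 1) → ℝ)) = p.2
    rw [Fin.tail_cons]; exact c.map.left_inv hp
  right_inv' z hz := by
    change (Fin.cons (z 0) (c.map (c.map.symm (Fin.tail z))) : Fin (q + 1) → ℝ) = z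
    rw [c.map.right_inv hz]; exact Fin.cons_self_tail z
  open_source := c.map.open_source.preimage continuous_snd
  open_target := c.map.open_target.preimage (continuous_snd.comp contDiff_uncons.continuous)
  continuousOn_toFun := contDiff_cons₂.continuous.comp_continuousOn
    (continuousOn_fst.prodMk (c.map.continuousOn.comp continuousOn_snd fun _ hp => hp))
  continuousOn_invFun := (continuous_apply 0).continuousOn.prodMk
    (c.map.continuousOn_symm.comp
      (continuous_snd.comp contDiff_uncons.continuous).continuousOn fun _ hz => hz)

/-- The part of `ℝ^{1+q}` that corresponds to `W`. -/
abbrev prodMapImg (c : SuperChart M q n) (W : Opens (lineProd M q n).carrier) :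
    Opens (Fin (q + 1) → ℝ) :=
  ⟨(prodMap c).target ∩ (prodMap c).symm ⁻¹' W, (prodMap c).isOpen_inter_preimage_symm W.2⟩

/-- The expression of a section of the product in the product chart. -/
def prodExpr (c : SuperChart M q n) (W : Opens (lineProd M q n).carrier) :
    (lineProd M q n).sec W →ₐ[ℝ] SuperFun n (prodMapImg c W) :=
  (((AlgHom.pi fun z : prodMapImg c W => (Pi.evalAlgHom ℝ (fun _ : prodImg c W => Grassmann n)
    ⟨(z.1 0, Fin.tail z.1), z.2⟩)).comp (chartExpr c W)).comp (prodSec M q n W).val).codRestrict _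
    fun s => mem_superFun.2 <| (mem_prodSec.1 s.2 c).comp (V₁ := prodMapImg c W)
      (fun z => (z 0, Fin.tail z)) contDiff_uncons.contDiffOn fun _ hz => hz

theorem evalAt_congr (c : SuperChart M q n) {W : Opens (ℝ × M.carrier)} (s : ∀ t, M.sec (slice W t))
    {t t' : ℝ} {y y' : Fin q → ℝ} (ht : t = t') (hy : y = y')
    (h : y ∈ c.map.target ∧ c.map.symm y ∈ slice W t)
    (h' : y' ∈ c.map.target ∧ c.map.symm y' ∈ slice W t') :
    evalAt c (slice W t) y h (s t) = evalAt c (slice W t') y' h' (s t') := by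
  subst ht hy; rfl

theorem cons_mem_prodMapImg (c : SuperChart M q n) {W : Opens (lineProd M q n).carrier} {t : ℝ}
    {y : Fin q → ℝ} (hy : y ∈ c.map.target ∧ c.map.symm y ∈ slice W t) :
    (Fin.cons t y : Fin (q + 1) → ℝ) ∈ prodMapImg c W := by
  refine ⟨?_, ?_⟩
  · change Fin.tail (Fin.cons t y : Fin (q + 1) → ℝ) ∈ c.map.target
    rw [Fin.tail_cons]; exact hy.1
  · change ((Fin.cons t y : Fin (q + 1) → ℝ) 0,
      c.map.symm (Fin.tail (Fin.cons t y : Fin (q + 1) → ℝ))) ∈ W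
    rw [Fin.tail_cons]; exact hy.2

theorem prodExpr_cons (c : SuperChart M q n) (W : Opens (lineProd M q n).carrier)
    (s : (lineProd M q n).sec W) {t : ℝ} {y : Fin q → ℝ}
    (hy : y ∈ c.map.target ∧ c.map.symm y ∈ slice W t) :
    (prodExpr c W s).1 ⟨Fin.cons t y, cons_mem_prodMapImg c hy⟩ =
      evalAt c (slice W t) y hy (s.1 t) :=
  evalAt_congr c s.1 rfl (Fin.tail_cons (α := fun _ => ℝ) t y) (cons_mem_prodMapImg c hy) hy

/-- Over the domain of `c`, sections are determined by their values, which gives injectivity. For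
surjectivity each slice of `F` at fixed time is transported by `c`; the resulting family is smooth
in `c`, hence in every chart. -/
theorem prodExpr_bijective (c : SuperChart M q n) (W : Opens (lineProd M q n).carrier)
    (hW : (W : Set (lineProd M q n).carrier) ⊆ (prodMap c).source) :
    Function.Bijective (prodExpr c W) := by
  have hWt : ∀ t, slice W t ≤ c.dom := fun t x hx => hW hx
  constructor
  · intro s s' h
    refine Subtype.ext (funext fun t => eq_of_evalAt c (hWt t) fun y hy => ?_)
    rw [← prodExpr_cons c W s hy, ← prodExpr_cons c W s' hy, h]
  · intro F
    have hm : ∀ t, ∀ y ∈ c.img (slice W t), (Fin.cons t y : Fin (q + 1) → ℝ) ∈ prodMapImg c W :=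
      fun t y hy => cons_mem_prodMapImg c hy
    let s : ∀ t, M.sec (slice W t) := fun t => (c.iso (slice W t) (hWt t)).symm
      ⟨fun y => F.1 ⟨Fin.cons t y.1, hm t y.1 y.2⟩, mem_superFun.2 <|
        (superFun_smooth F).comp (V₁ := c.img (slice W t)) (fun y => Fin.cons t y)
          (contDiff_cons t).contDiffOn (hm t)⟩
    have hs : ∀ t y (hy : y ∈ c.map.target ∧ c.map.symm y ∈ slice W t),
        evalAt c (slice W t) y hy (s t) = F.1 ⟨Fin.cons t y, hm t y hy⟩ := fun t y hy => by
      rw [evalAt_eq c (hWt t), AlgEquiv.apply_symm_apply]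
    have hmem : s ∈ prodSec M q n W := mem_prodSec_of_chart c (fun p hp => hW hp) (by
      have h := (superFun_smooth F).comp (V₁ := prodImg c W) (fun z => Fin.cons z.1 z.2)
        contDiff_cons₂.contDiffOn fun z hz => hm z.1 z.2 hz
      have e : chartExpr c W s = fun z => F.1 ⟨Fin.cons z.1.1 z.1.2, hm z.1.1 z.1.2 z.2⟩ :=
        funext fun z => hs z.1.1 z.1.2 z.2
      rw [e]; exact h)
    refine ⟨⟨s, hmem⟩, Subtype.ext (funext fun z => ?_)⟩
    refine (hs (z.1 0) (Fin.tail z.1) z.2).trans ?_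
    exact congrArg F.1 (Subtype.ext (Fin.cons_self_tail z.1))

/-- The product chart of `ℝ^{1|0} × M`. -/
def prodChart (c : SuperChart M q n) : SuperChart (lineProd M q n) (q + 1) n where
  map := prodMap c
  iso W hW := AlgEquiv.ofBijective (prodExpr c W) (prodExpr_bijective c W hW)
  iso_res _ _ _ h f y hy := evalAt_res c (slice_mono h (y 0)) (Fin.tail y) hy (f.1 (y 0))
  iso_par W _ _ _ hf y := evalAt_mem c (U := slice W (y.1 0)) (Fin.tail y.1) y.2 (hf (y.1 0))

theorem prodChart_iso_apply (c : SuperChart M q n) (W : Opens (lineProd M q n).carrier)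
    (hW : W ≤ (prodChart c).dom) (s : (lineProd M q n).sec W) :
    (prodChart c).iso W hW s = prodExpr c W s := rfl

/-- The coordinates of `M` as coordinates of `ℝ^{1|0} × M`. -/
def emb : Fin q ⊕ Fin n → Fin (q + 1) ⊕ Fin n := Sum.map Fin.succ id

theorem idxPar_emb (I : Fin q ⊕ Fin n) : idxPar (emb I) = idxPar I := by
  rcases I with a | A <;> rfl

theorem prodChart_coord_zero (c : SuperChart M q n) :
    (prodChart c).coord (Sum.inl 0) = timeSec (prodChart c).dom := by
  rw [SuperChart.coord, AlgEquiv.symm_apply_eq]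
  refine Subtype.ext (funext fun z => ?_)
  exact ((evalAt c (slice (cyl q n c.dom) (z.1 0)) (Fin.tail z.1) z.2).commutes (z.1 0)).symm

theorem prodChart_coord_emb (c : SuperChart M q n) (I : Fin q ⊕ Fin n) :
    (prodChart c).coord (emb I) =
      pull (show (prodChart c).dom ≤ cyl q n c.dom from le_rfl) (c.coord I) := by
  rw [SuperChart.coord, AlgEquiv.symm_apply_eq]
  refine Subtype.ext (funext fun z => ?_)
  have h1 : (prodExpr c (cyl q n c.dom) (pull (le_refl (cyl q n c.dom)) (c.coord I))).1 z =
      evalAt c c.dom (Fin.tail z.1) z.2 (c.coord I) :=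
    evalAt_res c (show slice (cyl q n c.dom) (z.1 0) ≤ c.dom from fun _ hx => hx) _ z.2 _
  refine Eq.trans (Eq.trans ?_ (evalAt_eq c le_rfl (Fin.tail z.1) z.2 (c.coord I)).symm) h1.symm
  rw [SuperChart.coord, AlgEquiv.apply_symm_apply]
  rcases I with a | A <;> rfl

/-- A derivative in a direction of `M` leaves `t` fixed, so it can be computed slice by slice: for
even coordinates this is the chain rule for `y ↦ (t, y)`, and odd derivatives act pointwise. -/
theorem prodChart_frame_emb (c : SuperChart M q n) (I : Fin q ⊕ Fin n)
    (W : Opens (lineProd M q n).carrier) (hW : W ≤ (prodChart c).dom)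
    (s : (lineProd M q n).sec W) (t : ℝ) :
    (((prodChart c).frame (emb I)).1 ⟨W, hW⟩ s).1 t =
      (c.frame I).1 ⟨slice W t, fun _ hx => hW hx⟩ (s.1 t) := by
  have hWt : slice W t ≤ c.dom := fun x hx => hW hx
  refine eq_of_evalAt c hWt fun y hy => ?_
  rw [← prodExpr_cons c W _ hy, ← prodChart_iso_apply c W hW]
  change ((prodChart c).iso W hW (((prodChart c).iso W hW).symm
    (modelDeriv ((prodChart c).img W) (emb I) ((prodChart c).iso W hW s)))).1 _ = _
  rw [AlgEquiv.apply_symm_apply, evalAt_eq c hWt]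
  change _ = ((c.iso (slice W t) hWt) ((c.iso (slice W t) hWt).symm
    (modelDeriv (c.img (slice W t)) I (c.iso (slice W t) hWt (s.1 t))))).1 _
  rw [AlgEquiv.apply_symm_apply]
  have hF : ∀ (y : Fin q → ℝ) (hy : y ∈ c.img (slice W t)),
      (c.iso (slice W t) hWt (s.1 t)).1 ⟨y, hy⟩ =
        ((prodChart c).iso W hW s).1 ⟨Fin.cons t y, cons_mem_prodMapImg c hy⟩ := fun y hy =>
    (evalAt_eq c hWt y hy _).symm.trans (prodExpr_cons c W s hy).symm
  rcases I with a | A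
  · apply (monomials n).repr.injective
    ext S
    refine (repr_dirDerivFun _ _ _ S).trans (Eq.trans ?_ (repr_dirDerivFun _ _ _ S).symm)
    have e : coef (c.iso (slice W t) hWt (s.1 t)).1 S =ᶠ[nhds y]
        coef ((prodChart c).iso W hW s).1 S ∘ fun y => (Fin.cons t y : Fin (q + 1) → ℝ) := by
      filter_upwards [(c.img (slice W t)).2.mem_nhds hy] with z hz
      exact ((coef_of_mem _ S hz).trans (congrArg (fun a => (monomials n).repr a S) (hF z hz))).trans
        (coef_of_mem ((prodChart c).iso W hW s).1 S (cons_mem_prodMapImg c hz)).symm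
    have hd := coef_differentiableAt ((prodChart c).iso W hW s) S
      ⟨Fin.cons t y, cons_mem_prodMapImg c hy⟩
    -- The derivative of `y ↦ (t, y)`, with zero time component.
    let L : Fin (q + 1) → (Fin q → ℝ) →L[ℝ] ℝ :=
      Fin.cons 0 fun i => ContinuousLinearMap.proj (R := ℝ) (φ := fun _ : Fin q => ℝ) i
    have hcons : HasFDerivAt (fun y : Fin q → ℝ => (Fin.cons t y : Fin (q + 1) → ℝ))
        (ContinuousLinearMap.pi L) y := by
      rw [hasFDerivAt_pi']
      intro i
      refine Fin.cases ?_ (fun i => ?_) i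
      · exact hasFDerivAt_const t y
      · exact hasFDerivAt_apply (𝕜 := ℝ) i y
    refine Eq.trans ?_ (congrArg (· (Pi.single a 1))
      (e.fderiv_eq.trans (hd.hasFDerivAt.comp y hcons).fderiv)).symm
    refine congrArg (fderiv ℝ (coef ((prodChart c).iso W hW s).1 S) (Fin.cons t y)) ?_
    funext i
    refine Fin.cases ?_ (fun i => ?_) i
    · simp [L]
    · simp [L, Pi.single_apply]
  · exact congrArg (contraction A) (hF y hy).symm

end ProductChart

/-! ### Module operations and parity of vector fields. -/

section VectorFieldAlgebra

variable {M : SuperSpace.{u}} {U V : Opens M.carrier}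

theorem vf_ext {X Y : VF M U} (h : ∀ W hW a, X.1 ⟨W, hW⟩ a = Y.1 ⟨W, hW⟩ a) : X = Y :=
  Subtype.ext (funext fun W => LinearMap.ext fun a => h W.1 W.2 a)

theorem exists_vf_split (X : VF M U) : ∃ (A : Der M U 0) (B : Der M U 1), X = vf A + vf B := by
  obtain ⟨A, hA, B, hB, h⟩ := Submodule.mem_sup.1 X.2
  exact ⟨⟨A, hA⟩, ⟨B, hB⟩, Subtype.ext h.symm⟩

theorem vf_induction {p : VF M U → Prop} (hom : ∀ (i : ZMod 2) (X : Der M U i), p (vf X))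
    (add : ∀ X Y, p X → p Y → p (X + Y)) (X : VF M U) : p X := by
  obtain ⟨A, B, rfl⟩ := exists_vf_split X
  exact add _ _ (hom 0 A) (hom 1 B)

theorem sec_induction {p : M.sec U → Prop} (hom : ∀ (i : ZMod 2) (f : M.sec U), f ∈ M.par U i → p f)
    (add : ∀ f g, p f → p g → p (f + g)) (f : M.sec U) : p f := by
  obtain ⟨a, b, ha, hb, rfl⟩ := exists_parity_split f
  exact add _ _ (hom 0 a ha) (hom 1 b hb)

theorem vf_res (X : VF M U) {W W' : Opens M.carrier} (hW : W ≤ U) (h : W' ≤ W) (a : M.sec W) :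
    M.res h (X.1 ⟨W, hW⟩ a) = X.1 ⟨W', h.trans hW⟩ (M.res h a) := by
  induction X using vf_induction with
  | hom i X => exact X.2.1 W W' hW h a
  | add X Y hX hY => exact (map_add _ _ _).trans (congrArg₂ (· + ·) hX hY)

theorem vf_ext_cover {ι : Type*} (C : ι → Opens M.carrier) (hcov : ∀ x ∈ U, ∃ i, x ∈ C i)
    {X Y : VF M U} (h : ∀ i, restr (inf_le_left : U ⊓ C i ≤ U) X = restr inf_le_left Y) : X = Y := by
  refine vf_ext fun W hW a => sec_ext_cover C (fun x hx => hcov x (hW hx)) fun i => ?_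
  rw [vf_res, vf_res]
  exact congrArg (fun Z : VF M (U ⊓ C i) => Z.1 ⟨W ⊓ C i, inf_le_inf_right _ hW⟩ (M.res inf_le_left a))
    (h i)

theorem fmul_apply (f : M.sec U) (X : VF M U) (W : Opens M.carrier) (hW : W ≤ U) (a : M.sec W) :
    (fmul f X).1 ⟨W, hW⟩ a = M.res hW f * X.1 ⟨W, hW⟩ a := rfl

theorem vf_add_apply (X Y : VF M U) (W : Opens M.carrier) (hW : W ≤ U) (a : M.sec W) :
    (X + Y).1 ⟨W, hW⟩ a = X.1 ⟨W, hW⟩ a + Y.1 ⟨W, hW⟩ a := rfl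

theorem act_fmul (f : M.sec U) (X : VF M U) (a : M.sec U) : act (fmul f X) a = f * act X a := by
  rw [act, fmul_apply, M.res_id]; rfl

theorem act_add_left (X Y : VF M U) (a : M.sec U) : act (X + Y) a = act X a + act Y a := rfl

theorem act_sub_left (X Y : VF M U) (a : M.sec U) : act (X - Y) a = act X a - act Y a := rfl

theorem act_smul_left (r : ℝ) (X : VF M U) (a : M.sec U) : act (r • X) a = r • act X a := rfl

theorem act_sum {ι : Type*} (s : Finset ι) (X : ι → VF M U) (a : M.sec U) :
    act (∑ i ∈ s, X i) a = ∑ i ∈ s, act (X i) a :=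
  map_sum (AddMonoidHom.mk' (fun X : VF M U => act X a) fun X Y => act_add_left X Y a) X s

theorem act_add (X : VF M U) (a b : M.sec U) : act X (a + b) = act X a + act X b := map_add _ _ _

theorem act_smul (X : VF M U) (r : ℝ) (a : M.sec U) : act X (r • a) = r • act X a := map_smul _ _ _

theorem res_act (X : VF M U) (h : V ≤ U) (a : M.sec U) :
    M.res h (act X a) = act (restr h X) (M.res h a) := vf_res X le_rfl h a

theorem act_mul {i j : ZMod 2} (X : Der M U i) {a : M.sec U} (ha : a ∈ M.par U j) (b : M.sec U) :
    act (vf X) (a * b) = act (vf X) a * b + sgn (i * j) • (a * act (vf X) b) :=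
  X.2.2.2 U le_rfl j a b ha

theorem act_mem {i j : ZMod 2} (X : Der M U i) {a : M.sec U} (ha : a ∈ M.par U j) :
    act (vf X) a ∈ M.par U (i + j) := X.2.2.1 U le_rfl j a ha

theorem vf_apply_one (X : VF M U) (W : Opens M.carrier) (hW : W ≤ U) : X.1 ⟨W, hW⟩ 1 = 0 := by
  induction X using vf_induction with
  | hom i X =>
    have h := X.2.2.2 W hW 0 1 1 (M.one_mem W)
    rw [mul_one, mul_one, one_mul, mul_zero, sgn_zero, one_smul] at h
    exact left_eq_add.1 h
  | add X Y hX hY => rw [vf_add_apply, hX, hY, add_zero]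

theorem vf_apply_algebraMap (X : VF M U) (W : Opens M.carrier) (hW : W ≤ U) (r : ℝ) :
    X.1 ⟨W, hW⟩ (algebraMap ℝ _ r) = 0 := by
  rw [Algebra.algebraMap_eq_smul_one, map_smul, vf_apply_one, smul_zero]

theorem fmul_add (f : M.sec U) (X Y : VF M U) : fmul f (X + Y) = fmul f X + fmul f Y :=
  vf_ext fun _ _ _ => mul_add _ _ _

theorem fmul_sub (f : M.sec U) (X Y : VF M U) : fmul f (X - Y) = fmul f X - fmul f Y :=
  vf_ext fun _ _ _ => mul_sub _ _ _

theorem add_fmul (f g : M.sec U) (X : VF M U) : fmul (f + g) X = fmul f X + fmul g X :=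
  vf_ext fun W hW a => by rw [fmul_apply, map_add, add_mul]; rfl

theorem sub_fmul (f g : M.sec U) (X : VF M U) : fmul (f - g) X = fmul f X - fmul g X :=
  vf_ext fun W hW a => by rw [fmul_apply, map_sub, sub_mul]; rfl

theorem fmul_fmul (f g : M.sec U) (X : VF M U) : fmul f (fmul g X) = fmul (f * g) X :=
  vf_ext fun W hW a => by rw [fmul_apply, fmul_apply, fmul_apply, map_mul, mul_assoc]

theorem one_fmul (X : VF M U) : fmul 1 X = X :=
  vf_ext fun W hW a => by rw [fmul_apply, map_one, one_mul]

theorem zero_fmul (X : VF M U) : fmul 0 X = 0 :=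
  vf_ext fun W hW a => by rw [fmul_apply, map_zero, zero_mul]; rfl

theorem smul_fmul (r : ℝ) (f : M.sec U) (X : VF M U) : fmul (r • f) X = r • fmul f X :=
  vf_ext fun W hW a => by rw [fmul_apply, map_smul, smul_mul_assoc]; rfl

theorem fmul_smul (r : ℝ) (f : M.sec U) (X : VF M U) : fmul f (r • X) = r • fmul f X :=
  vf_ext fun _ _ _ => mul_smul_comm _ _ _

theorem neg_fmul (f : M.sec U) (X : VF M U) : fmul (-f) X = -fmul f X := by
  rw [← neg_one_smul ℝ f, smul_fmul]; exact neg_one_smul ℝ (fmul f X)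

theorem restr_fmul (h : V ≤ U) (f : M.sec U) (X : VF M U) :
    restr h (fmul f X) = fmul (M.res h f) (restr h X) :=
  vf_ext fun W hW a => by
    rw [fmul_apply, M.res_res]; rfl

theorem restr_add (h : V ≤ U) (X Y : VF M U) : restr h (X + Y) = restr h X + restr h Y := rfl

theorem restr_sub (h : V ≤ U) (X Y : VF M U) : restr h (X - Y) = restr h X - restr h Y := rfl

theorem restr_smul (h : V ≤ U) (r : ℝ) (X : VF M U) : restr h (r • X) = r • restr h X := rfl

theorem restr_restr {W : Opens M.carrier} (h : V ≤ U) (h' : W ≤ V) (X : VF M U) :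
    restr h' (restr h X) = restr (h'.trans h) X := rfl

/-- Restriction of homogeneous vector fields. -/
def drestr {i : ZMod 2} (h : V ≤ U) (X : Der M U i) : Der M V i :=
  ⟨fun W => X.1 ⟨W.1, W.2.trans h⟩, fun W W' hW h' a => X.2.1 W W' (hW.trans h) h' a,
    fun W hW => X.2.2.1 W (hW.trans h), fun W hW => X.2.2.2 W (hW.trans h)⟩

theorem restr_vf {i : ZMod 2} (h : V ≤ U) (X : Der M U i) : restr h (vf X) = vf (drestr h X) := rfl

/-- The product of a homogeneous section and a homogeneous vector field. -/
def dmul {i j : ZMod 2} (f : M.sec U) (hf : f ∈ M.par U j) (X : Der M U i) : Der M U (j + i) :=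
  ⟨(fmul f (vf X)).1, smul_der_mem hf X.2⟩

theorem vf_dmul {i j : ZMod 2} (f : M.sec U) (hf : f ∈ M.par U j) (X : Der M U i) :
    vf (dmul f hf X) = fmul f (vf X) := rfl

theorem fmul_mem {i j k : ZMod 2} (hk : j + i = k) {f : M.sec U} (hf : f ∈ M.par U j) {X : VF M U}
    (hX : X.1 ∈ Der M U i) : (fmul f X).1 ∈ Der M U k := by
  subst hk; exact smul_der_mem hf hX

/-- An operator that is both even and odd sends every homogeneous section into both parity parts,
hence to zero. -/
theorem der_disjoint : Disjoint (Der M U 0) (Der M U 1) := by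
  refine Submodule.disjoint_def.2 fun D h0 h1 => funext fun W => LinearMap.ext fun a => ?_
  obtain ⟨a, b, ha, hb, rfl⟩ := exists_parity_split a
  have key : ∀ (j : ZMod 2) (a : M.sec W.1), a ∈ M.par W.1 j → D W a = 0 := fun j a ha => by
    have e0 := h0.2.1 W.1 W.2 j a ha
    have e1 := h1.2.1 W.1 W.2 j a ha
    rw [zero_add] at e0
    rw [add_comm] at e1
    exact eq_zero_of_mem_par e0 e1
  rw [map_add, key 0 a ha, key 1 b hb, add_zero]; rfl

theorem der_isCompl : IsCompl ((Der M U 0).submoduleOf (VF M U)) ((Der M U 1).submoduleOf (VF M U)) := by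
  constructor
  · refine Submodule.disjoint_def.2 fun X h0 h1 => Subtype.ext ?_
    exact Submodule.disjoint_def.1 der_disjoint X.1 h0 h1
  · rw [codisjoint_iff, eq_top_iff]
    intro X _
    obtain ⟨A, B, rfl⟩ := exists_vf_split X
    exact Submodule.add_mem_sup A.2 B.2

/-- The even part of a section. -/
def evenSec : M.sec U →ₗ[ℝ] M.sec U := Submodule.projection _ _ (M.par_isCompl U)

/-- The even part of a vector field. -/
def evenVF : VF M U →ₗ[ℝ] VF M U :=
  Submodule.projection (R := ℝ) (E := VF M U) ((Der M U 0).submoduleOf (VF M U))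
    ((Der M U 1).submoduleOf (VF M U)) der_isCompl

theorem evenVF_of_even (X : Der M U 0) : evenVF (vf X) = vf X :=
  Submodule.projection_apply_of_mem_left (R := ℝ) (E := VF M U) der_isCompl X.2

theorem evenVF_of_odd (X : Der M U 1) : evenVF (vf X) = 0 :=
  (Submodule.projection_apply_eq_zero_iff (R := ℝ) (E := VF M U) der_isCompl).2 X.2

/-- The parity involution of vector fields. -/
def twist (X : VF M U) : VF M U := (2 : ℝ) • evenVF X - X

theorem twist_add (X Y : VF M U) : twist (X + Y) = twist X + twist Y := by
  rw [twist, twist, twist, map_add]; module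

theorem twist_vf {i : ZMod 2} (X : Der M U i) : twist (vf X) = sgn i • vf X := by
  rw [twist]
  rcases parity_cases i with rfl | rfl
  · rw [evenVF_of_even, sgn_zero]; module
  · rw [evenVF_of_odd, sgn, if_neg one_ne_zero]; module

theorem evenSec_of_even {f : M.sec U} (hf : f ∈ M.par U 0) : evenSec f = f :=
  Submodule.projection_apply_of_mem_left _ hf

theorem evenSec_of_odd {f : M.sec U} (hf : f ∈ M.par U 1) : evenSec f = 0 :=
  (Submodule.projection_apply_eq_zero_iff _).2 hf

/-- The right multiplication `X f = (-1)^{|f||X|} f X`. -/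
def rmul (X : VF M U) (f : M.sec U) : VF M U := fmul (evenSec f) X + fmul (f - evenSec f) (twist X)

theorem rmul_hom {i j : ZMod 2} (X : Der M U i) {f : M.sec U} (hf : f ∈ M.par U j) :
    rmul (vf X) f = sgn (i * j) • fmul f (vf X) := by
  rcases parity_cases j with rfl | rfl
  · rw [rmul, evenSec_of_even hf, sub_self, zero_fmul, add_zero, mul_zero, sgn_zero, one_smul]
  · rw [rmul, evenSec_of_odd hf, sub_zero, zero_fmul, zero_add, mul_one, twist_vf, fmul_smul]

theorem rmul_add (X : VF M U) (f g : M.sec U) : rmul X (f + g) = rmul X f + rmul X g := by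
  rw [rmul, map_add, add_fmul, add_sub_add_comm, add_fmul, rmul, rmul]; abel

theorem add_rmul (X Y : VF M U) (f : M.sec U) : rmul (X + Y) f = rmul X f + rmul Y f := by
  rw [rmul, twist_add, fmul_add, fmul_add, rmul, rmul]; abel

theorem restr_rmul (h : V ≤ U) (X : VF M U) (f : M.sec U) :
    restr h (rmul X f) = rmul (restr h X) (M.res h f) := by
  induction X using vf_induction with
  | add X Y hX hY => rw [add_rmul, restr_add, restr_add, add_rmul, hX, hY]
  | hom i X =>
    induction f using sec_induction with
    | add f g hf hg => rw [rmul_add, map_add, restr_add, rmul_add, hf, hg]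
    | hom j f hf =>
      rw [rmul_hom X hf, restr_vf, rmul_hom _ (M.res_mem h hf), restr_smul, restr_fmul, restr_vf]

theorem supercomm_fmul {i j : ZMod 2} {f g : M.sec U} (hf : f ∈ M.par U i) (hg : g ∈ M.par U j)
    (X : VF M U) : fmul (f * g) X = sgn (i * j) • fmul (g * f) X := by
  rw [M.supercomm hf hg, smul_fmul]

end VectorFieldAlgebra

/-! ### Gluing vector fields. -/

section Gluing

variable {M : SuperSpace.{u}}

/-- Homogeneous vector fields can be glued. -/
theorem exists_glued_der {ι : Type u} {U : Opens M.carrier} {j : ZMod 2} (C : ι → Opens M.carrier)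
    (hcov : ∀ x ∈ U, ∃ i, x ∈ C i) (X : ∀ i, Der M (C i) j)
    (hX : ∀ i i' (W : Opens M.carrier) (h : W ≤ C i) (h' : W ≤ C i') (a : M.sec W),
      (X i).1 ⟨W, h⟩ a = (X i').1 ⟨W, h'⟩ a) :
    ∃ Y : Der M U j, ∀ i (W : Opens M.carrier) (h : W ≤ U) (h' : W ≤ C i) (a : M.sec W),
      Y.1 ⟨W, h⟩ a = (X i).1 ⟨W, h'⟩ a := by
  -- The value of the glued operator on a section is defined by gluing the local values over the
  -- sets `W ⊓ C i`.
  have hex : ∀ W : {W : Opens M.carrier // W ≤ U}, ∀ a : M.sec W.1, ∃ b : M.sec W.1, ∀ i,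
      M.res (inf_le_left : W.1 ⊓ C i ≤ W.1) b =
        (X i).1 ⟨W.1 ⊓ C i, inf_le_right⟩ (M.res inf_le_left a) := by
    intro W a
    obtain ⟨b, hb, -⟩ := M.glue W.1 (fun i => W.1 ⊓ C i) (fun i => inf_le_left)
      (fun x hx => (hcov x (W.2 hx)).imp fun i hi => ⟨hx, hi⟩)
      (fun i => (X i).1 ⟨W.1 ⊓ C i, inf_le_right⟩ (M.res inf_le_left a)) (fun i i' W' hi hi' => by
        rw [(X i).2.1, (X i').2.1, M.res_res, M.res_res]
        exact hX i i' W' _ _ _)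
    exact ⟨b, hb⟩
  choose F hF using hex
  have ext : ∀ (W : {W : Opens M.carrier // W ≤ U}) (a b : M.sec W.1),
      (∀ i, M.res (inf_le_left : W.1 ⊓ C i ≤ W.1) a = M.res inf_le_left b) → a = b := fun W a b h =>
    sec_ext_cover C (fun x hx => hcov x (W.2 hx)) h
  let D : Fam M U := fun W =>
    { toFun := F W
      map_add' := fun a b => ext W _ _ fun i => by rw [map_add, hF, hF, hF, map_add, map_add]
      map_smul' := fun r a => ext W _ _ fun i => by
        rw [RingHom.id_apply, map_smul, hF, hF, map_smul, map_smul] }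
  have hFl : ∀ i (W : Opens M.carrier) (h : W ≤ U) (h' : W ≤ C i) (a : M.sec W),
      F ⟨W, h⟩ a = (X i).1 ⟨W, h'⟩ a := by
    intro i W h h' a
    refine ext ⟨W, h⟩ _ _ fun k => ?_
    rw [hF, (X i).2.1]
    exact hX k i _ _ _ _
  have hres : ∀ (W W' : Opens M.carrier) (hW : W ≤ U) (h : W' ≤ W) (a : M.sec W),
      M.res h (F ⟨W, hW⟩ a) = F ⟨W', h.trans hW⟩ (M.res h a) := by
    intro W W' hW h a
    refine ext ⟨W', h.trans hW⟩ _ _ fun i => ?_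
    rw [hF, M.res_res, M.res_res]
    have e : M.res (inf_le_left.trans h : W' ⊓ C i ≤ W) (F ⟨W, hW⟩ a) =
        M.res (inf_le_inf_right (C i) h) (M.res (inf_le_left : W ⊓ C i ≤ W) (F ⟨W, hW⟩ a)) := by
      rw [M.res_res]
    rw [e, hF ⟨W, hW⟩ a i, (X i).2.1, M.res_res]
  -- Parity is a local property: the component of the wrong parity restricts to zero on each member
  -- of the cover.
  have hpar : ∀ (W : Opens M.carrier) (k : ZMod 2) (a : M.sec W), W ≤ U →
      (∀ i, M.res (inf_le_left : W ⊓ C i ≤ W) a ∈ M.par (W ⊓ C i) k) → a ∈ M.par W k := by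
    intro W k a hWU h
    obtain ⟨b, c, hb, hc, rfl⟩ := exists_parity_split a
    rcases parity_cases k with rfl | rfl
    · have : c = 0 := ext ⟨W, hWU⟩ c 0 fun i => by
        rw [map_zero]
        refine eq_zero_of_mem_par (i := 0) ?_ (M.res_mem _ hc)
        have h1 := Submodule.sub_mem _ (h i) (M.res_mem (inf_le_left : W ⊓ C i ≤ W) hb)
        rwa [map_add, add_sub_cancel_left] at h1
      rw [this, add_zero]; exact hb
    · have : b = 0 := ext ⟨W, hWU⟩ b 0 fun i => by
        rw [map_zero]
        refine eq_zero_of_mem_par (i := 0) (M.res_mem _ hb) ?_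
        have h1 := Submodule.sub_mem _ (h i) (M.res_mem (inf_le_left : W ⊓ C i ≤ W) hc)
        rwa [map_add, add_sub_cancel_right] at h1
      rw [this, zero_add]; exact hc
  refine ⟨⟨D, hres, fun W hW k a ha => hpar W _ _ hW fun i => ?_, fun W hW k a b ha =>
    ext ⟨W, hW⟩ _ _ fun i => ?_⟩, hFl⟩
  · change M.res _ (F ⟨W, hW⟩ a) ∈ _
    rw [hF ⟨W, hW⟩]
    exact (X i).2.2.1 _ _ k _ (M.res_mem _ ha)
  · change M.res _ (F ⟨W, hW⟩ (a * b)) = M.res _ (F ⟨W, hW⟩ a * b + sgn (j * k) • (a * F ⟨W, hW⟩ b))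
    rw [hF ⟨W, hW⟩, map_mul, (X i).2.2.2 _ _ k _ _ (M.res_mem _ ha), map_add, map_smul, map_mul, map_mul,
      hF ⟨W, hW⟩, hF ⟨W, hW⟩]

end Gluing

/-! ### Expansion of vector fields in the natural frame. -/

section FrameExpansion

variable {M : SuperSpace.{u}} {q n : ℕ}

theorem vf_apply_eq_sum (c : SuperChart M q n) {W : Opens M.carrier} (hW : W ≤ c.dom) (X : VF M W)
    (W' : Opens M.carrier) (hW' : W' ≤ W) (f : M.sec W') :
    X.1 ⟨W', hW'⟩ f = ∑ I, M.res hW' (act X (M.res hW (c.coord I))) *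
      (c.frame I).1 ⟨W', hW'.trans hW⟩ f := by
  induction X using vf_induction with
  | hom i X => exact der_apply_eq_sum c hW X.2 W' hW' f
  | add X Y hX hY =>
    rw [vf_add_apply, hX, hY, ← Finset.sum_add_distrib]
    refine Finset.sum_congr rfl fun I _ => ?_
    rw [act_add_left, map_add, add_mul]

theorem vf_eq_sum (c : SuperChart M q n) {W : Opens M.carrier} (hW : W ≤ c.dom) (X : VF M W) :
    X = ∑ I, fmul (act X (M.res hW (c.coord I))) (vf (drestr hW (c.frame I))) := by
  refine vf_ext fun W' hW' f => ?_
  rw [vf_apply_eq_sum c hW X, AddSubmonoidClass.coe_finsetSum, Finset.sum_apply, LinearMap.sum_apply]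
  rfl

theorem vf_ext_coord (c : SuperChart M q n) {W : Opens M.carrier} (hW : W ≤ c.dom) {X Y : VF M W}
    (h : ∀ I, act X (M.res hW (c.coord I)) = act Y (M.res hW (c.coord I))) : X = Y := by
  rw [vf_eq_sum c hW X, vf_eq_sum c hW Y]
  exact Finset.sum_congr rfl fun I _ => by rw [h I]

end FrameExpansion

/-! ### Functions of time and the vector field ∂_t. -/

section PartialT

variable {M : SuperSpace.{u}} {q n : ℕ}

variable (M q n) in
/-- `M` is covered by charts. -/
def Charted : Prop := ∀ x : M.carrier, ∃ c : SuperChart M q n, x ∈ c.dom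

/-- The value of a section of the product at time `t`. -/
def atTime (W : Opens (lineProd M q n).carrier) (t : ℝ) :
    (lineProd M q n).sec W →ₐ[ℝ] M.sec (slice W t) :=
  (Pi.evalAlgHom ℝ (fun t => M.sec (slice W t)) t).comp (prodSec M q n W).val

theorem prodSec_ext {W : Opens (lineProd M q n).carrier} {s s' : (lineProd M q n).sec W}
    (h : ∀ t, s.1 t = s'.1 t) : s = s' := Subtype.ext (funext h)

/-- A smooth function of time as a section of the product. -/
def tfun (φ : ℝ → ℝ) (hφ : ContDiff ℝ ∞ φ) (W : Opens (lineProd M q n).carrier) :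
    (lineProd M q n).sec W :=
  ⟨fun t => algebraMap ℝ _ (φ t), mem_prodSec.2 fun c =>
    .of_coef (fun S p => φ p.1 * (monomials n).repr 1 S)
      (fun S => (hφ.comp_contDiffOn contDiffOn_fst).mul contDiffOn_const) fun S p => by
        have h : chartExpr c W (fun t => algebraMap ℝ _ (φ t)) p =
            algebraMap ℝ (Grassmann n) (φ p.1.1) := (evalAt c (slice W p.1.1) p.1.2 p.2).commutes _
        rw [h, Algebra.algebraMap_eq_smul_one, map_smul, Finsupp.smul_apply, smul_eq_mul]⟩

theorem tfun_apply (φ : ℝ → ℝ) (hφ : ContDiff ℝ ∞ φ) (W : Opens (lineProd M q n).carrier) (t : ℝ) :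
    (tfun (M := M) (q := q) (n := n) φ hφ W).1 t = algebraMap ℝ _ (φ t) := rfl

theorem tfun_mem (φ : ℝ → ℝ) (hφ : ContDiff ℝ ∞ φ) (W : Opens (lineProd M q n).carrier) :
    tfun φ hφ W ∈ (lineProd M q n).par W 0 := fun t => by
  rw [tfun_apply, Algebra.algebraMap_eq_smul_one]
  exact Submodule.smul_mem _ _ (M.one_mem _)

theorem timeSec_mem (W : Opens (lineProd M q n).carrier) :
    timeSec W ∈ (lineProd M q n).par W 0 := tfun_mem id contDiff_id W

theorem res_timeSec {W W' : Opens (lineProd M q n).carrier} (h : W' ≤ W) :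
    (lineProd M q n).res h (timeSec W) = timeSec W' :=
  prodSec_ext fun t => (M.res (slice_mono h t)).commutes t

theorem res_tfun (φ : ℝ → ℝ) (hφ : ContDiff ℝ ∞ φ) {W W' : Opens (lineProd M q n).carrier}
    (h : W' ≤ W) : (lineProd M q n).res h (tfun φ hφ W) = tfun φ hφ W' :=
  prodSec_ext fun t => (M.res (slice_mono h t)).commutes (φ t)

theorem prodChart_frame_zero (c : SuperChart M q n) (W : Opens (lineProd M q n).carrier)
    (hW : W ≤ (prodChart c).dom) (s s' : (lineProd M q n).sec W)
    (h : ∀ (S : Finset (Fin n)) (z : Fin (q + 1) → ℝ) (hz : z ∈ prodMapImg c W),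
      fderiv ℝ (coef (prodExpr c W s).1 S) z (Pi.single 0 1) =
        (monomials n).repr ((prodExpr c W s').1 ⟨z, hz⟩) S) :
    ((prodChart c).frame (Sum.inl 0)).1 ⟨W, hW⟩ s = s' := by
  apply ((prodChart c).iso W hW).injective
  refine ((prodChart c).iso W hW).apply_symm_apply _ |>.trans ?_
  refine Subtype.ext (funext fun z => ?_)
  apply (monomials n).repr.injective
  ext S
  exact (repr_dirDerivFun _ _ _ S).trans (h S z.1 z.2)

/-- In the product chart a pull-back factors through `Fin.tail`, whose derivative kills the time
direction. -/
theorem prodChart_frame_zero_pull (c : SuperChart M q n) (W : Opens (lineProd M q n).carrier)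
    (hW : W ≤ (prodChart c).dom) {V : Opens M.carrier} (hV : W ≤ cyl q n V) (f : M.sec V) :
    ((prodChart c).frame (Sum.inl 0)).1 ⟨W, hW⟩ (pull hV f) = 0 := by
  refine prodChart_frame_zero c W hW _ _ fun S z hz => ?_
  have h0 : (prodExpr c W (0 : (lineProd M q n).sec W)).1 ⟨z, hz⟩ = 0 :=
    congrArg (fun F : SuperFun n (prodMapImg c W) => F.1 ⟨z, hz⟩) (map_zero (prodExpr c W))
  rw [h0, map_zero, Finsupp.zero_apply]
  have hm : ∀ z ∈ prodMapImg c W, Fin.tail z ∈ c.img V := fun z hz => ⟨hz.1, hV hz.2⟩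
  let G : c.img V → Grassmann n := fun y => evalAt c V y.1 y.2 f
  have hG : IsSmooth G := isSmooth_evalAt c V f
  have e : coef (prodExpr c W (pull hV f)).1 S =ᶠ[nhds z] coef G S ∘ Fin.tail := by
    filter_upwards [(prodMapImg c W).2.mem_nhds hz] with y hy
    refine (coef_of_mem _ S hy).trans (Eq.trans ?_ (coef_of_mem G S (hm y hy)).symm)
    exact congrArg (fun a => (monomials n).repr a S)
      (evalAt_res c (show slice W (y 0) ≤ V from fun _ hx => hV hx) (Fin.tail y) hy f)
  let L : (Fin (q + 1) → ℝ) →L[ℝ] (Fin q → ℝ) := ContinuousLinearMap.pi fun i =>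
    ContinuousLinearMap.proj (R := ℝ) (φ := fun _ : Fin (q + 1) => ℝ) i.succ
  have hL : HasFDerivAt (Fin.tail : (Fin (q + 1) → ℝ) → Fin q → ℝ) L z := L.hasFDerivAt
  have hd : DifferentiableAt ℝ (coef G S) (Fin.tail z) :=
    ((hG S).differentiableOn (by simp)).differentiableAt ((c.img V).2.mem_nhds (hm z hz))
  rw [e.fderiv_eq, (hd.hasFDerivAt.comp z hL).fderiv, ContinuousLinearMap.comp_apply]
  have : L (Pi.single 0 1) = 0 := by funext i; simp [L]
  rw [this, map_zero]

theorem prodChart_frame_zero_tfun (c : SuperChart M q n) (W : Opens (lineProd M q n).carrier)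
    (hW : W ≤ (prodChart c).dom) (φ : ℝ → ℝ) (hφ : ContDiff ℝ ∞ φ) (hφ' : ContDiff ℝ ∞ (deriv φ)) :
    ((prodChart c).frame (Sum.inl 0)).1 ⟨W, hW⟩ (tfun φ hφ W) = tfun (deriv φ) hφ' W := by
  refine prodChart_frame_zero c W hW _ _ fun S z hz => ?_
  have ht : ∀ (ψ : ℝ → ℝ) (hψ : ContDiff ℝ ∞ ψ) (z : Fin (q + 1) → ℝ) (hz : z ∈ prodMapImg c W),
      (prodExpr c W (tfun ψ hψ W)).1 ⟨z, hz⟩ = ψ (z 0) • 1 := fun ψ hψ z hz =>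
    ((evalAt c (slice W (z 0)) (Fin.tail z) hz).commutes _).trans (Algebra.algebraMap_eq_smul_one _)
  rw [ht, map_smul, Finsupp.smul_apply, smul_eq_mul]
  have e : coef (prodExpr c W (tfun φ hφ W)).1 S =ᶠ[nhds z]
      fun y => φ (y 0) * (monomials n).repr 1 S := by
    filter_upwards [(prodMapImg c W).2.mem_nhds hz] with y hy
    refine (coef_of_mem _ S hy).trans ?_
    rw [ht, map_smul, Finsupp.smul_apply, smul_eq_mul]
  have h1 : HasFDerivAt (fun y : Fin (q + 1) → ℝ => φ (y 0)) (deriv φ (z 0) •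
      (ContinuousLinearMap.proj (R := ℝ) (φ := fun _ : Fin (q + 1) => ℝ) 0)) z :=
    ((hφ.differentiable (by simp)) (z 0)).hasDerivAt.comp_hasFDerivAt z (hasFDerivAt_apply 0 z)
  rw [e.fderiv_eq, (h1.mul_const _).fderiv]
  simp [mul_comm]

theorem forall_prodIdx {p : Fin (q + 1) ⊕ Fin n → Prop} (h0 : p (Sum.inl 0)) (h : ∀ I, p (emb I))
    (A : Fin (q + 1) ⊕ Fin n) : p A := by
  rcases A with a | A
  · exact Fin.cases h0 (fun a => h (Sum.inl a)) a
  · exact h (Sum.inr A)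

theorem sum_prodIdx {A : Type*} [AddCommMonoid A] (F : Fin (q + 1) ⊕ Fin n → A) :
    ∑ I, F I = F (Sum.inl 0) + ∑ I, F (emb I) := by
  rw [Fintype.sum_sum_type, Fin.sum_univ_succ, Fintype.sum_sum_type, add_assoc]
  rfl

theorem res_coord_zero (c : SuperChart M q n) {W : Opens (lineProd M q n).carrier}
    (hW : W ≤ (prodChart c).dom) :
    (lineProd M q n).res hW ((prodChart c).coord (Sum.inl 0)) = timeSec W := by
  rw [prodChart_coord_zero]; exact res_timeSec hW

theorem res_coord_emb (c : SuperChart M q n) {W : Opens (lineProd M q n).carrier}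
    (hW : W ≤ (prodChart c).dom) (I : Fin q ⊕ Fin n) :
    (lineProd M q n).res hW ((prodChart c).coord (emb I)) =
      pull (show W ≤ cyl q n c.dom from hW) (c.coord I) := by
  rw [prodChart_coord_emb]
  exact prodSec_ext fun t => M.res_res _ _ _

/-- The conditions fix the values of `D` on all coordinates of the product chart. They do not refer
to the time frame field of a particular chart, and this is what makes the local fields ∂_t agree on
overlaps. -/
theorem eq_frame_zero (c : SuperChart M q n) {W : Opens (lineProd M q n).carrier}
    (hW : W ≤ (prodChart c).dom) (D : Der (lineProd M q n) W 0)
    (h1 : D.1 ⟨W, le_rfl⟩ (timeSec W) = 1)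
    (h2 : ∀ I, D.1 ⟨W, le_rfl⟩ (pull (show W ≤ cyl q n c.dom from hW) (c.coord I)) = 0) :
    D = drestr hW ((prodChart c).frame (Sum.inl 0)) := by
  have : vf D = vf (drestr hW ((prodChart c).frame (Sum.inl 0))) := by
    refine vf_ext_coord (prodChart c) hW fun A => ?_
    refine forall_prodIdx (p := fun A => act (vf D) ((lineProd M q n).res hW ((prodChart c).coord A)) =
      act (vf (drestr hW ((prodChart c).frame (Sum.inl 0))))
        ((lineProd M q n).res hW ((prodChart c).coord A))) ?_ (fun I => ?_) A
    · refine Eq.trans ?_ ((prodChart c).frame_coord hW (Sum.inl 0) (Sum.inl 0)).symm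
      rw [res_coord_zero, if_pos rfl]; exact h1
    · refine Eq.trans ?_ ((prodChart c).frame_coord hW (Sum.inl 0) (emb I)).symm
      rw [res_coord_emb, if_neg (by rcases I with a | A <;> simp [emb, Fin.ext_iff])]
      exact h2 I
  exact Subtype.ext (congrArg (fun Z : VF (lineProd M q n) W => Z.1) this)

theorem frame_zero_time (c : SuperChart M q n) {W : Opens (lineProd M q n).carrier}
    (hW : W ≤ (prodChart c).dom) :
    ((prodChart c).frame (Sum.inl 0)).1 ⟨W, hW⟩ (timeSec W) = 1 := by
  rw [← res_coord_zero c hW]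
  exact ((prodChart c).frame_coord hW (Sum.inl 0) (Sum.inl 0)).trans (if_pos rfl)

/-- The time frame fields of the product charts satisfy the criterion of `eq_frame_zero` for each
other, so they glue to a global field. -/
theorem exists_isPartialT (hM : Charted M q n) :
    ∃ T : VF (lineProd M q n) ⊤, IsPartialT T := by
  have hcov : ∀ x ∈ (⊤ : Opens (lineProd M q n).carrier),
      ∃ c : SuperChart M q n, x ∈ (prodChart c).dom := fun x _ => hM x.2
  obtain ⟨T, hT⟩ := exists_glued_der (U := ⊤) (fun c : SuperChart M q n => (prodChart c).dom) hcov
    (fun c => (prodChart c).frame (Sum.inl 0)) (fun c c' W h h' a => by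
      have := eq_frame_zero c' h' (drestr h ((prodChart c).frame (Sum.inl 0)))
        (frame_zero_time c h) (fun I => prodChart_frame_zero_pull c W h _ _)
      exact congrArg (fun D : Der (lineProd M q n) W 0 => D.1 ⟨W, le_rfl⟩ a) this)
  refine ⟨vf T, T.2, ?_, fun V => LinearMap.ext fun f => ?_⟩
  · refine sec_ext_cover (fun c : SuperChart M q n => (prodChart c).dom) hcov fun c => ?_
    rw [res_act, res_timeSec, map_one]
    exact (hT c _ _ inf_le_right _).trans (frame_zero_time c inf_le_right)
  · refine sec_ext_cover (fun c : SuperChart M q n => (prodChart c).dom)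
      (fun x _ => hcov x trivial) fun c => ?_
    refine (T.2.1 _ _ le_top inf_le_left _).trans ((hT c _ _ inf_le_right _).trans ?_)
    refine Eq.trans ?_ (map_zero _).symm
    have : (lineProd M q n).res (inf_le_left : cyl q n V ⊓ (prodChart c).dom ≤ cyl q n V)
        (pull (le_refl (cyl q n V)) f) = pull inf_le_left f :=
      (res_pull _ inf_le_left le_rfl _ f).trans (by rw [M.res_id])
    exact (congrArg _ this).trans (prodChart_frame_zero_pull c _ inf_le_right inf_le_left f)

/-- Existence excludes the default value 0 in the definition of `partialT`. -/
theorem isPartialT_partialT (hM : Charted M q n) : IsPartialT (partialT M q n) := by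
  have h := exists_isPartialT hM
  rw [partialT, dif_pos h]
  exact h.choose_spec

variable {T : VF (lineProd M q n) ⊤}

theorem IsPartialT.apply_time (hT : IsPartialT T) (W : Opens (lineProd M q n).carrier) :
    T.1 ⟨W, le_top⟩ (timeSec W) = 1 := by
  rw [← res_timeSec (le_top : W ≤ ⊤), ← vf_res T le_rfl le_top]
  exact (congrArg _ hT.time).trans (map_one _)

theorem IsPartialT.apply_pull (hT : IsPartialT T) {V : Opens M.carrier}
    {W : Opens (lineProd M q n).carrier} (h : W ≤ cyl q n V) (f : M.sec V) :
    T.1 ⟨W, le_top⟩ (SuperGeom.pull h f) = 0 := by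
  have h1 : (lineProd M q n).res h (SuperGeom.pull (le_refl (cyl q n V)) f) = SuperGeom.pull h f :=
    (res_pull _ h le_rfl h f).trans (by rw [M.res_id])
  rw [← h1, ← vf_res T le_top h]
  exact (congrArg _ (LinearMap.congr_fun (hT.pull V) f)).trans (map_zero _)

/-- The vector field `∂_t` on an open set, as an even vector field. -/
def IsPartialT.der (hT : IsPartialT T) (W : Opens (lineProd M q n).carrier) :
    Der (lineProd M q n) W 0 := drestr le_top ⟨T.1, hT.even⟩

theorem IsPartialT.eq_frame (hT : IsPartialT T) (c : SuperChart M q n)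
    {W : Opens (lineProd M q n).carrier} (hW : W ≤ (prodChart c).dom) :
    hT.der W = drestr hW ((prodChart c).frame (Sum.inl 0)) :=
  eq_frame_zero c hW _ (hT.apply_time W) fun _ => hT.apply_pull _ _

theorem IsPartialT.apply_tfun (hT : IsPartialT T) (hM : Charted M q n)
    (W : Opens (lineProd M q n).carrier) (φ : ℝ → ℝ) (hφ : ContDiff ℝ ∞ φ)
    (hφ' : ContDiff ℝ ∞ (deriv φ)) :
    T.1 ⟨W, le_top⟩ (tfun φ hφ W) = tfun (deriv φ) hφ' W := by
  refine sec_ext_cover (fun c : SuperChart M q n => (prodChart c).dom) (fun x _ => hM x.2) fun c => ?_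
  rw [vf_res, res_tfun, res_tfun]
  refine Eq.trans ?_ (prodChart_frame_zero_tfun c _ inf_le_right φ hφ hφ')
  exact congrArg (fun D : Der (lineProd M q n) _ 0 => D.1 ⟨_, le_rfl⟩ (tfun φ hφ _))
    (hT.eq_frame c (W := W ⊓ (prodChart c).dom) inf_le_right)

end PartialT

/-! ### Bilinearity, graded antisymmetry and Leibniz rules of the bracket. -/

section Brackets

variable {M : SuperSpace.{u}} {U V : Opens M.carrier}

theorem sgn_mul_self (a : ZMod 2) : sgn a * sgn a = 1 := by
  rw [sgn_mul_sgn, add_self_parity, sgn_zero]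

/-- Change of the (propositionally equal) parity of a homogeneous vector field. -/
def dcast {i j : ZMod 2} (h : i = j) (X : Der M U i) : Der M U j := ⟨X.1, h ▸ X.2⟩

theorem vf_injective {i : ZMod 2} {X Y : Der M U i} (h : vf X = vf Y) : X = Y :=
  Subtype.ext (congrArg (fun Z : VF M U => Z.1) h)

theorem vf_add {i : ZMod 2} (X Y : Der M U i) : vf (X + Y) = vf X + vf Y := rfl

theorem vf_smul {i : ZMod 2} (r : ℝ) (X : Der M U i) : vf (r • X) = r • vf X := rfl

theorem vf_bracket_add_left {i j : ZMod 2} (X X' : Der M U i) (Y : Der M U j) :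
    vf (bracket (X + X') Y) = vf (bracket X Y) + vf (bracket X' Y) :=
  vf_ext fun W hW a => by
    change (X.1 _ (Y.1 _ a) + X'.1 _ (Y.1 _ a)) -
      sgn (i * j) • (Y.1 ⟨W, hW⟩ (X.1 ⟨W, hW⟩ a + X'.1 ⟨W, hW⟩ a)) =
      (X.1 _ (Y.1 _ a) - sgn (i * j) • Y.1 _ (X.1 _ a)) +
      (X'.1 _ (Y.1 _ a) - sgn (i * j) • Y.1 _ (X'.1 _ a))
    rw [map_add]; module

theorem vf_bracket_symm {i j : ZMod 2} (X : Der M U i) (Y : Der M U j) :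
    vf (bracket X Y) = -(sgn (i * j) • vf (bracket Y X)) :=
  vf_ext fun W hW a => by
    change X.1 ⟨W, hW⟩ (Y.1 ⟨W, hW⟩ a) - sgn (i * j) • Y.1 ⟨W, hW⟩ (X.1 ⟨W, hW⟩ a) =
      -(sgn (i * j) • (Y.1 ⟨W, hW⟩ (X.1 ⟨W, hW⟩ a) - sgn (j * i) • X.1 ⟨W, hW⟩ (Y.1 ⟨W, hW⟩ a)))
    rw [smul_sub, smul_smul, mul_comm j i, sgn_mul_self]; module

theorem vf_bracket_add_right {i j : ZMod 2} (X : Der M U i) (Y Y' : Der M U j) :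
    vf (bracket X (Y + Y')) = vf (bracket X Y) + vf (bracket X Y') := by
  rw [vf_bracket_symm, vf_bracket_add_left, vf_bracket_symm X Y, vf_bracket_symm X Y']; module

theorem vf_bracket_dmul_right {i j l : ZMod 2} (X : Der M U i) {f : M.sec U} (hf : f ∈ M.par U l)
    (Y : Der M U j) : vf (bracket X (dmul f hf Y)) =
      fmul (act (vf X) f) (vf Y) + sgn (i * l) • fmul f (vf (bracket X Y)) :=
  vf_ext fun W hW a => by
    change X.1 ⟨W, hW⟩ (M.res hW f * Y.1 ⟨W, hW⟩ a) -
      sgn (i * (l + j)) • (M.res hW f * Y.1 ⟨W, hW⟩ (X.1 ⟨W, hW⟩ a)) =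
      M.res hW (act (vf X) f) * Y.1 ⟨W, hW⟩ a + sgn (i * l) • (M.res hW f *
        (X.1 ⟨W, hW⟩ (Y.1 ⟨W, hW⟩ a) - sgn (i * j) • Y.1 ⟨W, hW⟩ (X.1 ⟨W, hW⟩ a)))
    rw [X.2.2.2 W hW l _ _ (M.res_mem hW hf), res_act, mul_sub, mul_smul_comm, smul_sub, smul_smul,
      sgn_mul_sgn, ← mul_add]
    change M.res hW f |> fun s => X.1 ⟨W, hW⟩ s * _ + _ - _ = X.1 ⟨W, hW⟩ s * _ + _
    module

theorem vf_bracket_dmul_left {i j l : ZMod 2} {f : M.sec U} (hf : f ∈ M.par U l) (X : Der M U i)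
    (Y : Der M U j) : vf (bracket (dmul f hf X) Y) =
      fmul f (vf (bracket X Y)) - sgn ((l + i) * j) • fmul (act (vf Y) f) (vf X) := by
  rw [vf_bracket_symm, vf_bracket_dmul_right, vf_bracket_symm X Y]
  rw [← neg_one_smul ℝ (sgn (i * j) • vf (bracket Y X)), fmul_smul, fmul_smul]
  rcases parity_cases i with rfl | rfl <;> rcases parity_cases j with rfl | rfl <;>
    rcases parity_cases l with rfl | rfl <;> simp [sgn, add_self_parity] <;> module

end Brackets

/-! ### Even pairings and their non-degeneracy in a chart. -/

section Pairings

variable {M : SuperSpace.{u}} {U V : Opens M.carrier} {q n : ℕ}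

/-- Even, graded symmetric pairings of vector fields that are linear over the sections. -/
structure IsEvenPairing (g : Pairing M) : Prop where
  res : ∀ {U V : Opens M.carrier} (h : V ≤ U) (X Y : VF M U),
    M.res h (g U X Y) = g V (restr h X) (restr h Y)
  add_left : ∀ (U : Opens M.carrier) (X Y Z : VF M U), g U (X + Y) Z = g U X Z + g U Y Z
  add_right : ∀ (U : Opens M.carrier) (X Y Z : VF M U), g U X (Y + Z) = g U X Y + g U X Z
  smul_left : ∀ (U : Opens M.carrier) (f : M.sec U) (X Y : VF M U),
    g U (fmul f X) Y = f * g U X Y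
  even : ∀ (U : Opens M.carrier) {i j : ZMod 2} (X : Der M U i) (Y : Der M U j),
    g U (vf X) (vf Y) ∈ M.par U (i + j)
  symm : ∀ (U : Opens M.carrier) {i j : ZMod 2} (X : Der M U i) (Y : Der M U j),
    g U (vf X) (vf Y) = sgn (i * j) • g U (vf Y) (vf X)

theorem IsRiemannianMetric.isEvenPairing {g : Pairing M} (hg : IsRiemannianMetric q n g) :
    IsEvenPairing g :=
  ⟨hg.res, hg.add_left, hg.add_right, hg.smul_left, hg.even, hg.symm⟩

variable {g : Pairing M}

namespace IsEvenPairing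

theorem rsmul_left (hg : IsEvenPairing g) (r : ℝ) (X Y : VF M U) :
    g U (r • X) Y = r • g U X Y := by
  have h : r • X = fmul (algebraMap ℝ _ r) X := by
    rw [Algebra.algebraMap_eq_smul_one, smul_fmul, one_fmul]
  rw [h, hg.smul_left, Algebra.algebraMap_eq_smul_one, smul_one_mul]

theorem rsmul_right (hg : IsEvenPairing g) (r : ℝ) (X Y : VF M U) :
    g U X (r • Y) = r • g U X Y := by
  induction X using vf_induction with
  | add X X' hX hX' => rw [hg.add_left, hg.add_left, hX, hX', smul_add]
  | hom i X =>
    induction Y using vf_induction with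
    | add Y Y' hY hY' => rw [smul_add, hg.add_right, hg.add_right, hY, hY', smul_add]
    | hom j Y =>
      rw [← vf_smul, hg.symm, vf_smul, hg.rsmul_left, hg.symm U X Y, smul_comm]

theorem sub_left (hg : IsEvenPairing g) (X Y Z : VF M U) :
    g U (X - Y) Z = g U X Z - g U Y Z := by
  have : X - Y = X + (-1 : ℝ) • Y := by module
  rw [this, hg.add_left, hg.rsmul_left]; module

theorem zero_left (hg : IsEvenPairing g) (Z : VF M U) : g U 0 Z = 0 := by
  rw [← zero_smul ℝ (0 : VF M U), hg.rsmul_left, zero_smul]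

theorem zero_right (hg : IsEvenPairing g) (Z : VF M U) : g U Z 0 = 0 := by
  rw [← zero_smul ℝ (0 : VF M U), hg.rsmul_right, zero_smul]

theorem neg_left (hg : IsEvenPairing g) (X Z : VF M U) : g U (-X) Z = - g U X Z := by
  rw [← neg_one_smul ℝ X, hg.rsmul_left, neg_one_smul]

theorem sum_left (hg : IsEvenPairing g) {ι : Type*} (s : Finset ι) (X : ι → VF M U) (Z : VF M U) :
    g U (∑ i ∈ s, X i) Z = ∑ i ∈ s, g U (X i) Z :=
  map_sum (AddMonoidHom.mk' (fun X : VF M U => g U X Z) fun X Y => hg.add_left U X Y Z) X s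

theorem fmul_right (hg : IsEvenPairing g) {i l : ZMod 2} (X : Der M U i) {f : M.sec U}
    (hf : f ∈ M.par U l) (Y : VF M U) :
    g U (vf X) (fmul f Y) = sgn (i * l) • (f * g U (vf X) Y) := by
  induction Y using vf_induction with
  | add Y Y' hY hY' => rw [fmul_add, hg.add_right, hg.add_right, hY, hY', mul_add, smul_add]
  | hom j Y =>
    rw [← vf_dmul f hf, hg.symm, vf_dmul, hg.smul_left, hg.symm U X Y, mul_smul_comm, smul_smul,
      sgn_mul_sgn, ← mul_add]

end IsEvenPairing

/-- The matrix of `g` in the frame of `c` is invertible. -/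
def NondegenerateIn (g : Pairing M) (c : SuperChart M q n) : Prop :=
  ∃ B : Fin q ⊕ Fin n → Fin q ⊕ Fin n → M.sec c.dom,
    (∀ I K, ∑ J, g c.dom (vf (c.frame I)) (vf (c.frame J)) * B J K = if I = K then 1 else 0) ∧
    (∀ I K, ∑ J, B I J * g c.dom (vf (c.frame J)) (vf (c.frame K)) = if I = K then 1 else 0)

theorem IsRiemannianMetric.nondegenerateIn (hg : IsRiemannianMetric q n g) (c : SuperChart M q n) :
    NondegenerateIn g c := by
  obtain ⟨u, hu⟩ := hg.nondegenerate c
  refine ⟨fun I J => u.inv I J, fun I K => ?_, fun I K => ?_⟩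
  · have h := congrFun (congrFun u.val_inv I) K
    rwa [Matrix.mul_apply, Matrix.one_apply, hu] at h
  · have h := congrFun (congrFun u.inv_val I) K
    rwa [Matrix.mul_apply, Matrix.one_apply, hu] at h

/-- The hypothesis says that the row of coefficients of `X` times the Gram matrix is zero;
multiplying by `B` on the right gives zero coefficients. -/
theorem NondegenerateIn.eq_zero (hg : IsEvenPairing g) {c : SuperChart M q n}
    (hc : NondegenerateIn g c) (hU : U ≤ c.dom) (X : VF M U)
    (h : ∀ J, g U X (vf (drestr hU (c.frame J))) = 0) : X = 0 := by
  obtain ⟨B, hB, -⟩ := hc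
  refine vf_ext_coord c hU fun K => ?_
  rw [vf_eq_sum c hU X] at h
  have h1 : ∀ J, ∑ I, act X (M.res hU (c.coord I)) *
      M.res hU (g c.dom (vf (c.frame I)) (vf (c.frame J))) = 0 := fun J => by
    rw [← h J, hg.sum_left]
    exact Finset.sum_congr rfl fun I _ => by rw [hg.smul_left, hg.res]; rfl
  have h2 : ∑ J, (∑ I, act X (M.res hU (c.coord I)) *
      M.res hU (g c.dom (vf (c.frame I)) (vf (c.frame J)))) * M.res hU (B J K) = 0 :=
    Finset.sum_eq_zero fun J _ => by rw [h1, zero_mul]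
  simp only [Finset.sum_mul] at h2
  rw [Finset.sum_comm] at h2
  have h3 : ∀ I, ∑ J, act X (M.res hU (c.coord I)) *
      M.res hU (g c.dom (vf (c.frame I)) (vf (c.frame J))) * M.res hU (B J K) =
      act X (M.res hU (c.coord I)) * if I = K then 1 else 0 := fun I => by
    simp only [mul_assoc, ← map_mul]
    rw [← Finset.mul_sum, ← map_sum, hB]
    split_ifs <;> simp
  rw [Finset.sum_congr rfl fun I _ => h3 I] at h2
  simp only [mul_ite, mul_one, mul_zero, Finset.sum_ite_eq', Finset.mem_univ, if_true] at h2
  exact h2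

/-- The coefficients are the row `w B`. Here `B` must be a left inverse of the Gram matrix, while
`NondegenerateIn.eq_zero` uses a right inverse; the entries commute only up to sign, and both are
recorded. -/
theorem NondegenerateIn.exists_dual (hg : IsEvenPairing g) {c : SuperChart M q n}
    (hc : NondegenerateIn g c) (hU : U ≤ c.dom) (w : Fin q ⊕ Fin n → M.sec U) :
    ∃ X : VF M U, ∀ J, g U X (vf (drestr hU (c.frame J))) = w J := by
  obtain ⟨B, -, hB⟩ := hc
  refine ⟨∑ K, fmul (∑ J, w J * M.res hU (B J K)) (vf (drestr hU (c.frame K))), fun L => ?_⟩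
  rw [hg.sum_left]
  have h1 : ∀ K, g U (fmul (∑ J, w J * M.res hU (B J K)) (vf (drestr hU (c.frame K))))
      (vf (drestr hU (c.frame L))) = ∑ J, w J * M.res hU (B J K *
        g c.dom (vf (c.frame K)) (vf (c.frame L))) := fun K => by
    rw [hg.smul_left, Finset.sum_mul]
    refine Finset.sum_congr rfl fun J _ => ?_
    rw [map_mul, hg.res, mul_assoc]; rfl
  rw [Finset.sum_congr rfl fun K _ => h1 K, Finset.sum_comm]
  have h2 : ∀ J, ∑ K, w J * M.res hU (B J K * g c.dom (vf (c.frame K)) (vf (c.frame L))) =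
      w J * if J = L then 1 else 0 := fun J => by
    rw [← Finset.mul_sum, ← map_sum, hB]
    split_ifs <;> simp
  rw [Finset.sum_congr rfl fun J _ => h2 J]
  simp

/-- Every homogeneous vector field is a sum of multiples of the natural frame. -/
theorem der_induction_frame (c : SuperChart M q n) (hU : U ≤ c.dom)
    {p : ∀ k, Der M U k → Prop} (zero : ∀ k, p k 0)
    (add : ∀ k (X Y : Der M U k), p k X → p k Y → p k (X + Y))
    (frame : ∀ l I (f : M.sec U) (hf : f ∈ M.par U l),
      p (l + idxPar I) (dmul f hf (drestr hU (c.frame I))))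
    {k : ZMod 2} (X : Der M U k) : p k X := by
  -- The coefficient of ∂_I has parity `k + |I|`, so the product has parity `k + |I| + |I|`. This
  -- equals `k` only propositionally, whence the use of `dcast`.
  have hpar : ∀ I : Fin q ⊕ Fin n, k + idxPar I + idxPar I = k := fun I => by
    rw [add_assoc, add_self_parity, add_zero]
  have hm : ∀ I, act (vf X) (M.res hU (c.coord I)) ∈ M.par U (k + idxPar I) := fun I =>
    act_mem X (M.res_mem hU (c.coord_mem I))
  have hc : ∀ {a b : ZMod 2} (h : a = b) (Y : Der M U a), p a Y → p b (dcast h Y) := by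
    rintro a b rfl Y hY; exact hY
  have e : X = ∑ I, dcast (hpar I) (dmul _ (hm I) (drestr hU (c.frame I))) := by
    refine vf_injective ((vf_eq_sum c hU (vf X)).trans ?_)
    refine Subtype.ext ?_
    change _ = (↑(∑ I, dcast (hpar I) (dmul _ (hm I) (drestr hU (c.frame I)))) : Fam M U)
    rw [AddSubmonoidClass.coe_finsetSum, AddSubmonoidClass.coe_finsetSum]
    rfl
  rw [e]
  refine Finset.sum_induction _ (p k) (add k) (zero k) fun I _ => hc (hpar I) _ (frame _ I _ (hm I))

end Pairings

/-! ### The Koszul formula. -/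

section Koszul

variable {M : SuperSpace.{u}} {U V : Opens M.carrier} {q n : ℕ} {g : Pairing M}

/-- The right-hand side of the Koszul formula for `2 g(∇_X Y, Z)`. -/
def koszul (g : Pairing M) {i j k : ZMod 2} (X : Der M U i) (Y : Der M U j) (Z : Der M U k) :
    M.sec U :=
  act (vf X) (g U (vf Y) (vf Z)) + sgn (i * (j + k)) • act (vf Y) (g U (vf Z) (vf X)) -
    sgn (k * (i + j)) • act (vf Z) (g U (vf X) (vf Y)) + g U (vf (bracket X Y)) (vf Z) -
    sgn (i * (j + k)) • g U (vf (bracket Y Z)) (vf X) +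
    sgn (k * (i + j)) • g U (vf (bracket Z X)) (vf Y)

theorem res_koszul (hg : IsEvenPairing g) (h : V ≤ U) {i j k : ZMod 2} (X : Der M U i)
    (Y : Der M U j) (Z : Der M U k) :
    M.res h (koszul g X Y Z) = koszul g (drestr h X) (drestr h Y) (drestr h Z) := by
  simp only [koszul, map_add, map_sub, map_smul, res_act, hg.res]
  rfl

/-- The terms that differentiate a pairing cancel under graded antisymmetrisation in `X`, `Y`, and
so do two of the brackets. This will be torsion-freeness. -/
theorem koszul_swap (hg : IsEvenPairing g) {i j k : ZMod 2} (X : Der M U i)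
    (Y : Der M U j) (Z : Der M U k) :
    koszul g X Y Z - sgn (i * j) • koszul g Y X Z = (2 : ℝ) • g U (vf (bracket X Y)) (vf Z) := by
  simp only [koszul]
  rw [vf_bracket_symm Y X, vf_bracket_symm X Z, vf_bracket_symm Z Y, hg.symm U X Z, hg.symm U Z Y,
    hg.symm U Y X]
  simp only [hg.neg_left, hg.rsmul_left, act_smul]
  rcases parity_cases i with rfl | rfl <;> rcases parity_cases j with rfl | rfl <;>
    rcases parity_cases k with rfl | rfl <;> simp [sgn, add_self_parity] <;> module

/-- Under graded symmetrisation in `Y`, `Z` the bracket terms and two derivatives cancel. This will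
be compatibility with the metric. -/
theorem koszul_metric (hg : IsEvenPairing g) {i j k : ZMod 2} (X : Der M U i)
    (Y : Der M U j) (Z : Der M U k) :
    koszul g X Y Z + sgn (j * k) • koszul g X Z Y =
      (2 : ℝ) • act (vf X) (g U (vf Y) (vf Z)) := by
  simp only [koszul]
  rw [vf_bracket_symm X Z, vf_bracket_symm Z Y, vf_bracket_symm Y X, hg.symm U X Z, hg.symm U Z Y,
    hg.symm U Y X]
  simp only [hg.neg_left, hg.rsmul_left, act_smul]
  rcases parity_cases i with rfl | rfl <;> rcases parity_cases j with rfl | rfl <;>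
    rcases parity_cases k with rfl | rfl <;> simp [sgn, add_self_parity] <;> module

theorem koszul_add_left (hg : IsEvenPairing g) {i j k : ZMod 2} (X X' : Der M U i)
    (Y : Der M U j) (Z : Der M U k) :
    koszul g (X + X') Y Z = koszul g X Y Z + koszul g X' Y Z := by
  simp only [koszul, vf_add, vf_bracket_add_left, vf_bracket_add_right, hg.add_left, hg.add_right,
    act_add, act_add_left, smul_add]
  module

theorem koszul_add_mid (hg : IsEvenPairing g) {i j k : ZMod 2} (X : Der M U i)
    (Y Y' : Der M U j) (Z : Der M U k) :
    koszul g X (Y + Y') Z = koszul g X Y Z + koszul g X Y' Z := by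
  simp only [koszul, vf_add, vf_bracket_add_left, vf_bracket_add_right, hg.add_left, hg.add_right,
    act_add, act_add_left, smul_add]
  module

theorem koszul_add_right (hg : IsEvenPairing g) {i j k : ZMod 2} (X : Der M U i)
    (Y : Der M U j) (Z Z' : Der M U k) :
    koszul g X Y (Z + Z') = koszul g X Y Z + koszul g X Y Z' := by
  simp only [koszul, vf_add, vf_bracket_add_left, vf_bracket_add_right, hg.add_left, hg.add_right,
    act_add, act_add_left, smul_add]
  module

/-- The derivatives of `f` coming from the pairings cancel those coming from the brackets with `f
X`. -/
theorem koszul_dmul_left (hg : IsEvenPairing g) {i j k l : ZMod 2} {f : M.sec U}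
    (hf : f ∈ M.par U l) (X : Der M U i) (Y : Der M U j) (Z : Der M U k) :
    koszul g (dmul f hf X) Y Z = f * koszul g X Y Z := by
  simp only [koszul]
  rw [vf_bracket_dmul_left, vf_bracket_dmul_right, vf_dmul, hg.fmul_right Z hf, hg.fmul_right _ hf,
    act_smul, act_mul Y hf, hg.smul_left, act_mul Z hf, act_fmul, hg.sub_left, hg.add_left,
    hg.rsmul_left, hg.rsmul_left, hg.smul_left, hg.smul_left, hg.smul_left, hg.smul_left,
    hg.symm U Z X]
  simp only [mul_add, mul_sub, mul_smul_comm, act_smul]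
  rcases parity_cases i with rfl | rfl <;> rcases parity_cases j with rfl | rfl <;>
    rcases parity_cases k with rfl | rfl <;> rcases parity_cases l with rfl | rfl <;>
    simp [sgn, add_self_parity] <;> module

/-- Linearity in the first argument is carried to the second by `koszul_swap`; the derivative of `f`
comes from the bracket of `X` with `f Y`. -/
theorem koszul_dmul_mid (hg : IsEvenPairing g) {i j k l : ZMod 2} {f : M.sec U}
    (hf : f ∈ M.par U l) (X : Der M U i) (Y : Der M U j) (Z : Der M U k) :
    koszul g X (dmul f hf Y) Z =
      (2 : ℝ) • (act (vf X) f * g U (vf Y) (vf Z)) + sgn (i * l) • (f * koszul g X Y Z) := by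
  have h1 := koszul_swap hg X (dmul f hf Y) Z
  have h2 := congrArg (f * ·) (koszul_swap hg X Y Z)
  simp only [mul_sub, mul_smul_comm] at h2
  rw [koszul_dmul_left hg, vf_bracket_dmul_right, hg.add_left, hg.rsmul_left, hg.smul_left,
    hg.smul_left] at h1
  rw [sub_eq_iff_eq_add] at h1 h2
  rw [h1, h2, mul_add i, ← sgn_mul_sgn]
  module

/-- Here `koszul_metric` reduces the claim to the second argument, and the two derivatives of `f`
cancel. -/
theorem koszul_dmul_right (hg : IsEvenPairing g) {i j k l : ZMod 2} {f : M.sec U}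
    (hf : f ∈ M.par U l) (X : Der M U i) (Y : Der M U j) (Z : Der M U k) :
    koszul g X Y (dmul f hf Z) = sgn (l * (i + j)) • (f * koszul g X Y Z) := by
  have h1 := koszul_metric hg X Y (dmul f hf Z)
  have h2 := congrArg (f * ·) (koszul_metric hg X Y Z)
  simp only [mul_add, mul_smul_comm] at h2
  rw [koszul_dmul_mid hg, vf_dmul, hg.fmul_right Y hf, act_smul, act_mul X hf, hg.symm U Z Y] at h1
  rw [← eq_sub_iff_add_eq] at h1 h2
  rw [h1, h2]
  simp only [mul_smul_comm]
  rcases parity_cases i with rfl | rfl <;> rcases parity_cases j with rfl | rfl <;>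
    rcases parity_cases k with rfl | rfl <;> rcases parity_cases l with rfl | rfl <;>
    simp [sgn, add_self_parity] <;> module

theorem koszul_mem (hg : IsEvenPairing g) {i j k : ZMod 2} (X : Der M U i)
    (Y : Der M U j) (Z : Der M U k) : koszul g X Y Z ∈ M.par U (i + j + k) := by
  have e1 : i + (j + k) = i + j + k := by ring
  have e2 : j + (k + i) = i + j + k := by ring
  have e3 : k + (i + j) = i + j + k := by ring
  have e4 : j + k + i = i + j + k := by ring
  have e5 : k + i + j = i + j + k := by ring
  refine Submodule.add_mem _ (Submodule.sub_mem _ (Submodule.add_mem _ (Submodule.sub_mem _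
    (Submodule.add_mem _ ?_ (Submodule.smul_mem _ _ ?_)) (Submodule.smul_mem _ _ ?_)) ?_)
    (Submodule.smul_mem _ _ ?_)) (Submodule.smul_mem _ _ ?_)
  · exact e1 ▸ act_mem X (hg.even U Y Z)
  · exact e2 ▸ act_mem Y (hg.even U Z X)
  · exact e3 ▸ act_mem Z (hg.even U X Y)
  · exact hg.even U _ Z
  · exact e4 ▸ hg.even U _ X
  · exact e5 ▸ hg.even U _ Y

/-- The Koszul formula. -/
theorem IsLeviCivita.koszul (hg : IsEvenPairing g) {D : AffineConnection M} (hD : IsLeviCivita g D)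
    {i j k : ZMod 2} (X : Der M U i) (Y : Der M U j) (Z : Der M U k) :
    (2 : ℝ) • g U (D.nabla U (vf X) (vf Y)) (vf Z) = SuperGeom.koszul g X Y Z := by
  have hn : ∀ {i j : ZMod 2} (X : Der M U i) (Y : Der M U j), ∃ A : Der M U (i + j),
      D.nabla U (vf X) (vf Y) = vf A := fun X Y => ⟨⟨_, D.degree U X Y⟩, rfl⟩
  have tf : ∀ {i j : ZMod 2} (X : Der M U i) (Y : Der M U j),
      vf (bracket X Y) = D.nabla U (vf X) (vf Y) - sgn (i * j) • D.nabla U (vf Y) (vf X) :=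
    fun X Y => (sub_eq_zero.1 (hD.torsion_free U X Y)).symm
  have hm := fun {i j k : ZMod 2} (X : Der M U i) (Y : Der M U j) (Z : Der M U k) =>
    hD.metric U X Y (vf Z)
  -- Derivatives of pairings and brackets are all expressed by covariant derivatives; the graded
  -- symmetry of `g` then leaves only the terms with ∇_X Y.
  simp only [SuperGeom.koszul, hm, tf]
  obtain ⟨A, hA⟩ := hn X Y
  obtain ⟨A', hA'⟩ := hn Y X
  obtain ⟨B, hB⟩ := hn Y Z
  obtain ⟨B', hB'⟩ := hn Z Y
  obtain ⟨C, hC⟩ := hn Z X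
  obtain ⟨C', hC'⟩ := hn X Z
  simp only [hA, hA', hB, hB', hC, hC', hg.sub_left, hg.rsmul_left]
  rw [hg.symm U X B', hg.symm U Z A', hg.symm U Y C']
  rcases parity_cases i with rfl | rfl <;> rcases parity_cases j with rfl | rfl <;>
    rcases parity_cases k with rfl | rfl <;>
    simp [sgn, add_self_parity] <;> module

end Koszul

/-! ### Connections given on homogeneous vector fields. -/

section Homogeneous

variable {M : SuperSpace.{u}} {U V : Opens M.carrier}

theorem evenVF_split (A : Der M U 0) (B : Der M U 1) : evenVF (vf A + vf B) = vf A := by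
  rw [map_add, evenVF_of_even, evenVF_of_odd, add_zero]

/-- The even part of a vector field, as a homogeneous one. -/
def evenPart (X : VF M U) : Der M U 0 := ⟨(evenVF X).1, by
  obtain ⟨A, B, rfl⟩ := exists_vf_split X
  rw [evenVF_split]; exact A.2⟩

/-- The odd part of a vector field, as a homogeneous one. -/
def oddPart (X : VF M U) : Der M U 1 := ⟨(X - evenVF X).1, by
  obtain ⟨A, B, rfl⟩ := exists_vf_split X
  have e : vf A + vf B - vf A = vf B := by abel
  rw [evenVF_split, e]; exact B.2⟩

theorem vf_evenPart (X : VF M U) : vf (evenPart X) = evenVF X := rfl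

theorem vf_oddPart (X : VF M U) : vf (oddPart X) = X - evenVF X := rfl

theorem evenPart_add (X Y : VF M U) : evenPart (X + Y) = evenPart X + evenPart Y :=
  vf_injective (by rw [vf_add, vf_evenPart, vf_evenPart, vf_evenPart, map_add])

theorem oddPart_add (X Y : VF M U) : oddPart (X + Y) = oddPart X + oddPart Y :=
  vf_injective (by rw [vf_add, vf_oddPart, vf_oddPart, vf_oddPart, map_add]; abel)

theorem evenPart_split (A : Der M U 0) (B : Der M U 1) : evenPart (vf A + vf B) = A :=
  vf_injective (by rw [vf_evenPart, evenVF_split])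

theorem oddPart_split (A : Der M U 0) (B : Der M U 1) : oddPart (vf A + vf B) = B :=
  vf_injective (by rw [vf_oddPart, evenVF_split]; abel)

theorem vf_zero {i : ZMod 2} : vf (0 : Der M U i) = 0 := rfl

theorem evenPart_vf_zero (A : Der M U 0) : evenPart (vf A) = A := by
  have := evenPart_split A 0; rwa [vf_zero, add_zero] at this

theorem oddPart_vf_zero (A : Der M U 0) : oddPart (vf A) = 0 := by
  have := oddPart_split A 0; rwa [vf_zero, add_zero] at this

theorem evenPart_vf_one (A : Der M U 1) : evenPart (vf A) = 0 := by
  have := evenPart_split 0 A; rwa [vf_zero, zero_add] at this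

theorem oddPart_vf_one (A : Der M U 1) : oddPart (vf A) = A := by
  have := oddPart_split 0 A; rwa [vf_zero, zero_add] at this

theorem drestr_evenPart (h : V ≤ U) (X : VF M U) :
    drestr h (evenPart X) = evenPart (restr h X) := by
  obtain ⟨A, B, rfl⟩ := exists_vf_split X
  rw [restr_add, restr_vf, restr_vf, evenPart_split, evenPart_split]

theorem drestr_oddPart (h : V ≤ U) (X : VF M U) :
    drestr h (oddPart X) = oddPart (restr h X) := by
  obtain ⟨A, B, rfl⟩ := exists_vf_split X
  rw [restr_add, restr_vf, restr_vf, oddPart_split, oddPart_split]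

variable (M) in
/-- An affine connection given on homogeneous vector fields only. -/
structure HomConnection where
  nab : ∀ (U : Opens M.carrier) {i j : ZMod 2}, Der M U i → Der M U j → Der M U (i + j)
  res : ∀ {U V : Opens M.carrier} (h : V ≤ U) {i j : ZMod 2} (X : Der M U i) (Y : Der M U j),
    drestr h (nab U X Y) = nab V (drestr h X) (drestr h Y)
  add_left : ∀ (U : Opens M.carrier) {i j : ZMod 2} (X X' : Der M U i) (Y : Der M U j),
    nab U (X + X') Y = nab U X Y + nab U X' Y
  add_right : ∀ (U : Opens M.carrier) {i j : ZMod 2} (X : Der M U i) (Y Y' : Der M U j),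
    nab U X (Y + Y') = nab U X Y + nab U X Y'
  smul_left : ∀ (U : Opens M.carrier) {i j l : ZMod 2} (f : M.sec U) (hf : f ∈ M.par U l)
    (X : Der M U i) (Y : Der M U j), vf (nab U (dmul f hf X) Y) = fmul f (vf (nab U X Y))
  leibniz : ∀ (U : Opens M.carrier) {i j l : ZMod 2} (f : M.sec U) (hf : f ∈ M.par U l)
    (X : Der M U i) (Y : Der M U j), vf (nab U X (dmul f hf Y)) =
      fmul (act (vf X) f) (vf Y) + sgn (i * l) • fmul f (vf (nab U X Y))

namespace HomConnection

variable (C : HomConnection M)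

theorem zero_left {i j : ZMod 2} (Y : Der M U j) : C.nab U (0 : Der M U i) Y = 0 := by
  have := C.add_left U (0 : Der M U i) 0 Y
  rwa [add_zero, left_eq_add] at this

theorem zero_right {i j : ZMod 2} (X : Der M U i) : C.nab U X (0 : Der M U j) = 0 := by
  have := C.add_right U X (0 : Der M U j) 0
  rwa [add_zero, left_eq_add] at this

/-- The bilinear extension to all vector fields. -/
def ext (U : Opens M.carrier) (X Y : VF M U) : VF M U :=
  vf (C.nab U (evenPart X) (evenPart Y)) + vf (C.nab U (evenPart X) (oddPart Y)) +
    (vf (C.nab U (oddPart X) (evenPart Y)) + vf (C.nab U (oddPart X) (oddPart Y)))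

theorem ext_vf {i j : ZMod 2} (X : Der M U i) (Y : Der M U j) :
    C.ext U (vf X) (vf Y) = vf (C.nab U X Y) := by
  rcases parity_cases i with rfl | rfl <;> rcases parity_cases j with rfl | rfl <;>
    simp only [ext, evenPart_vf_zero, oddPart_vf_zero, evenPart_vf_one, oddPart_vf_one, C.zero_left,
      C.zero_right, vf_zero, add_zero, zero_add]

theorem ext_add_left (X Y Z : VF M U) : C.ext U (X + Y) Z = C.ext U X Z + C.ext U Y Z := by
  simp only [ext, evenPart_add, oddPart_add, C.add_left, vf_add]; abel

theorem ext_add_right (X Y Z : VF M U) : C.ext U X (Y + Z) = C.ext U X Y + C.ext U X Z := by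
  simp only [ext, evenPart_add, oddPart_add, C.add_right, vf_add]; abel

/-- The affine connection determined by its values on homogeneous vector fields. -/
def toAffine : AffineConnection M where
  nabla := C.ext
  res h X Y := by
    simp only [ext, restr_add, restr_vf, C.res, drestr_evenPart, drestr_oddPart]
  degree U i j X Y := by rw [ext_vf]; exact (C.nab U X Y).2
  add_left U X Y Z := C.ext_add_left X Y Z
  add_right U X Y Z := C.ext_add_right X Y Z
  smul_left U f X Y := by
    induction X using vf_induction with
    | add X X' hX hX' => rw [fmul_add, C.ext_add_left, C.ext_add_left, hX, hX', fmul_add]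
    | hom i X =>
      induction Y using vf_induction with
      | add Y Y' hY hY' => rw [C.ext_add_right, C.ext_add_right, hY, hY', fmul_add]
      | hom j Y =>
        induction f using sec_induction with
        | add f f' hf hf' => rw [add_fmul, C.ext_add_left, hf, hf', add_fmul]
        | hom l f hf => rw [← vf_dmul f hf, ext_vf, ext_vf, C.smul_left]
  leibniz U i l X f Y hf := by
    induction Y using vf_induction with
    | add Y Y' hY hY' =>
      rw [fmul_add, C.ext_add_right, C.ext_add_right, hY, hY', fmul_add, fmul_add, smul_add]; abel
    | hom j Y => rw [← vf_dmul f hf, ext_vf, ext_vf, C.leibniz]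

end HomConnection

end Homogeneous

/-! ### Existence of the Levi-Civita connection. -/

section LeviCivita

variable {M : SuperSpace.{u}} {U V : Opens M.carrier} {q n : ℕ} {g : Pairing M}

variable (q n) in
/-- `M` is covered by charts in which `g` is non-degenerate. -/
def LocallyNondegenerate (g : Pairing M) : Prop :=
  ∀ x : M.carrier, ∃ c : SuperChart M q n, x ∈ c.dom ∧ NondegenerateIn g c

/-- Because `g` is even, the component of `X` of the wrong parity pairs with each frame field into
both parity parts, hence to zero; non-degeneracy removes it. -/
theorem NondegenerateIn.mem_der (hg : IsEvenPairing g) {c : SuperChart M q n}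
    (hc : NondegenerateIn g c) (hU : U ≤ c.dom) (X : VF M U) (p : ZMod 2)
    (h : ∀ J, g U X (vf (drestr hU (c.frame J))) ∈ M.par U (p + idxPar J)) : X.1 ∈ Der M U p := by
  obtain ⟨A, B, rfl⟩ := exists_vf_split X
  simp only [hg.add_left] at h
  rcases parity_cases p with rfl | rfl
  · have : vf B = 0 := hc.eq_zero hg hU _ fun J => by
      have h1 := Submodule.sub_mem _ (h J) (hg.even U A (drestr hU (c.frame J)))
      rw [add_sub_cancel_left] at h1
      refine eq_zero_of_mem_par h1 ?_
      have h2 := hg.even U B (drestr hU (c.frame J))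
      rwa [zero_add, add_comm]
    rw [this, add_zero]; exact A.2
  · have : vf A = 0 := hc.eq_zero hg hU _ fun J => by
      have h1 := Submodule.sub_mem _ (h J) (hg.even U B (drestr hU (c.frame J)))
      rw [add_sub_cancel_right] at h1
      have h2 := hg.even U A (drestr hU (c.frame J))
      rw [zero_add] at h2
      rw [add_comm] at h1
      exact eq_zero_of_mem_par h2 h1
    rw [this, zero_add]; exact B.2

/-- `A = ∇_X Y` in the sense of the Koszul formula. -/
def IsKoszul (g : Pairing M) {i j p : ZMod 2} (X : Der M U i) (Y : Der M U j) (A : Der M U p) :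
    Prop :=
  ∀ (W : Opens M.carrier) (hW : W ≤ U) (k : ZMod 2) (Z : Der M W k),
    (2 : ℝ) • g W (vf (drestr hW A)) (vf Z) = koszul g (drestr hW X) (drestr hW Y) Z

/-- Both sides pick up the same sign when a section is taken out of `Z`, so testing on a frame is
enough, also over smaller open sets. -/
theorem IsKoszul.of_frame (hg : IsEvenPairing g) {c : SuperChart M q n} (hU : U ≤ c.dom)
    {i j : ZMod 2} {X : Der M U i} {Y : Der M U j} {A : Der M U (i + j)}
    (h : ∀ J, (2 : ℝ) • g U (vf A) (vf (drestr hU (c.frame J))) =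
      koszul g X Y (drestr hU (c.frame J))) : IsKoszul g X Y A := by
  intro W hW k Z
  induction Z using der_induction_frame c (hW.trans hU) with
  | zero k =>
    have h1 := koszul_add_right hg (drestr hW X) (drestr hW Y) (0 : Der M W k) 0
    rw [add_zero, left_eq_add] at h1
    rw [h1, vf_zero, hg.zero_right, smul_zero]
  | add k Z Z' hZ hZ' => rw [vf_add, hg.add_right, smul_add, hZ, hZ', koszul_add_right hg]
  | frame l J f hf =>
    rw [vf_dmul, hg.fmul_right _ hf, koszul_dmul_right hg, smul_comm, ← mul_smul_comm]
    have h1 := congrArg (M.res hW) (h J)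
    rw [map_smul, hg.res, res_koszul hg] at h1
    rw [mul_comm l]
    exact congrArg (fun a => sgn ((i + j) * l) • (f * a)) h1

theorem IsKoszul.unique (hg : IsEvenPairing g) (hn : LocallyNondegenerate q n g) {i j p p' : ZMod 2}
    {X : Der M U i} {Y : Der M U j} {A : Der M U p} {A' : Der M U p'} (h : IsKoszul g X Y A)
    (h' : IsKoszul g X Y A') : vf A = vf A' := by
  refine vf_ext_cover (fun c : {c : SuperChart M q n // NondegenerateIn g c} => c.1.dom)
    (fun x _ => (hn x).elim fun c hc => ⟨⟨c, hc.2⟩, hc.1⟩) fun c => ?_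
  refine sub_eq_zero.1 (c.2.eq_zero hg inf_le_right _ fun J => ?_)
  have h1 := (h _ (inf_le_left : U ⊓ c.1.dom ≤ U) _ (drestr inf_le_right (c.1.frame J))).trans
    (h' _ (inf_le_left : U ⊓ c.1.dom ≤ U) _ (drestr inf_le_right (c.1.frame J))).symm
  rw [hg.sub_left, sub_eq_zero]
  exact smul_right_injective _ (two_ne_zero (α := ℝ)) h1

/-- Non-degeneracy produces a field whose pairings with the frame are half the Koszul expressions;
their parities make it homogeneous. -/
theorem exists_isKoszul_chart (hg : IsEvenPairing g) {c : SuperChart M q n}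
    (hc : NondegenerateIn g c) (hU : U ≤ c.dom) {i j : ZMod 2} (X : Der M U i) (Y : Der M U j) :
    ∃ A : Der M U (i + j), IsKoszul g X Y A := by
  obtain ⟨A, hA⟩ := hc.exists_dual hg hU fun J =>
    (1 / 2 : ℝ) • koszul g X Y (drestr hU (c.frame J))
  have hm : A.1 ∈ Der M U (i + j) := hc.mem_der hg hU A _ fun J => by
    rw [hA]; exact Submodule.smul_mem _ _ (koszul_mem hg _ _ _)
  refine ⟨⟨A.1, hm⟩, .of_frame hg hU fun J => ?_⟩
  refine (congrArg ((2 : ℝ) • ·) (hA J)).trans ?_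
  simp only [smul_smul]; norm_num

theorem IsKoszul.restr (hU : V ≤ U) {i j p : ZMod 2} {X : Der M U i} {Y : Der M U j} {A : Der M U p}
    (h : IsKoszul g X Y A) : IsKoszul g (drestr hU X) (drestr hU Y) (drestr hU A) :=
  fun W hW k Z => h W (hW.trans hU) k Z

/-- The solutions in charts agree on overlaps by `IsKoszul.unique`, so they glue. -/
theorem exists_isKoszul (hg : IsEvenPairing g) (hn : LocallyNondegenerate q n g) {i j : ZMod 2}
    (X : Der M U i) (Y : Der M U j) : ∃ A : Der M U (i + j), IsKoszul g X Y A := by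
  let ι := {c : SuperChart M q n // NondegenerateIn g c}
  have hcov : ∀ x : M.carrier, ∃ c : ι, x ∈ c.1.dom := fun x =>
    (hn x).elim fun c hc => ⟨⟨c, hc.2⟩, hc.1⟩
  choose A hA using fun c : ι => exists_isKoszul_chart hg c.2 (inf_le_right : U ⊓ c.1.dom ≤ c.1.dom)
    (drestr inf_le_left X) (drestr inf_le_left Y)
  obtain ⟨B, hB⟩ := exists_glued_der (U := U) (fun c : ι => U ⊓ c.1.dom)
    (fun x hx => (hcov x).imp fun c hc => ⟨hx, hc⟩) A (fun c c' W h h' a => by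
      have := ((hA c).restr h).unique hg hn ((hA c').restr h')
      exact congrArg (fun Z : VF M W => Z.1 ⟨W, le_rfl⟩ a) this)
  refine ⟨B, fun W hW k Z => sec_ext_cover (fun c : ι => c.1.dom) (fun x _ => hcov x) fun c => ?_⟩
  rw [map_smul, hg.res, res_koszul hg]
  have hle : W ⊓ c.1.dom ≤ U ⊓ c.1.dom := inf_le_inf_right _ hW
  have h1 := hA c (W ⊓ c.1.dom) hle k (drestr inf_le_left Z)
  have h2 : vf (drestr hle (A c)) = SuperGeom.restr (inf_le_left : W ⊓ c.1.dom ≤ W) (vf (drestr hW B)) :=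
    vf_ext fun W' hW' a => (hB c W' _ (hW'.trans hle) a).symm
  rw [h2] at h1
  exact h1

theorem isKoszul_add_left (hg : IsEvenPairing g) {i j p : ZMod 2} {X X' : Der M U i} {Y : Der M U j}
    {A A' : Der M U p} (h : IsKoszul g X Y A) (h' : IsKoszul g X' Y A') :
    IsKoszul g (X + X') Y (A + A') := fun W hW k Z => by
  have := koszul_add_left hg (drestr hW X) (drestr hW X') (drestr hW Y) Z
  refine Eq.trans ?_ this.symm
  rw [← h W hW k Z, ← h' W hW k Z, ← smul_add, ← hg.add_left]
  rfl

theorem isKoszul_add_right (hg : IsEvenPairing g) {i j p : ZMod 2} {X : Der M U i} {Y Y' : Der M U j}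
    {A A' : Der M U p} (h : IsKoszul g X Y A) (h' : IsKoszul g X Y' A') :
    IsKoszul g X (Y + Y') (A + A') := fun W hW k Z => by
  have := koszul_add_mid hg (drestr hW X) (drestr hW Y) (drestr hW Y') Z
  refine Eq.trans ?_ this.symm
  rw [← h W hW k Z, ← h' W hW k Z, ← smul_add, ← hg.add_left]
  rfl

theorem drestr_dmul (h : V ≤ U) {i l : ZMod 2} {f : M.sec U} (hf : f ∈ M.par U l) (X : Der M U i) :
    drestr h (dmul f hf X) = dmul (M.res h f) (M.res_mem h hf) (drestr h X) :=
  vf_injective (restr_fmul h f (vf X))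

theorem isKoszul_dmul_left (hg : IsEvenPairing g) {i j p l : ZMod 2} {f : M.sec U}
    (hf : f ∈ M.par U l) {X : Der M U i} {Y : Der M U j} {A : Der M U p} (h : IsKoszul g X Y A) :
    IsKoszul g (dmul f hf X) Y (dmul f hf A) := fun W hW k Z => by
  rw [drestr_dmul, drestr_dmul, koszul_dmul_left hg, ← h W hW k Z, vf_dmul, hg.smul_left,
    mul_smul_comm]

theorem isKoszul_dmul_right (hg : IsEvenPairing g) {i j p l : ZMod 2} {f : M.sec U}
    (hf : f ∈ M.par U l) {X : Der M U i} {Y : Der M U j} {A : Der M U (i + j)}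
    (h : IsKoszul g X Y A) (B : Der M U p)
    (hB : vf B = fmul (act (vf X) f) (vf Y) + sgn (i * l) • fmul f (vf A)) :
    IsKoszul g X (dmul f hf Y) B := fun W hW k Z => by
  have h1 : vf (drestr hW B) = fmul (act (vf (drestr hW X)) (M.res hW f)) (vf (drestr hW Y)) +
      sgn (i * l) • fmul (M.res hW f) (vf (drestr hW A)) := by
    rw [← restr_vf, hB, restr_add, restr_smul, restr_fmul, restr_fmul, res_act]; rfl
  rw [h1, drestr_dmul, koszul_dmul_mid hg, ← h W hW k Z, hg.add_left, hg.rsmul_left, hg.smul_left,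
    hg.smul_left, mul_smul_comm]
  module

/-- The Levi-Civita connection on homogeneous vector fields. -/
def leviCivitaHom (hg : IsEvenPairing g) (hn : LocallyNondegenerate q n g) : HomConnection M where
  nab U i j X Y := (exists_isKoszul hg hn X Y).choose
  -- All axioms follow from uniqueness: the two sides solve the same Koszul equation.
  res h i j X Y := vf_injective <| ((exists_isKoszul hg hn X Y).choose_spec.restr h).unique hg hn
    (exists_isKoszul hg hn _ _).choose_spec
  add_left U i j X X' Y := vf_injective <| (exists_isKoszul hg hn _ _).choose_spec.unique hg hn
    (isKoszul_add_left hg (exists_isKoszul hg hn X Y).choose_spec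
      (exists_isKoszul hg hn X' Y).choose_spec)
  add_right U i j X Y Y' := vf_injective <| (exists_isKoszul hg hn _ _).choose_spec.unique hg hn
    (isKoszul_add_right hg (exists_isKoszul hg hn X Y).choose_spec
      (exists_isKoszul hg hn X Y').choose_spec)
  smul_left U i j l f hf X Y := (exists_isKoszul hg hn _ _).choose_spec.unique hg hn
    (isKoszul_dmul_left hg hf (exists_isKoszul hg hn X Y).choose_spec)
  leibniz U i j l f hf X Y := by
    have hm : (fmul (act (vf X) f) (vf Y) +
        sgn (i * l) • fmul f (vf (exists_isKoszul hg hn X Y).choose)).1 ∈ Der M U (i + l + j) :=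
      Submodule.add_mem _ (fmul_mem rfl (act_mem X hf) Y.2)
        (Submodule.smul_mem _ _ (fmul_mem (by ring) hf (exists_isKoszul hg hn X Y).choose.2))
    exact (exists_isKoszul hg hn _ _).choose_spec.unique hg hn
      (isKoszul_dmul_right hg hf (exists_isKoszul hg hn X Y).choose_spec ⟨_, hm⟩ rfl)

theorem leviCivitaHom_koszul (hg : IsEvenPairing g) (hn : LocallyNondegenerate q n g)
    {i j k : ZMod 2} (X : Der M U i) (Y : Der M U j) (Z : Der M U k) :
    (2 : ℝ) • g U (vf ((leviCivitaHom hg hn).nab U X Y)) (vf Z) = koszul g X Y Z :=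
  (exists_isKoszul hg hn X Y).choose_spec U le_rfl k Z

/-- Two vector fields with the same pairings with homogeneous ones are equal. -/
theorem eq_of_pairing (hg : IsEvenPairing g) (hn : LocallyNondegenerate q n g) {A B : VF M U}
    (h : ∀ (W : Opens M.carrier) (hW : W ≤ U) (k : ZMod 2) (Z : Der M W k),
      g W (restr hW A) (vf Z) = g W (restr hW B) (vf Z)) : A = B := by
  refine vf_ext_cover (fun c : {c : SuperChart M q n // NondegenerateIn g c} => c.1.dom)
    (fun x _ => (hn x).elim fun c hc => ⟨⟨c, hc.2⟩, hc.1⟩) fun c => ?_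
  refine sub_eq_zero.1 (c.2.eq_zero hg inf_le_right _ fun J => ?_)
  rw [hg.sub_left, sub_eq_zero]
  exact h _ _ _ _

/-- Existence of the Levi-Civita connection. -/
theorem exists_isLeviCivita (hg : IsEvenPairing g) (hn : LocallyNondegenerate q n g) :
    ∃ D : AffineConnection M, IsLeviCivita g D := by
  let C := leviCivitaHom hg hn
  have hC : ∀ {U : Opens M.carrier} {i j : ZMod 2} (X : Der M U i) (Y : Der M U j),
    C.toAffine.nabla U (vf X) (vf Y) = vf (C.nab U X Y) := fun X Y => C.ext_vf X Y
  refine ⟨C.toAffine, fun U i j X Y => ?_, fun U i j X Y Z => ?_⟩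
  -- Paired with a test field and doubled, torsion-freeness becomes `koszul_swap`, and metric
  -- compatibility becomes `koszul_metric`.
  · refine (sub_eq_zero (G := VF M U)).2 ?_
    refine eq_of_pairing hg hn fun W hW k Z => ?_
    rw [restr_sub, restr_smul, hC, hC, restr_vf, restr_vf, restr_vf, C.res, C.res, hg.sub_left,
      hg.rsmul_left]
    refine smul_right_injective _ (two_ne_zero (α := ℝ)) ?_
    change (2 : ℝ) • (_ - _) = (2 : ℝ) • _
    rw [smul_sub, smul_comm, leviCivitaHom_koszul, leviCivitaHom_koszul]
    exact koszul_swap hg (drestr hW X) (drestr hW Y) Z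
  · induction Z using vf_induction with
    | add Z Z' hZ hZ' =>
      rw [hg.add_right, act_add, hZ, hZ', C.toAffine.add_right, hg.add_right, hg.add_right, smul_add]
      abel
    | hom k Z =>
      rw [hC, hC, hg.symm U Y (C.nab U X Z)]
      refine smul_right_injective _ (two_ne_zero (α := ℝ)) ?_
      change (2 : ℝ) • _ = (2 : ℝ) • (_ + _)
      rw [smul_add, smul_comm, smul_comm (2 : ℝ) (sgn (j * (i + k))), leviCivitaHom_koszul,
        leviCivitaHom_koszul, smul_smul, sgn_mul_sgn, ← koszul_metric hg X Y Z]
      have : i * j + j * (i + k) = j * k := by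
        rw [mul_add, mul_comm j i, ← add_assoc, add_self_parity, zero_add]
      rw [this]

end LeviCivita

/-! ### Components along the factor of vector fields on the product. -/

section Vertical

variable {M : SuperSpace.{u}} {q n : ℕ} {W : Opens (lineProd M q n).carrier}

/-- Smoothness in a chart is a local condition, so it may be tested over the cylinder of that
chart's own domain. -/
theorem mem_prodSec_local {s : ∀ t, M.sec (slice W t)}
    (h : ∀ c : SuperChart M q n, ∃ s' : (lineProd M q n).sec (W ⊓ cyl q n c.dom), ∀ t,
      M.res (slice_mono (inf_le_left : W ⊓ cyl q n c.dom ≤ W) t) (s t) = s'.1 t) :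
    s ∈ prodSec M q n W := mem_prodSec.2 fun c S p hp => by
  obtain ⟨s', hs'⟩ := h c
  have hpi : p ∈ prodImg c (W ⊓ cyl q n c.dom) := ⟨hp.1, hp.2, c.map.map_target hp.1⟩
  have h1 := (mem_prodSec.1 s'.2 c S).contDiffAt ((prodImg c (W ⊓ cyl q n c.dom)).2.mem_nhds hpi)
  refine (h1.congr_of_eventuallyEq ?_).contDiffWithinAt
  filter_upwards [(prodImg c (W ⊓ cyl q n c.dom)).2.mem_nhds hpi] with z hz
  have hz' : z ∈ prodImg c W := ⟨hz.1, hz.2.1⟩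
  refine (coef_of_mem _ _ hz').trans (Eq.trans ?_ (coef_of_mem _ _ hz).symm)
  refine congrArg (fun a => (monomials n).repr a S) ?_
  have h2 := evalAt_res c (slice_mono (inf_le_left : W ⊓ cyl q n c.dom ≤ W) z.1) z.2 hz (s z.1)
  exact h2.symm.trans (congrArg (evalAt c (slice (W ⊓ cyl q n c.dom) z.1) z.2 hz) (hs' z.1))

theorem vert_add (X Y : VF (lineProd M q n) W) (t : ℝ) : vert (X + Y) t = vert X t + vert Y t :=
  Subtype.ext (map_add (vertFam W t) X.1 Y.1)

theorem vert_fmul (f : (lineProd M q n).sec W) (X : VF (lineProd M q n) W) (t : ℝ) :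
    vert (fmul f X) t = fmul (f.1 t) (vert X t) :=
  vf_ext fun V hV a => by
    change M.res (le_slice hV) (M.res _ (f.1 t) * _) = M.res hV (f.1 t) * M.res (le_slice hV) _
    exact (map_mul (M.res (le_slice hV)) _ _).trans (congrArg (· * _) (M.res_res _ _ _))

/-- The definition of `vertFam` uses the cylinder over the open set itself. As `X` commutes with
restriction, any `W'` on which the pull-back lives gives the same value. -/
theorem vert_apply {W' : Opens (lineProd M q n).carrier} (hW' : W' ≤ W) {V : Opens M.carrier}
    (hV : W' ≤ cyl q n V) (X : VF (lineProd M q n) W) (t : ℝ) (f : M.sec V) :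
    (vert X t).1 ⟨slice W' t, slice_mono hW' t⟩ (M.res (fun _ hx => hV hx) f) =
      (X.1 ⟨W', hW'⟩ (pull hV f)).1 t := by
  let N := lineProd M q n
  let V₀ : Opens M.carrier := slice W' t
  have h0 : V₀ ≤ V := fun _ hx => hV hx
  have h1 : W' ⊓ cyl q n V₀ ≤ W ⊓ cyl q n V₀ := inf_le_inf_right _ hW'
  have h2 : V₀ ≤ slice (W' ⊓ cyl q n V₀) t := fun x hx => ⟨hx, hx⟩
  have e1 : N.res h1 (X.1 ⟨W ⊓ cyl q n V₀, inf_le_left⟩ (pull inf_le_right (M.res h0 f))) =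
      N.res inf_le_left (X.1 ⟨W', hW'⟩ (pull hV f)) := by
    refine (vf_res (M := N) X _ _ _).trans (Eq.trans ?_ (vf_res (M := N) X _ _ _).symm)
    refine congrArg (X.1 ⟨_, _⟩) ?_
    exact prodSec_ext fun t => (M.res_res _ _ _).trans ((M.res_res _ _ _).trans (M.res_res _ _ _).symm)
  have e2 := congrArg (fun s : N.sec (W' ⊓ cyl q n V₀) => M.res h2 (s.1 t)) e1
  refine Eq.trans ?_ (e2.trans ?_)
  · exact (M.res_res _ _ _).symm
  · exact (M.res_res _ _ _).trans (M.res_id _)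

theorem vert_restr {W' : Opens (lineProd M q n).carrier} (hW' : W' ≤ W)
    (X : VF (lineProd M q n) W) (t : ℝ) :
    vert (restr hW' X) t = restr (slice_mono hW' t) (vert X t) :=
  vf_ext fun V hV a => by
    let N := lineProd M q n
    have h1 : W' ⊓ cyl q n V ≤ W ⊓ cyl q n V := inf_le_inf_right _ hW'
    have e1 : N.res h1 (X.1 ⟨W ⊓ cyl q n V, inf_le_left⟩ (pull inf_le_right a)) =
        X.1 ⟨W' ⊓ cyl q n V, inf_le_left.trans hW'⟩ (pull inf_le_right a) := by
      refine (vf_res (M := N) X _ _ _).trans (congrArg (X.1 ⟨_, _⟩) ?_)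
      exact prodSec_ext fun t => M.res_res _ _ _
    have e2 := congrArg (fun s : N.sec (W' ⊓ cyl q n V) => M.res (le_slice hV) (s.1 t)) e1
    exact e2.symm.trans (M.res_res _ _ _)

/-- The component along `M`, at time `t`, of a homogeneous vector field. -/
def dvert {i : ZMod 2} (X : Der (lineProd M q n) W i) (t : ℝ) : Der M (slice W t) i :=
  ⟨vertFam W t X.1, vertFam_mem W t i X.1 X.2⟩

theorem vert_vf {i : ZMod 2} (X : Der (lineProd M q n) W i) (t : ℝ) :
    vert (vf X) t = vf (dvert X t) := rfl

theorem prodSec_sum_apply {ι : Type*} (S : Finset ι) (s : ι → (lineProd M q n).sec W) (t : ℝ) :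
    (∑ i ∈ S, s i).1 t = ∑ i ∈ S, (s i).1 t := map_sum (atTime W t) s S

/-- Over a chart the pairing is a sum of products of X(x^I), Y(x^J) and the pulled-back entries of
the Gram matrix, each of which is a section of the product. -/
theorem pairing_vert_mem {g : Pairing M} (hg : IsEvenPairing g) (X Y : VF (lineProd M q n) W) :
    (fun t => g (slice W t) (vert X t) (vert Y t)) ∈ prodSec M q n W := by
  induction X using vf_induction with
  | add X X' hX hX' =>
    have e : (fun t => g (slice W t) (vert (X + X') t) (vert Y t)) =
        (fun t => g (slice W t) (vert X t) (vert Y t)) +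
          fun t => g (slice W t) (vert X' t) (vert Y t) :=
      funext fun t => by rw [vert_add, hg.add_left]; rfl
    rw [e]; exact Subalgebra.add_mem _ hX hX'
  | hom i X =>
    induction Y using vf_induction with
    | add Y Y' hY hY' =>
      have e : (fun t => g (slice W t) (vert (vf X) t) (vert (Y + Y') t)) =
          (fun t => g (slice W t) (vert (vf X) t) (vert Y t)) +
            fun t => g (slice W t) (vert (vf X) t) (vert Y' t) :=
        funext fun t => by rw [vert_add, hg.add_right]; rfl
      rw [e]; exact Subalgebra.add_mem _ hY hY'
    | hom j Y =>
      refine mem_prodSec_local fun c => ?_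
      let W' := W ⊓ cyl q n c.dom
      have hl : W' ≤ W := inf_le_left
      have hr : W' ≤ cyl q n c.dom := inf_le_right
      -- The sign comes from exchanging ∂_I and `Y` in the pairing, so that the coefficients of `Y`
      -- can also be taken out on the left.
      refine ⟨∑ I, X.1 ⟨W', hl⟩ (pull hr (c.coord I)) * sgn (idxPar I * j) • ∑ J,
        Y.1 ⟨W', hl⟩ (pull hr (c.coord J)) *
          pull hr (g c.dom (vf (c.frame J)) (vf (c.frame I))), fun t => ?_⟩
      have hc : slice W' t ≤ c.dom := fun _ hx => hr hx
      have hs : slice W' t ≤ slice W t := slice_mono hl t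
      rw [hg.res, prodSec_sum_apply]
      change g (slice W' t) (vf (drestr hs (dvert X t))) (vf (drestr hs (dvert Y t))) = _
      have hX : ∀ {k : ZMod 2} (Z : Der (lineProd M q n) W k) (I : Fin q ⊕ Fin n),
          act (vf (drestr hs (dvert Z t))) (M.res hc (c.coord I)) =
            (Z.1 ⟨W', hl⟩ (pull hr (c.coord I))).1 t := fun Z I => vert_apply hl hr (vf Z) t _
      conv_lhs => rw [vf_eq_sum c hc (vf (drestr hs (dvert X t)))]
      rw [hg.sum_left]
      refine Finset.sum_congr rfl fun I _ => ?_
      rw [hg.smul_left, hX, hg.symm, vf_eq_sum c hc (vf (drestr hs (dvert Y t))), hg.sum_left]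
      refine congrArg (fun a : M.sec (slice W' t) => _ * sgn (idxPar I * j) • a) ?_
      refine Eq.trans ?_ (prodSec_sum_apply _ _ t).symm
      refine Finset.sum_congr rfl fun J _ => ?_
      rw [hg.smul_left, hX]
      refine congrArg (_ * ·) ?_
      exact (hg.res hc (vf (c.frame J)) (vf (c.frame I))).symm

end Vertical

/-! ### Lifts of vector fields to the product. -/

section Lift

variable {M : SuperSpace.{u}} {q n : ℕ} {U : Opens M.carrier}

/-- Over a chart the slicewise operator is a combination of product frame fields with pulled-back
coefficients, so it preserves smoothness in `t`. -/
theorem lift_mem (X : VF M U) {W : Opens (lineProd M q n).carrier} (hW : W ≤ cyl q n U)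
    (s : (lineProd M q n).sec W) :
    (fun t => X.1 ⟨slice W t, fun _ hx => hW hx⟩ (s.1 t)) ∈ prodSec M q n W := by
  refine mem_prodSec_local fun c => ?_
  let W' := W ⊓ cyl q n c.dom
  have hU : W' ≤ cyl q n (U ⊓ c.dom) := fun p hp => ⟨hW hp.1, hp.2⟩
  refine ⟨∑ I, pull hU (act (restr inf_le_left X) (M.res inf_le_right (c.coord I))) *
    ((prodChart c).frame (emb I)).1 ⟨W', inf_le_right⟩ ((lineProd M q n).res inf_le_left s),
    fun t => ?_⟩
  rw [prodSec_sum_apply]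
  refine (vf_res X _ (slice_mono inf_le_left t) (s.1 t)).trans ?_
  have h1 : slice W' t ≤ U ⊓ c.dom := fun _ hx => hU hx
  refine (vf_apply_eq_sum c inf_le_right (restr (inf_le_left : U ⊓ c.dom ≤ U) X) (slice W' t) h1
    (M.res (slice_mono inf_le_left t) (s.1 t))).trans ?_
  refine Finset.sum_congr rfl fun I _ => ?_
  exact congrArg (_ * ·) (prodChart_frame_emb c I W' inf_le_right
    ((lineProd M q n).res inf_le_left s) t).symm

/-- The operator on families of sections defined by a vector field on `M`. -/
def liftFam (X : VF M U) : Fam (lineProd M q n) (cyl q n U) := fun W =>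
  { toFun := fun s => ⟨_, lift_mem X W.2 s⟩
    map_add' := fun s s' => prodSec_ext fun t => map_add (X.1 ⟨slice W.1 t, _⟩) (s.1 t) (s'.1 t)
    map_smul' := fun r s => prodSec_ext fun t => map_smul (X.1 ⟨slice W.1 t, _⟩) r (s.1 t) }

variable (q n) in
/-- The lift of a homogeneous vector field on `M` to the product. -/
def liftDer {i : ZMod 2} (X : Der M U i) : Der (lineProd M q n) (cyl q n U) i :=
  ⟨liftFam (vf X), fun _ _ _ h a => prodSec_ext fun t => X.2.1 _ _ _ (slice_mono h t) (a.1 t),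
    fun _ _ j a ha t => X.2.2.1 _ _ j (a.1 t) (ha t),
    fun _ _ j a b ha => prodSec_ext fun t => X.2.2.2 _ _ j (a.1 t) (b.1 t) (ha t)⟩

variable (q n) in
/-- The lift of a vector field on `M` to the product. -/
def lift (X : VF M U) : VF (lineProd M q n) (cyl q n U) := ⟨liftFam X, by
  obtain ⟨A, B, rfl⟩ := exists_vf_split X
  have e : liftFam (q := q) (n := n) (vf A + vf B) = liftFam (vf A) + liftFam (vf B) := rfl
  rw [e]
  exact Submodule.add_mem _ (der_le_vf _ 0 (liftDer q n A).2) (der_le_vf _ 1 (liftDer q n B).2)⟩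

theorem lift_vf {i : ZMod 2} (X : Der M U i) : lift q n (vf X) = vf (liftDer q n X) := rfl

theorem lift_add (X Y : VF M U) : lift q n (X + Y) = lift q n X + lift q n Y := rfl

theorem lift_sub (X Y : VF M U) : lift q n (X - Y) = lift q n X - lift q n Y := rfl

theorem lift_smul (r : ℝ) (X : VF M U) : lift q n (r • X) = r • lift q n X := rfl

theorem lift_apply_pull (X : VF M U) {W : Opens (lineProd M q n).carrier} (hW : W ≤ cyl q n U)
    (f : M.sec U) : (lift q n X).1 ⟨W, hW⟩ (pull hW f) = pull hW (act X f) :=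
  prodSec_ext fun _ => (vf_res X le_rfl _ f).symm

theorem act_lift_pull (X : VF M U) (f : M.sec U) :
    act (lift q n X) (pull le_rfl f) = pull le_rfl (act X f) := lift_apply_pull X le_rfl f

theorem lift_apply_tfun (X : VF M U) (φ : ℝ → ℝ) (hφ : ContDiff ℝ ∞ φ)
    {W : Opens (lineProd M q n).carrier} (hW : W ≤ cyl q n U) :
    (lift q n X).1 ⟨W, hW⟩ (tfun φ hφ W) = 0 :=
  prodSec_ext fun _ => vf_apply_algebraMap X _ _ _

theorem act_lift_tfun (X : VF M U) (φ : ℝ → ℝ) (hφ : ContDiff ℝ ∞ φ) :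
    act (lift q n X) (tfun φ hφ _) = 0 := lift_apply_tfun X φ hφ le_rfl

theorem act_lift_time (X : VF M U) : act (lift q n X) (timeSec _) = 0 :=
  lift_apply_tfun X id contDiff_id le_rfl

theorem bracket_liftDer {i j : ZMod 2} (X : Der M U i) (Y : Der M U j) :
    bracket (liftDer q n X) (liftDer q n Y) = liftDer q n (bracket X Y) := rfl

theorem prodChart_frame_eq_lift (c : SuperChart M q n) (I : Fin q ⊕ Fin n) :
    vf ((prodChart c).frame (emb I)) = lift q n (vf (c.frame I)) :=
  vf_ext (M := lineProd M q n) (U := (prodChart c).dom) fun W hW s =>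
    prodSec_ext fun t => prodChart_frame_emb c I W hW s t

theorem vert_lift (X : VF M U) (t : ℝ) : vert (lift q n X) t = X :=
  vf_ext fun V hV a => by
    change M.res (le_slice hV) (X.1 ⟨_, _⟩ (M.res _ a)) = _
    refine (vf_res X _ (le_slice hV) _).trans (congrArg (X.1 ⟨V, _⟩) ?_)
    exact (M.res_res _ _ _).trans (M.res_id a)

variable {T : VF (lineProd M q n) ⊤}

theorem IsPartialT.vert_der (hT : IsPartialT T) (W : Opens (lineProd M q n).carrier) (t : ℝ) :
    vert (vf (hT.der W)) t = 0 :=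
  vf_ext fun V hV a => by
    change M.res (le_slice hV) ((T.1 ⟨W ⊓ cyl q n V, _⟩ (SuperGeom.pull inf_le_right a)).1 t) = _
    rw [hT.apply_pull]
    exact map_zero _

theorem IsPartialT.act_time (hT : IsPartialT T) (W : Opens (lineProd M q n).carrier) :
    act (vf (hT.der W)) (timeSec W) = 1 := hT.apply_time W

theorem IsPartialT.act_pull (hT : IsPartialT T) (f : M.sec U) :
    act (vf (hT.der (cyl q n U))) (SuperGeom.pull le_rfl f) = 0 := hT.apply_pull le_rfl f

theorem IsPartialT.act_tfun (hT : IsPartialT T) (hM : Charted M q n)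
    (W : Opens (lineProd M q n).carrier) (φ : ℝ → ℝ) (hφ : ContDiff ℝ ∞ φ)
    (hφ' : ContDiff ℝ ∞ (deriv φ)) :
    act (vf (hT.der W)) (tfun φ hφ W) = tfun (deriv φ) hφ' W := hT.apply_tfun hM W φ hφ hφ'

theorem vf_ext_prod (c : SuperChart M q n) {X Y : VF (lineProd M q n) (cyl q n c.dom)}
    (h0 : act X (timeSec _) = act Y (timeSec _))
    (h : ∀ I, act X (pull le_rfl (c.coord I)) = act Y (pull le_rfl (c.coord I))) : X = Y := by
  refine vf_ext_coord (prodChart c) (W := (prodChart c).dom) le_rfl fun A => ?_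
  refine forall_prodIdx (p := fun A => act (U := (prodChart c).dom) X
    ((lineProd M q n).res le_rfl ((prodChart c).coord A)) = act (U := (prodChart c).dom) Y
    ((lineProd M q n).res le_rfl ((prodChart c).coord A))) ?_ (fun I => ?_) A
  · rw [res_coord_zero]; exact h0
  · rw [res_coord_emb]; exact h I

/-- It suffices to look at coordinates. On `t` one order of composition differentiates 0 and the
other differentiates 1; on pull-backs the lift gives a pull-back again, which ∂_t kills. -/
theorem IsPartialT.bracket_lift (hT : IsPartialT T) (c : SuperChart M q n) {i : ZMod 2}
    (X : Der M c.dom i) : vf (bracket (hT.der (cyl q n c.dom)) (liftDer q n X)) = 0 := by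
  refine vf_ext_prod c ?_ fun I => ?_
  · change act (vf (hT.der _)) (act (lift q n (vf X)) (timeSec _)) -
      sgn _ • act (lift q n (vf X)) (act (vf (hT.der _)) (timeSec _)) = 0
    rw [act_lift_time, hT.act_time, act, act, map_zero]
    refine (congrArg (0 - sgn _ • ·) (vf_apply_one (M := lineProd M q n) _ _ _)).trans ?_
    rw [smul_zero, sub_zero]
  · change act (vf (hT.der _)) (act (lift q n (vf X)) (SuperGeom.pull le_rfl _)) -
      sgn _ • act (lift q n (vf X)) (act (vf (hT.der _)) (SuperGeom.pull le_rfl _)) = 0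
    rw [act_lift_pull, hT.act_pull, hT.act_pull, act, map_zero, smul_zero, sub_zero]

end Lift

/-! ### The warped metric and its Gram matrix. -/

section Warped

variable {M : SuperSpace.{u}} {q n : ℕ} {W : Opens (lineProd M q n).carrier} {g : Pairing M}
  {h : ℝ → ℝ}

/-- The family in the definition of `warped` is smooth by `pairing_vert_mem`, so the default value
never occurs. -/
theorem warped_apply (hg : IsEvenPairing g) (hh : ContDiff ℝ ∞ h) (X Y : VF (lineProd M q n) W)
    (t : ℝ) : (warped q n h g W X Y).1 t =
      -((act X (timeSec W)).1 t * (act Y (timeSec W)).1 t) +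
        h t ^ 2 • g (slice W t) (vert X t) (vert Y t) := by
  have hs : (fun t => -((act X (timeSec W)).1 t * (act Y (timeSec W)).1 t) +
      h t ^ 2 • g (slice W t) (vert X t) (vert Y t)) ∈ prodSec M q n W := by
    let G : (lineProd M q n).sec W := ⟨_, pairing_vert_mem hg X Y⟩
    have h1 := (-(act X (timeSec W) * act Y (timeSec W)) +
      tfun (fun t => h t ^ 2) (hh.pow 2) W * G).2
    have e : (-(act X (timeSec W) * act Y (timeSec W)) +
      tfun (fun t => h t ^ 2) (hh.pow 2) W * G).1 =
        fun t => -((act X (timeSec W)).1 t * (act Y (timeSec W)).1 t) +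
          h t ^ 2 • g (slice W t) (vert X t) (vert Y t) :=
      funext fun t => congrArg (_ + ·) (Algebra.smul_def (h t ^ 2)
        (g (slice W t) (vert X t) (vert Y t))).symm
    exact e ▸ h1
  have e : warped q n h g W X Y = ⟨_, hs⟩ := dif_pos hs
  rw [e]

theorem warped_isEvenPairing (hg : IsEvenPairing g) (hh : ContDiff ℝ ∞ h) :
    IsEvenPairing (warped q n h g) where
  res {W W'} hW X Y := prodSec_ext fun t => by
    have hX : ∀ X : VF (lineProd M q n) W, M.res (slice_mono hW t) ((act X (timeSec W)).1 t) =
        (act (restr hW X) (timeSec W')).1 t := fun X => by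
      have h1 := res_act (M := lineProd M q n) X hW (timeSec W)
      rw [res_timeSec] at h1
      exact congrArg (fun s : (lineProd M q n).sec W' => s.1 t) h1
    have e : ((lineProd M q n).res hW (warped q n h g W X Y)).1 t =
      M.res (slice_mono hW t) ((warped q n h g W X Y).1 t) := rfl
    refine e.trans ?_
    refine (congrArg (M.res (slice_mono hW t)) (warped_apply hg hh X Y t)).trans
      (Eq.trans ?_ (warped_apply hg hh _ _ t).symm)
    rw [← hX, ← hX, vert_restr, vert_restr]
    refine (map_add (M.res (slice_mono hW t)) _ _).trans (congrArg₂ (· + ·) ?_ ?_)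
    · exact (map_neg (M.res (slice_mono hW t)) _).trans (congrArg Neg.neg (map_mul _ _ _))
    · exact (map_smul (M.res (slice_mono hW t)) _ _).trans
        (congrArg (h t ^ 2 • ·) (hg.res (slice_mono hW t) _ _))
  add_left W X Y Z := prodSec_ext fun t => by
    refine (warped_apply hg hh _ _ t).trans (Eq.trans ?_
      (congrArg₂ (· + ·) (warped_apply hg hh X Z t) (warped_apply hg hh Y Z t)).symm)
    rw [vert_add, hg.add_left, act_add_left]
    change -(((act X (timeSec W)).1 t + (act Y (timeSec W)).1 t) * _) + _ = _
    rw [add_mul, smul_add]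
    abel
  add_right W X Y Z := prodSec_ext fun t => by
    refine (warped_apply hg hh _ _ t).trans (Eq.trans ?_
      (congrArg₂ (· + ·) (warped_apply hg hh X Y t) (warped_apply hg hh X Z t)).symm)
    rw [vert_add, hg.add_right, act_add_left]
    change -(_ * ((act Y (timeSec W)).1 t + (act Z (timeSec W)).1 t)) + _ = _
    rw [mul_add, smul_add]
    abel
  smul_left W f X Y := prodSec_ext fun t => by
    refine (warped_apply hg hh _ _ t).trans (Eq.trans ?_
      (congrArg (f.1 t * ·) (warped_apply hg hh X Y t)).symm)
    rw [vert_fmul, hg.smul_left, act_fmul]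
    change -(f.1 t * (act X (timeSec W)).1 t * _) + _ = _
    rw [mul_add, mul_neg, mul_assoc, mul_smul_comm]
  even W i j X Y t := by
    refine (warped_apply hg hh (vf X) (vf Y) t).symm ▸ ?_
    refine Submodule.add_mem _ (Submodule.neg_mem _ ?_) (Submodule.smul_mem _ _ ?_)
    · have h1 := act_mem X (timeSec_mem W) t
      have h2 := act_mem Y (timeSec_mem W) t
      rw [add_zero] at h1 h2
      exact M.mul_mem h1 h2
    · exact hg.even _ (dvert X t) (dvert Y t)
  symm W i j X Y := prodSec_ext fun t => by
    refine (warped_apply hg hh _ _ t).trans (Eq.trans ?_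
      (congrArg (sgn (i * j) • ·) (warped_apply hg hh (vf Y) (vf X) t)).symm)
    have h1 := act_mem X (timeSec_mem W) t
    have h2 := act_mem Y (timeSec_mem W) t
    rw [add_zero] at h1 h2
    rw [M.supercomm h1 h2]
    have h3 := hg.symm _ (dvert X t) (dvert Y t)
    rw [vert_vf, vert_vf, h3]
    module

variable {T : VF (lineProd M q n) ⊤}

theorem IsPartialT.warped_self (hT : IsPartialT T) (hg : IsEvenPairing g) (hh : ContDiff ℝ ∞ h) :
    warped q n h g W (vf (hT.der W)) (vf (hT.der W)) = -1 := prodSec_ext fun t => by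
  refine (warped_apply hg hh _ _ t).trans ?_
  rw [hT.act_time, hT.vert_der, hg.zero_left, smul_zero, add_zero]
  exact congrArg Neg.neg (mul_one _)

theorem IsPartialT.warped_lift (hT : IsPartialT T) (hg : IsEvenPairing g) (hh : ContDiff ℝ ∞ h)
    {U : Opens M.carrier} (X : VF M U) :
    warped q n h g _ (lift q n X) (vf (hT.der (cyl q n U))) = 0 := prodSec_ext fun t => by
  refine (warped_apply hg hh _ _ t).trans ?_
  rw [hT.vert_der, hg.zero_right, act_lift_time, smul_zero, add_zero]
  exact (congrArg Neg.neg (zero_mul _)).trans neg_zero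

theorem IsPartialT.warped_lift' (hT : IsPartialT T) (hg : IsEvenPairing g) (hh : ContDiff ℝ ∞ h)
    {U : Opens M.carrier} (X : VF M U) :
    warped q n h g _ (vf (hT.der (cyl q n U))) (lift q n X) = 0 := prodSec_ext fun t => by
  refine (warped_apply hg hh _ _ t).trans ?_
  rw [hT.vert_der, hg.zero_left, act_lift_time, smul_zero, add_zero]
  exact (congrArg Neg.neg (mul_zero _)).trans neg_zero

theorem warped_lift_lift (hg : IsEvenPairing g) (hh : ContDiff ℝ ∞ h)
    {U : Opens M.carrier} (X Y : VF M U) :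
    warped q n h g _ (lift q n X) (lift q n Y) =
      tfun (fun t => h t ^ 2) (hh.pow 2) _ * pull le_rfl (g U X Y) := prodSec_ext fun t => by
  refine (warped_apply hg hh _ _ t).trans ?_
  rw [act_lift_time]
  have e : g (slice (cyl q n U) t) (vert (lift q n X) t) (vert (lift q n Y) t) = g U X Y :=
    congrArg₂ (g U) (vert_lift X t) (vert_lift Y t)
  have e0 : -((0 : (lineProd M q n).sec (cyl q n U)).1 t * (act (lift q n Y) (timeSec _)).1 t) = 0 :=
    (congrArg Neg.neg (zero_mul _)).trans neg_zero
  refine (congrArg₂ (· + ·) e0 (congrArg (h t ^ 2 • ·) e)).trans ((zero_add _).trans ?_)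
  refine (Algebra.smul_def _ _).trans (congrArg (algebraMap ℝ _ (h t ^ 2) * ·) ?_)
  exact (M.res_id _).symm

theorem tfun_mul (φ ψ : ℝ → ℝ) (hφ : ContDiff ℝ ∞ φ) (hψ : ContDiff ℝ ∞ ψ) :
    tfun φ hφ W * tfun ψ hψ W = tfun (fun t => φ t * ψ t) (hφ.mul hψ) W :=
  prodSec_ext fun t => (map_mul (algebraMap ℝ _) (φ t) (ψ t)).symm

theorem tfun_one : tfun (fun _ => 1) contDiff_const W = 1 :=
  prodSec_ext fun _ => map_one (algebraMap ℝ _)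

theorem tfun_comm (φ : ℝ → ℝ) (hφ : ContDiff ℝ ∞ φ) (s : (lineProd M q n).sec W) :
    tfun φ hφ W * s = s * tfun φ hφ W :=
  prodSec_ext fun t => Algebra.commutes (φ t) (s.1 t)

/-- The coordinate of the product that an index stands for: `none` is the time. -/
def idxSplit : Fin (q + 1) ⊕ Fin n → Option (Fin q ⊕ Fin n)
  | .inl a => Fin.cases none (fun a => some (.inl a)) a
  | .inr A => some (.inr A)

theorem idxSplit_zero : idxSplit (q := q) (n := n) (Sum.inl 0) = none := rfl

theorem idxSplit_emb (I : Fin q ⊕ Fin n) : idxSplit (emb I) = some I := by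
  rcases I with a | A <;> rfl

theorem emb_ne_zero (I : Fin q ⊕ Fin n) : emb I ≠ Sum.inl 0 := fun h => by
  have := congrArg idxSplit h
  rw [idxSplit_emb, idxSplit_zero] at this
  exact Option.some_ne_none I this

theorem emb_injective {I J : Fin q ⊕ Fin n} (h : emb I = emb J) : I = J := by
  have := congrArg idxSplit h
  rw [idxSplit_emb, idxSplit_emb] at this
  exact Option.some_injective _ this

theorem IsPartialT.frame_zero (hT : IsPartialT T) (c : SuperChart M q n) :
    vf ((prodChart c).frame (Sum.inl 0)) = vf (hT.der (cyl q n c.dom)) :=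
  (congrArg vf (hT.eq_frame c (W := (prodChart c).dom) le_rfl)).symm

/-- In a product chart the Gram matrix is block diagonal with blocks -1 and h² times that of `g`,
and its inverse has the blocks -1 and h⁻² times `B`. -/
theorem warped_nondegenerateIn (hT : IsPartialT T) (hg : IsEvenPairing g) (hh : ContDiff ℝ ∞ h)
    (h0 : ∀ t, h t ≠ 0) {c : SuperChart M q n} (hc : NondegenerateIn g c) :
    NondegenerateIn (warped q n h g) (prodChart c) := by
  obtain ⟨B, hB1, hB2⟩ := hc
  let C := cyl q n c.dom
  have hinv : ContDiff ℝ ∞ fun t => (h t ^ 2)⁻¹ := (hh.pow 2).inv fun t => pow_ne_zero 2 (h0 t)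
  let a : (lineProd M q n).sec C := tfun (fun t => h t ^ 2) (hh.pow 2) C
  let b : (lineProd M q n).sec C := tfun (fun t => (h t ^ 2)⁻¹) hinv C
  have hab : a * b = 1 := by
    rw [tfun_mul, ← tfun_one]
    exact prodSec_ext fun t => congrArg (algebraMap ℝ _) (mul_inv_cancel₀ (pow_ne_zero 2 (h0 t)))
  have hba : b * a = 1 := (tfun_comm _ _ _).trans hab
  let B' : Fin (q + 1) ⊕ Fin n → Fin (q + 1) ⊕ Fin n → (lineProd M q n).sec C := fun A A' =>
    match idxSplit A, idxSplit A' with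
    | none, none => -1
    | some I, some J => b * pull le_rfl (B I J)
    | _, _ => 0
  let G : Fin (q + 1) ⊕ Fin n → Fin (q + 1) ⊕ Fin n → (lineProd M q n).sec C := fun A A' =>
    warped q n h g C (vf ((prodChart c).frame A)) (vf ((prodChart c).frame A'))
  have B00 : B' (Sum.inl 0) (Sum.inl 0) = -1 := rfl
  have B0e : ∀ I, B' (Sum.inl 0) (emb I) = 0 := fun I => by
    simp only [B', idxSplit_emb, idxSplit_zero]
  have Be0 : ∀ I, B' (emb I) (Sum.inl 0) = 0 := fun I => by
    simp only [B', idxSplit_emb, idxSplit_zero]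
  have Bee : ∀ I J, B' (emb I) (emb J) = b * pull le_rfl (B I J) := fun I J => by
    simp only [B', idxSplit_emb]
  have F0 := hT.frame_zero c
  have Fe := prodChart_frame_eq_lift c
  have G00 : G (Sum.inl 0) (Sum.inl 0) = -1 :=
    (congrArg₂ (warped q n h g C) F0 F0).trans (hT.warped_self hg hh)
  have G0e : ∀ I, G (Sum.inl 0) (emb I) = 0 := fun I =>
    (congrArg₂ (warped q n h g C) F0 (Fe I)).trans (hT.warped_lift' hg hh _)
  have Ge0 : ∀ I, G (emb I) (Sum.inl 0) = 0 := fun I =>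
    (congrArg₂ (warped q n h g C) (Fe I) F0).trans (hT.warped_lift hg hh _)
  have Gee : ∀ I J, G (emb I) (emb J) = a * pull le_rfl (g c.dom (vf (c.frame I)) (vf (c.frame J))) :=
    fun I J => (congrArg₂ (warped q n h g C) (Fe I) (Fe J)).trans (warped_lift_lift hg hh _ _)
  -- One computation with block matrices, stated symmetrically so as to give both inverse relations.
  -- The scalars `x` and `y` must commute with all sections.
  have key : ∀ (P Q : Fin (q + 1) ⊕ Fin n → Fin (q + 1) ⊕ Fin n → (lineProd M q n).sec C)
      (p r : Fin q ⊕ Fin n → Fin q ⊕ Fin n → M.sec c.dom) (x y : (lineProd M q n).sec C),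
      (∀ s, x * s = s * x) → (∀ s, y * s = s * y) → x * y = 1 →
      P (Sum.inl 0) (Sum.inl 0) = -1 → Q (Sum.inl 0) (Sum.inl 0) = -1 →
      (∀ I, P (Sum.inl 0) (emb I) = 0) → (∀ I, Q (Sum.inl 0) (emb I) = 0) →
      (∀ I, P (emb I) (Sum.inl 0) = 0) → (∀ I, Q (emb I) (Sum.inl 0) = 0) →
      (∀ I J, P (emb I) (emb J) = x * pull le_rfl (p I J)) →
      (∀ I J, Q (emb I) (emb J) = y * pull le_rfl (r I J)) →
      (∀ I K, ∑ J, p I J * r J K = if I = K then 1 else 0) →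
      ∀ I K, ∑ J, P I J * Q J K = if I = K then 1 else 0 := by
    intro P Q p r x y hx hy hxy P00 Q00 P0e Q0e Pe0 Qe0 Pee Qee hpr I K
    rw [sum_prodIdx]
    revert I K
    refine forall_prodIdx (forall_prodIdx ?_ fun K => ?_) fun I => forall_prodIdx ?_ fun K => ?_
    · simp [P00, Q00, P0e]
    · simp [Q0e, P0e, (emb_ne_zero K).symm]
    · simp [Pe0, Qe0, emb_ne_zero I]
    · rw [Pe0, zero_mul, zero_add]
      have : ∀ J, P (emb I) (emb J) * Q (emb J) (emb K) = pull le_rfl (p I J * r J K) := fun J => by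
        rw [Pee, Qee, mul_assoc, ← mul_assoc _ y, ← hy, mul_assoc, ← mul_assoc, hxy, one_mul, map_mul]
      rw [Finset.sum_congr rfl fun J _ => this J, ← map_sum, hpr]
      by_cases hIK : I = K
      · rw [if_pos hIK, if_pos (congrArg emb hIK), map_one]
      · rw [if_neg hIK, if_neg fun e => hIK (emb_injective e), map_zero]
  exact ⟨B', key G B' _ _ a b (tfun_comm _ _) (tfun_comm _ _) hab G00 B00 G0e B0e Ge0 Be0 Gee Bee hB1,
    key B' G _ _ b a (tfun_comm _ _) (tfun_comm _ _) hba B00 G00 B0e G0e Be0 Ge0 Bee Gee hB2⟩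

theorem warped_locallyNondegenerate (hT : IsPartialT T) (hg : IsEvenPairing g)
    (hh : ContDiff ℝ ∞ h) (h0 : ∀ t, h t ≠ 0) (hn : LocallyNondegenerate q n g) :
    LocallyNondegenerate (q + 1) n (warped q n h g) := fun x => by
  obtain ⟨c, hx, hc⟩ := hn x.2
  exact ⟨prodChart c, hx, warped_nondegenerateIn hT hg hh h0 hc⟩

end Warped

/-! ### Real linearity of connections; antisymmetry of the curvature. -/

section Connections

variable {M : SuperSpace.{u}} {U : Opens M.carrier} (D : AffineConnection M)

namespace AffineConnection

theorem rsmul_left (r : ℝ) (X Y : VF M U) : D.nabla U (r • X) Y = r • D.nabla U X Y := by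
  have h : ∀ X : VF M U, r • X = fmul (algebraMap ℝ _ r) X := fun X => by
    rw [Algebra.algebraMap_eq_smul_one, smul_fmul, one_fmul]
  rw [h, D.smul_left, ← h]

theorem rsmul_right (r : ℝ) (X Y : VF M U) : D.nabla U X (r • Y) = r • D.nabla U X Y := by
  have h : ∀ X : VF M U, r • X = fmul (algebraMap ℝ _ r) X := fun X => by
    rw [Algebra.algebraMap_eq_smul_one, smul_fmul, one_fmul]
  have hr : algebraMap ℝ (M.sec U) r ∈ M.par U 0 := by
    rw [Algebra.algebraMap_eq_smul_one]; exact Submodule.smul_mem _ _ (M.one_mem U)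
  induction X using vf_induction with
  | add X X' hX hX' => rw [D.add_left, D.add_left, hX, hX', smul_add]
  | hom i X =>
    rw [h Y, D.leibniz U X _ Y hr, act, vf_apply_algebraMap, zero_fmul, zero_add, mul_zero, sgn_zero,
      one_smul, ← h]

theorem zero_left (Y : VF M U) : D.nabla U 0 Y = 0 := by
  rw [← zero_smul ℝ (0 : VF M U), D.rsmul_left, zero_smul, zero_smul]

/-- The covariant derivative of homogeneous vector fields, as a homogeneous one. -/
def dnabla {i j : ZMod 2} (X : Der M U i) (Y : Der M U j) : Der M U (i + j) :=
  ⟨_, D.degree U X Y⟩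

end AffineConnection

theorem curvature_antisymm {i j : ZMod 2} (X : Der M U i) (Y : Der M U j) (Z : VF M U) :
    curvature D Y X Z = -(sgn (i * j) • curvature D X Y Z) := by
  rw [curvature, curvature, vf_bracket_symm Y X, ← neg_one_smul ℝ (sgn (j * i) • vf (bracket X Y)),
    D.rsmul_left, D.rsmul_left, mul_comm j i]
  rcases parity_cases (i * j) with h | h <;> rw [h] <;> simp [sgn] <;> module

theorem curvature_congr {i i' j j' : ZMod 2} {X : Der M U i} {X' : Der M U i'} {Y : Der M U j}
    {Y' : Der M U j'} (hi : i = i') (hj : j = j') (hX : vf X = vf X') (hY : vf Y = vf Y')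
    (Z : VF M U) : curvature D X Y Z = curvature D X' Y' Z := by
  subst hi hj
  rw [vf_injective hX, vf_injective hY]

end Connections

/-! ### Calculus with functions of time and pull-backs. -/

section TimeFunctions

variable {M : SuperSpace.{u}} {q n : ℕ} {U : Opens M.carrier} {W : Opens (lineProd M q n).carrier}
  {T : VF (lineProd M q n) ⊤}

theorem tfun_congr {φ ψ : ℝ → ℝ} {hφ : ContDiff ℝ ∞ φ} {hψ : ContDiff ℝ ∞ ψ} (h : ∀ t, φ t = ψ t) :
    tfun φ hφ W = tfun ψ hψ W := prodSec_ext fun t => congrArg (algebraMap ℝ _) (h t)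

theorem smul_tfun (r : ℝ) {φ : ℝ → ℝ} (hφ : ContDiff ℝ ∞ φ) :
    r • tfun φ hφ W = tfun (fun t => r * φ t) (contDiff_const.mul hφ) W := prodSec_ext fun t => by
  change r • algebraMap ℝ (M.sec (slice W t)) (φ t) = algebraMap ℝ _ (r * φ t)
  rw [map_mul, Algebra.smul_def]

theorem add_tfun {φ ψ : ℝ → ℝ} (hφ : ContDiff ℝ ∞ φ) (hψ : ContDiff ℝ ∞ ψ) :
    tfun φ hφ W + tfun ψ hψ W = tfun (fun t => φ t + ψ t) (hφ.add hψ) W :=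
  prodSec_ext fun _ => (map_add (algebraMap ℝ _) _ _).symm

theorem sub_tfun {φ ψ : ℝ → ℝ} (hφ : ContDiff ℝ ∞ φ) (hψ : ContDiff ℝ ∞ ψ) :
    tfun φ hφ W - tfun ψ hψ W = tfun (fun t => φ t - ψ t) (hφ.sub hψ) W :=
  prodSec_ext fun _ => (map_sub (algebraMap ℝ _) _ _).symm

theorem act_lift_tfun_pull (X : VF M U) {φ : ℝ → ℝ} (hφ : ContDiff ℝ ∞ φ) (f : M.sec U) :
    act (lift q n X) (tfun φ hφ _ * pull le_rfl f) = tfun φ hφ _ * pull le_rfl (act X f) := by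
  induction X using vf_induction with
  | add X Y hX hY => rw [lift_add, act_add_left, hX, hY, act_add_left, map_add, mul_add]
  | hom i X =>
    rw [lift_vf, act_mul _ (tfun_mem φ hφ _), ← lift_vf, act_lift_tfun, act_lift_pull, zero_mul,
      zero_add, mul_zero, sgn_zero, one_smul]

theorem IsPartialT.act_tfun_pull (hT : IsPartialT T) (hM : Charted M q n) {φ : ℝ → ℝ}
    (hφ : ContDiff ℝ ∞ φ) (hφ' : ContDiff ℝ ∞ (deriv φ)) (f : M.sec U) :
    act (vf (hT.der (cyl q n U))) (tfun φ hφ _ * SuperGeom.pull le_rfl f) =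
      tfun (deriv φ) hφ' _ * SuperGeom.pull le_rfl f := by
  rw [act_mul _ (tfun_mem φ hφ _), hT.act_tfun hM _ φ hφ hφ', hT.act_pull, mul_zero, mul_zero,
    smul_zero, add_zero]

theorem tfun_pull_mem {φ : ℝ → ℝ} (hφ : ContDiff ℝ ∞ φ) {f : M.sec U} {i : ZMod 2}
    (hf : f ∈ M.par U i) :
    tfun φ hφ (cyl q n U) * pull le_rfl f ∈ (lineProd M q n).par _ i := by
  have h := (lineProd M q n).mul_mem (tfun_mem φ hφ (cyl q n U)) (pull_mem le_rfl hf)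
  rwa [zero_add] at h

end TimeFunctions

/-! ### The Levi-Civita connection of the warped metric. -/

section WarpedLeviCivita

variable {M : SuperSpace.{u}} {q n : ℕ} {g : Pairing M} {h : ℝ → ℝ} {T : VF (lineProd M q n) ⊤}
  {c : SuperChart M q n}

/-- The fields ∂_t and the lifts contain a frame, so by non-degeneracy the Koszul formula only has
to be evaluated against them. -/
theorem eq_of_warped (hT : IsPartialT T) (hg : IsEvenPairing g) (hh : ContDiff ℝ ∞ h)
    (h0 : ∀ t, h t ≠ 0) (hc : NondegenerateIn g c) {A B : VF (lineProd M q n) (cyl q n c.dom)}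
    (e0 : warped q n h g _ A (vf (hT.der _)) = warped q n h g _ B (vf (hT.der _)))
    (e : ∀ (k : ZMod 2) (Z : Der M c.dom k), warped q n h g _ A (vf (liftDer q n Z)) =
      warped q n h g _ B (vf (liftDer q n Z))) : A = B := by
  have hgw := warped_isEvenPairing (q := q) (n := n) hg hh
  refine sub_eq_zero.1 ((warped_nondegenerateIn hT hg hh h0 hc).eq_zero hgw
    (U := (prodChart c).dom) le_rfl (A - B) fun J => ?_)
  have key : ∀ Z : VF (lineProd M q n) (cyl q n c.dom), warped q n h g _ A Z = warped q n h g _ B Z →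
      warped q n h g (cyl q n c.dom) (A - B) Z = 0 := fun Z hZ => by
    rw [hgw.sub_left, hZ, sub_self]
  refine forall_prodIdx (p := fun J => warped q n h g (prodChart c).dom (A - B)
    (vf (drestr le_rfl ((prodChart c).frame J))) = 0) ?_ (fun I => ?_) J
  · exact (congrArg (warped q n h g (cyl q n c.dom) (A - B)) (hT.frame_zero c)).trans (key _ e0)
  · exact (congrArg (warped q n h g (cyl q n c.dom) (A - B)) (prodChart_frame_eq_lift c I)).trans
      (key _ (e _ (c.frame I)))

theorem vf_bracket_self_even {N : SuperSpace.{u}} {W : Opens N.carrier} (X : Der N W 0) :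
    vf (bracket X X) = 0 := vf_ext fun _ _ _ => by
  change X.1 _ (X.1 _ _) - sgn (0 * 0) • X.1 _ (X.1 _ _) = 0
  rw [mul_zero, sgn_zero, one_smul, sub_self]

theorem IsPartialT.bracket_lift' (hT : IsPartialT T) (c : SuperChart M q n) {i : ZMod 2}
    (X : Der M c.dom i) : vf (bracket (liftDer q n X) (hT.der (cyl q n c.dom))) = 0 := by
  rw [vf_bracket_symm, hT.bracket_lift, smul_zero]
  exact neg_zero (G := VF (lineProd M q n) (cyl q n c.dom))

variable {D : AffineConnection (lineProd M q n)} {D₂ : AffineConnection M}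

theorem act_zero_right {N : SuperSpace.{u}} {W : Opens N.carrier} (X : VF N W) : act X 0 = 0 :=
  map_zero _

theorem act_neg_one {N : SuperSpace.{u}} {W : Opens N.carrier} (X : VF N W) : act X (-1) = 0 := by
  rw [act, map_neg, vf_apply_one, neg_zero]

theorem eq_of_two_smul {A : Type*} [AddCommGroup A] [Module ℝ A] {x y : A}
    (h : (2 : ℝ) • x = (2 : ℝ) • y) : x = y := smul_right_injective A (two_ne_zero (α := ℝ)) h

/-- All pairings in the Koszul formula are the constants -1 or 0, and all brackets vanish. -/
theorem leviCivita_time_time (hT : IsPartialT T) (hg : IsEvenPairing g) (hh : ContDiff ℝ ∞ h)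
    (h0 : ∀ t, h t ≠ 0) (hc : NondegenerateIn g c) (hD : IsLeviCivita (warped q n h g) D) :
    D.nabla _ (vf (hT.der (cyl q n c.dom))) (vf (hT.der (cyl q n c.dom))) = 0 := by
  have hgw := warped_isEvenPairing (q := q) (n := n) hg hh
  refine eq_of_warped hT hg hh h0 hc ?_ fun k Z => ?_ <;> refine eq_of_two_smul ?_ <;>
    rw [hD.koszul hgw, hgw.zero_left, smul_zero, koszul]
  · simp only [hT.warped_self hg hh, act_neg_one, vf_bracket_self_even, hgw.zero_left, smul_zero,
      add_zero, sub_zero]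
  · simp only [← lift_vf, hT.warped_lift hg hh, hT.warped_lift' hg hh, hT.bracket_lift,
      hT.bracket_lift', hT.warped_self hg hh, act_neg_one, act_zero_right, vf_bracket_self_even,
      hgw.zero_left, smul_zero, add_zero, sub_zero]

/-- The logarithmic derivative of `h` is smooth. -/
theorem contDiff_logDeriv (hh : ContDiff ℝ ∞ h) (h0 : ∀ t, h t ≠ 0) :
    ContDiff ℝ ∞ fun t => deriv h t / h t :=
  (hh.iterate_deriv 1).div hh h0

theorem deriv_sq (hh : ContDiff ℝ ∞ h) (t : ℝ) :
    deriv (fun t => h t ^ 2) t = 2 * (h t * deriv h t) := by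
  rw [deriv_fun_pow ((hh.differentiable (by simp)) t)]; simp; ring

theorem contDiff_deriv {φ : ℝ → ℝ} (hφ : ContDiff ℝ ∞ φ) : ContDiff ℝ ∞ (deriv φ) :=
  hφ.iterate_deriv 1

/-- Against a lift Z the only surviving term is ∂_t(h² g(X,Z)) = 2 h h' g(X,Z), which is 2 (h'/h)
times the warped pairing of X and Z. -/
theorem leviCivita_time_lift_hom (hM : Charted M q n) (hT : IsPartialT T) (hg : IsEvenPairing g)
    (hh : ContDiff ℝ ∞ h) (h0 : ∀ t, h t ≠ 0) (hc : NondegenerateIn g c)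
    (hD : IsLeviCivita (warped q n h g) D) {i : ZMod 2} (X : Der M c.dom i) :
    D.nabla _ (vf (hT.der (cyl q n c.dom))) (vf (liftDer q n X)) =
      fmul (tfun (fun t => deriv h t / h t) (contDiff_logDeriv hh h0) _) (vf (liftDer q n X)) := by
  have hgw := warped_isEvenPairing (q := q) (n := n) hg hh
  refine eq_of_warped hT hg hh h0 hc ?_ fun k Z => ?_ <;> refine eq_of_two_smul ?_ <;>
    rw [hD.koszul hgw, hgw.smul_left, koszul]
  · simp only [← lift_vf, hT.warped_lift hg hh, hT.warped_lift' hg hh, hT.bracket_lift,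
      hT.bracket_lift', hT.warped_self hg hh, act_neg_one, act_zero_right, vf_bracket_self_even,
      hgw.zero_left, smul_zero, add_zero, sub_zero, mul_zero]
  · rw [bracket_liftDer]
    simp only [← lift_vf, hT.warped_lift hg hh, hT.warped_lift' hg hh, hT.bracket_lift,
      hT.bracket_lift', act_zero_right, hgw.zero_left, smul_zero, add_zero, sub_zero,
      warped_lift_lift hg hh]
    rw [hT.act_tfun_pull hM (hh.pow 2) (contDiff_deriv (hh.pow 2)), ← mul_assoc, tfun_mul,
      ← smul_mul_assoc, smul_tfun]
    refine congrArg (· * _) (tfun_congr fun t => ?_)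
    rw [deriv_sq hh]
    field_simp [h0 t]

/-- Torsion-freeness, as lifts have zero bracket with ∂_t. -/
theorem leviCivita_lift_time_hom (hM : Charted M q n) (hT : IsPartialT T) (hg : IsEvenPairing g)
    (hh : ContDiff ℝ ∞ h) (h0 : ∀ t, h t ≠ 0) (hc : NondegenerateIn g c)
    (hD : IsLeviCivita (warped q n h g) D) {i : ZMod 2} (X : Der M c.dom i) :
    D.nabla _ (vf (liftDer q n X)) (vf (hT.der (cyl q n c.dom))) =
      fmul (tfun (fun t => deriv h t / h t) (contDiff_logDeriv hh h0) _) (vf (liftDer q n X)) := by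
  have e := hD.torsion_free _ (liftDer q n X) (hT.der (cyl q n c.dom))
  rw [hT.bracket_lift', mul_zero, sgn_zero, one_smul, leviCivita_time_lift_hom hM hT hg hh h0 hc hD]
    at e
  have e' := (sub_zero (D.nabla _ (vf (liftDer q n X)) (vf (hT.der (cyl q n c.dom))) -
    fmul (tfun (fun t => deriv h t / h t) (contDiff_logDeriv hh h0) _) (vf (liftDer q n X)))).symm.trans e
  exact sub_eq_zero.1 e'

/-- Against ∂_t the Koszul formula leaves -∂_t(h² g(X,Y)) = -2 h h' g(X,Y), and the sign disappears
because ∂_t has square -1. Against a lift it is h² times the Koszul formula of `g`. -/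
theorem leviCivita_lift_lift_hom (hM : Charted M q n) (hT : IsPartialT T) (hg : IsEvenPairing g)
    (hh : ContDiff ℝ ∞ h) (h0 : ∀ t, h t ≠ 0) (hc : NondegenerateIn g c)
    (hD : IsLeviCivita (warped q n h g) D) (hD₂ : IsLeviCivita g D₂) {i j : ZMod 2}
    (X : Der M c.dom i) (Y : Der M c.dom j) :
    D.nabla _ (vf (liftDer q n X)) (vf (liftDer q n Y)) =
      fmul (tfun (fun t => h t * deriv h t) (hh.mul (contDiff_deriv hh)) _ *
        pull le_rfl (g c.dom (vf X) (vf Y))) (vf (hT.der (cyl q n c.dom))) +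
      lift q n (D₂.nabla c.dom (vf X) (vf Y)) := by
  have hgw := warped_isEvenPairing (q := q) (n := n) hg hh
  refine eq_of_warped hT hg hh h0 hc ?_ fun k Z => ?_ <;> refine eq_of_two_smul ?_ <;>
    rw [hD.koszul hgw, hgw.add_left, hgw.smul_left, koszul]
  · rw [bracket_liftDer]
    simp only [← lift_vf, hT.warped_lift hg hh, hT.warped_lift' hg hh, hT.bracket_lift,
      hT.bracket_lift', act_zero_right, hgw.zero_left, smul_zero, add_zero, sub_zero,
      warped_lift_lift hg hh, hT.warped_self hg hh, zero_mul, sgn_zero, one_smul, zero_sub]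
    rw [hT.act_tfun_pull hM (hh.pow 2) (contDiff_deriv (hh.pow 2)), mul_neg, mul_one, smul_neg,
      ← smul_mul_assoc, smul_tfun]
    exact congrArg (fun s => -(s * _)) (tfun_congr fun t => deriv_sq hh t)
  · rw [bracket_liftDer, bracket_liftDer, bracket_liftDer]
    simp only [← lift_vf, hT.warped_lift' hg hh, warped_lift_lift hg hh, act_lift_tfun_pull, mul_zero,
      zero_add]
    have e := congrArg (fun s => tfun (fun t => h t ^ 2) (hh.pow 2) (cyl q n c.dom) *
      pull le_rfl s) (hD₂.koszul hg X Y Z)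
    simp only [koszul, map_add, map_sub, map_smul, mul_add (tfun _ _ _), mul_sub (tfun _ _ _),
      mul_smul_comm] at e
    exact e.symm

end WarpedLeviCivita

/-! ### Curvature of connections of warped form. -/

section WarpedCurvature

variable {M : SuperSpace.{u}} {q n : ℕ} {g : Pairing M} {T : VF (lineProd M q n) ⊤}
  {c : SuperChart M q n} {D : AffineConnection (lineProd M q n)} {D₂ : AffineConnection M}
  {a b φ : ℝ → ℝ} {ha : ContDiff ℝ ∞ a} {hb : ContDiff ℝ ∞ b} {hφ : ContDiff ℝ ∞ φ}

/-- The values of a connection on the product on `∂_t` and the lifts of vector fields: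
`D_T T = -T`, `D_T X = a X`, `D_X T = b X` and `D_X Y = φ g(X, Y) T + D₂_X Y`. -/
structure HasWarpedForm (hT : IsPartialT T) (g : Pairing M) (D : AffineConnection (lineProd M q n))
    (D₂ : AffineConnection M) (c : SuperChart M q n) (ha : ContDiff ℝ ∞ a) (hb : ContDiff ℝ ∞ b)
    (hφ : ContDiff ℝ ∞ φ) : Prop where
  time_time : D.nabla _ (vf (hT.der (cyl q n c.dom))) (vf (hT.der (cyl q n c.dom))) =
    -vf (hT.der (cyl q n c.dom))
  time_lift : ∀ X : VF M c.dom, D.nabla _ (vf (hT.der (cyl q n c.dom))) (lift q n X) =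
    fmul (tfun a ha _) (lift q n X)
  lift_time : ∀ X : VF M c.dom, D.nabla _ (lift q n X) (vf (hT.der (cyl q n c.dom))) =
    fmul (tfun b hb _) (lift q n X)
  lift_lift : ∀ X Y : VF M c.dom, D.nabla _ (lift q n X) (lift q n Y) =
    fmul (tfun φ hφ _ * pull le_rfl (g c.dom X Y)) (vf (hT.der (cyl q n c.dom))) +
      lift q n (D₂.nabla c.dom X Y)

variable {hT : IsPartialT T}

theorem neg_eq_smul {N : SuperSpace.{u}} {W : Opens N.carrier} (X : VF N W) : -X = (-1 : ℝ) • X :=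
  (neg_one_smul ℝ X).symm

theorem tfun_mul_pull_comm (f : M.sec c.dom) (ψ : ℝ → ℝ) (hψ : ContDiff ℝ ∞ ψ) :
    tfun φ hφ (cyl q n c.dom) * pull le_rfl f * tfun ψ hψ _ =
      tfun (fun t => φ t * ψ t) (hφ.mul hψ) _ * pull le_rfl f := by
  rw [mul_assoc, ← tfun_comm, ← mul_assoc, tfun_mul]

set_option maxHeartbeats 1000000 in
-- In ∇_T ∇_X Y - ∇_X ∇_T Y the lifted parts a ∇²_X Y cancel. Along T = ∂_t there remain φ' from the
-- Leibniz rule, -φ from ∇_T T = -T, and -a φ from the second term.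
theorem HasWarpedForm.curvature_time_lift (hM : Charted M q n) (hg : IsEvenPairing g)
    (H : HasWarpedForm hT g D D₂ c ha hb hφ) {i j : ZMod 2} (X : Der M c.dom i) (Y : Der M c.dom j)
    {κ : ℝ → ℝ} (hκ : ContDiff ℝ ∞ κ) (e : ∀ t, κ t = deriv φ t - φ t - a t * φ t) :
    curvature D (hT.der (cyl q n c.dom)) (liftDer q n X) (lift q n (vf Y)) =
      fmul (tfun κ hκ _ * pull le_rfl (g c.dom (vf X) (vf Y))) (vf (hT.der (cyl q n c.dom))) := by
  have hu := tfun_pull_mem (q := q) (n := n) hφ (hg.even c.dom X Y)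
  rw [curvature, hT.bracket_lift, D.zero_left, ← lift_vf, H.lift_lift, D.add_right, H.time_lift,
    D.leibniz _ _ _ _ hu, H.time_time, hT.act_tfun_pull hM hφ (contDiff_deriv hφ), H.time_lift, lift_vf,
    D.leibniz _ _ _ _ (tfun_mem a ha _), ← lift_vf, act_lift_tfun, H.lift_lift, neg_eq_smul, fmul_smul,
    fmul_add, zero_fmul, fmul_fmul, ← mul_assoc, tfun_mul, zero_mul, mul_zero, zero_mul, sgn_zero]
  have e' : tfun κ hκ (cyl q n c.dom) = tfun (deriv φ) (contDiff_deriv hφ) _ - tfun φ hφ _ -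
      tfun (fun t => a t * φ t) (ha.mul hφ) _ := by
    rw [sub_tfun, sub_tfun]; exact tfun_congr e
  rw [e', sub_mul, sub_mul, sub_fmul, sub_fmul]
  module

/-- The bracket vanishes, and ∇_X ∇_T T - ∇_T ∇_X T = -b X - (b' + b a) X. -/
theorem HasWarpedForm.curvature_lift_time_time (hM : Charted M q n)
    (H : HasWarpedForm hT g D D₂ c ha hb hφ) {i : ZMod 2} (X : Der M c.dom i)
    {κ : ℝ → ℝ} (hκ : ContDiff ℝ ∞ κ) (e : ∀ t, κ t = b t + deriv b t + b t * a t) :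
    curvature D (liftDer q n X) (hT.der (cyl q n c.dom)) (vf (hT.der (cyl q n c.dom))) =
      (-1 : ℝ) • fmul (tfun κ hκ _) (lift q n (vf X)) := by
  rw [curvature, hT.bracket_lift', D.zero_left, ← lift_vf, H.time_time, neg_eq_smul, D.rsmul_right,
    H.lift_time, D.leibniz _ _ _ _ (tfun_mem b hb _), hT.act_tfun hM _ b hb (contDiff_deriv hb),
    H.time_lift, fmul_fmul, tfun_mul, mul_zero, mul_zero, sgn_zero]
  have e' : tfun κ hκ (cyl q n c.dom) = tfun b hb _ + tfun (deriv b) (contDiff_deriv hb) _ +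
      tfun (fun t => b t * a t) (hb.mul ha) _ := by
    rw [add_tfun, add_tfun]; exact tfun_congr e
  rw [e', add_fmul, add_fmul]
  module

/-- As ∇_X T = b X with b a function of time alone, the curvature is b times the graded
antisymmetrisation of ∇_X Y minus [X,Y]. The ∂_t-part cancels since `g` is graded symmetric, and the
rest since `D₂` is torsion free. -/
theorem HasWarpedForm.curvature_lift_lift_time (hg : IsEvenPairing g) (hD₂ : IsLeviCivita g D₂)
    (H : HasWarpedForm hT g D D₂ c ha hb hφ) {i j : ZMod 2} (X : Der M c.dom i)
    (Y : Der M c.dom j) :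
    curvature D (liftDer q n X) (liftDer q n Y) (vf (hT.der (cyl q n c.dom))) = 0 := by
  have tf : D₂.nabla c.dom (vf X) (vf Y) = sgn (i * j) • D₂.nabla c.dom (vf Y) (vf X) +
      vf (bracket X Y) := by
    have := (sub_eq_zero (G := VF M c.dom)).1 (hD₂.torsion_free c.dom X Y)
    rw [← this]; module
  have hl : ∀ {i j : ZMod 2} (X : Der M c.dom i) (Y : Der M c.dom j),
      D.nabla _ (lift q n (vf X)) (D.nabla _ (lift q n (vf Y)) (vf (hT.der (cyl q n c.dom)))) =
        fmul (tfun b hb _) (fmul (tfun φ hφ _ * pull le_rfl (g c.dom (vf X) (vf Y)))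
          (vf (hT.der (cyl q n c.dom))) + lift q n (D₂.nabla c.dom (vf X) (vf Y))) := fun X Y => by
    rw [H.lift_time, lift_vf X, D.leibniz _ _ _ _ (tfun_mem b hb _), ← lift_vf, act_lift_tfun,
      zero_fmul, zero_add, mul_zero, sgn_zero, one_smul, H.lift_lift]
  rw [curvature, bracket_liftDer, ← lift_vf, ← lift_vf, ← lift_vf, hl, hl, H.lift_time, tf,
    hg.symm c.dom X Y, map_smul, mul_smul_comm, smul_fmul, lift_add, lift_smul]
  simp only [fmul_add, fmul_smul]
  module

set_option maxHeartbeats 1000000 in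
-- The part along ∂_t is φ times the antisymmetrisation of X g(Y,Z) + g(X, ∇²_Y Z), minus
-- g([X,Y],Z); it vanishes because `D₂` is metric and torsion free. The terms with φ b arise when
-- ∇_X hits ∂_t in φ g(Y,Z) ∂_t.
theorem HasWarpedForm.curvature_lift (hg : IsEvenPairing g) (hD₂ : IsLeviCivita g D₂)
    (H : HasWarpedForm hT g D D₂ c ha hb hφ) {i j k : ZMod 2} (X : Der M c.dom i)
    (Y : Der M c.dom j) (Z : Der M c.dom k) {β : ℝ → ℝ} (hβ : ContDiff ℝ ∞ β)
    (e : ∀ t, β t = φ t * b t) :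
    curvature D (liftDer q n X) (liftDer q n Y) (lift q n (vf Z)) =
      lift q n (curvature D₂ X Y (vf Z)) +
      (sgn (i * (j + k)) • fmul (tfun β hβ _ * pull le_rfl (g c.dom (vf Y) (vf Z))) (lift q n (vf X)) -
      sgn (j * k) • fmul (tfun β hβ _ * pull le_rfl (g c.dom (vf X) (vf Z))) (lift q n (vf Y))) := by
  let τ : M.sec c.dom → VF (lineProd M q n) (cyl q n c.dom) := fun f =>
    fmul (tfun φ hφ _ * pull le_rfl f) (vf (hT.der (cyl q n c.dom)))
  have τadd : ∀ f f', τ (f + f') = τ f + τ f' := fun f f' => by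
    simp only [τ, map_add, mul_add, add_fmul]
  have τsmul : ∀ (r : ℝ) f, τ (r • f) = r • τ f := fun r f => by
    simp only [τ, map_smul, mul_smul_comm, smul_fmul]
  have hl : ∀ {i j : ZMod 2} (X : Der M c.dom i) (Y : Der M c.dom j),
      D.nabla _ (lift q n (vf X)) (D.nabla _ (lift q n (vf Y)) (lift q n (vf Z))) =
        τ (act (vf X) (g c.dom (vf Y) (vf Z))) + sgn (i * (j + k)) • fmul (tfun β hβ _ *
          pull le_rfl (g c.dom (vf Y) (vf Z))) (lift q n (vf X)) +
        (τ (g c.dom (vf X) (D₂.nabla c.dom (vf Y) (vf Z))) +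
          lift q n (D₂.nabla c.dom (vf X) (D₂.nabla c.dom (vf Y) (vf Z)))) := fun {i j} X Y => by
    have hu := tfun_pull_mem (q := q) (n := n) hφ (hg.even c.dom Y Z)
    rw [H.lift_lift, D.add_right, H.lift_lift, lift_vf X, D.leibniz _ _ _ _ hu, ← lift_vf,
      H.lift_time, act_lift_tfun_pull, fmul_fmul, tfun_mul_pull_comm,
      tfun_congr (hφ := hβ) (hψ := hφ.mul hb) e]
  have tf : vf (bracket X Y) = D₂.nabla c.dom (vf X) (vf Y) -
      sgn (i * j) • D₂.nabla c.dom (vf Y) (vf X) :=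
    ((sub_eq_zero (G := VF M c.dom)).1 (hD₂.torsion_free c.dom X Y)).symm
  have hb' : D.nabla _ (lift q n (vf (bracket X Y))) (lift q n (vf Z)) =
      τ (g c.dom (vf (bracket X Y)) (vf Z)) + lift q n (D₂.nabla c.dom (vf (bracket X Y)) (vf Z)) :=
    H.lift_lift _ _
  rw [curvature, bracket_liftDer, ← lift_vf, ← lift_vf, ← lift_vf, hl, hl, hb', curvature,
    hD₂.metric c.dom X Y, hD₂.metric c.dom Y X]
  have hgb : g c.dom (vf (bracket X Y)) (vf Z) = g c.dom (D₂.nabla c.dom (vf X) (vf Y)) (vf Z) -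
      sgn (i * j) • g c.dom (D₂.nabla c.dom (vf Y) (vf X)) (vf Z) := by
    rw [tf, hg.sub_left, hg.rsmul_left]
  have hgb' : τ (g c.dom (vf (bracket X Y)) (vf Z)) =
      τ (g c.dom (D₂.nabla c.dom (vf X) (vf Y)) (vf Z)) -
      sgn (i * j) • τ (g c.dom (D₂.nabla c.dom (vf Y) (vf X)) (vf Z)) := by
    rw [hgb, sub_eq_add_neg, ← neg_smul, τadd, τsmul]; module
  rw [hgb', lift_sub, lift_sub, lift_smul]
  simp only [τadd, τsmul, smul_add, smul_smul, sgn_mul_sgn]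
  have e1 : i * j + j * i = 0 := by rw [mul_comm j i, add_self_parity]
  have e2 : i * j + j * (i + k) = j * k := by
    rw [mul_add, ← add_assoc, mul_comm j i, add_self_parity, zero_add]
  rw [e1, e2, sgn_zero]
  module

/-- The semi-symmetric non-metric connection of a warped product. -/
theorem hasWarpedForm (hM : Charted M q n) (hT : IsPartialT T) (hg : IsEvenPairing g) {h : ℝ → ℝ}
    (hh : ContDiff ℝ ∞ h) (h0 : ∀ t, h t ≠ 0) (hc : NondegenerateIn g c)
    {D' : AffineConnection (lineProd M q n)} (hD : IsLeviCivita (warped q n h g) D)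
    (hD₂ : IsLeviCivita g D₂)
    (hD' : ∀ (U : Opens (lineProd M q n).carrier) {i j : ZMod 2} (X : Der (lineProd M q n) U i)
      (Y : Der (lineProd M q n) U j), D'.nabla U (vf X) (vf Y) = D.nabla U (vf X) (vf Y) +
        sgn (i * j) • fmul (warped q n h g U (vf Y) (restr le_top T)) (vf X)) :
    HasWarpedForm hT g D' D₂ c (contDiff_logDeriv hh h0)
      ((contDiff_logDeriv hh h0).sub (contDiff_const (c := 1))) (hh.mul (contDiff_deriv hh)) where
  -- The correction term g(Y, ∂_t) X is zero when Y is a lift and -X when Y = ∂_t. Thus a = h'/h and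
  -- φ = h h' are those of the Levi-Civita connection, and b = h'/h - 1.
  time_time := by
    rw [hD', leviCivita_time_time hT hg hh h0 hc hD, zero_add, mul_zero, sgn_zero, one_smul]
    refine (congrArg (fun s => fmul s (vf (hT.der (cyl q n c.dom)))) (hT.warped_self hg hh)).trans ?_
    rw [neg_fmul, one_fmul]
  time_lift X := by
    induction X using vf_induction with
    | add X Y hX hY => rw [lift_add, D'.add_right, hX, hY, fmul_add]
    | hom i X =>
      rw [lift_vf, hD', leviCivita_time_lift_hom hM hT hg hh h0 hc hD]
      have e : warped q n h g _ (vf (liftDer q n X)) (restr le_top T) = 0 :=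
        hT.warped_lift hg hh (vf X)
      rw [e, zero_fmul, smul_zero, add_zero]
  lift_time X := by
    induction X using vf_induction with
    | add X Y hX hY => rw [lift_add, D'.add_left, hX, hY, fmul_add]
    | hom i X =>
      rw [lift_vf, hD', leviCivita_lift_time_hom hM hT hg hh h0 hc hD]
      have e : warped q n h g (cyl q n c.dom) (vf (hT.der _)) (restr le_top T) = -1 :=
        hT.warped_self hg hh
      rw [e, mul_zero, sgn_zero, one_smul, ← add_fmul, ← sub_eq_add_neg, ← tfun_one, sub_tfun]
  lift_lift X Y := by
    have hgw := warped_isEvenPairing (q := q) (n := n) hg hh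
    induction X using vf_induction with
    | add X X' hX hX' =>
      rw [lift_add, D'.add_left, hX, hX', hg.add_left, map_add, mul_add, add_fmul, D₂.add_left,
        lift_add]
      abel
    | hom i X =>
      induction Y using vf_induction with
      | add Y Y' hY hY' =>
        rw [lift_add, D'.add_right, hY, hY', hg.add_right, map_add, mul_add, add_fmul, D₂.add_right,
          lift_add]
        abel
      | hom j Y =>
        rw [lift_vf, lift_vf, hD', leviCivita_lift_lift_hom hM hT hg hh h0 hc hD hD₂]
        have e : warped q n h g _ (vf (liftDer q n Y)) (restr le_top T) = 0 :=
          hT.warped_lift hg hh (vf Y)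
        rw [e, zero_fmul, smul_zero, add_zero]

end WarpedCurvature

/-! ### The Ricci tensor of connections of warped form. -/

section WarpedRicci

variable {M : SuperSpace.{u}} {q n : ℕ} {g : Pairing M} {T : VF (lineProd M q n) ⊤}
  {c : SuperChart M q n} {D : AffineConnection (lineProd M q n)} {D₂ : AffineConnection M}
  {a b φ : ℝ → ℝ} {ha : ContDiff ℝ ∞ a} {hb : ContDiff ℝ ∞ b} {hφ : ContDiff ℝ ∞ φ}

/-- The superdimension, that is, the supertrace of the identity; it is the source of q - n in the
Einstein equations. -/
theorem sum_sgn_idxPar : ∑ I : Fin q ⊕ Fin n, sgn (idxPar I) = (q : ℝ) - n := by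
  rw [Fintype.sum_sum_type]
  simp [idxPar, sgn]
  ring

theorem idxPar_mul_self (I : Fin q ⊕ Fin n) : idxPar I * idxPar I = idxPar I := by
  rcases parity_cases (idxPar I) with h | h <;> rw [h] <;> rfl

theorem act_frame_coord (c : SuperChart M q n) (I J : Fin q ⊕ Fin n) :
    act (vf (c.frame I)) (c.coord J) = if I = J then 1 else 0 := by
  have h := c.frame_coord (le_refl c.dom) I J
  rwa [M.res_id] at h

theorem eq_sum_frame (c : SuperChart M q n) (X : VF M c.dom) :
    X = ∑ I, fmul (act X (c.coord I)) (vf (c.frame I)) := by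
  have h := vf_eq_sum c le_rfl X
  simp only [M.res_id] at h
  exact h

/-- The supertrace of the term that the warping adds to Z ↦ R(Z,X)Y. The multiple of the identity
contributes q - n, and the rank one operator built from Z ↦ g(Z,Y) X contributes -1. -/
theorem sum_metric_trace (hg : IsEvenPairing g) (c : SuperChart M q n) {i j : ZMod 2}
    (X : Der M c.dom i) (Y : Der M c.dom j) :
    ∑ I : Fin q ⊕ Fin n, sgn (idxPar I * (idxPar I + i + j)) •
      (sgn (idxPar I * (i + j)) • g c.dom (vf X) (vf Y) -
        sgn (i * j) • (g c.dom (vf (c.frame I)) (vf Y) * act (vf X) (c.coord I))) =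
      ((q : ℝ) - n - 1) • g c.dom (vf X) (vf Y) := by
  have e : ∀ I : Fin q ⊕ Fin n, sgn (idxPar I * (idxPar I + i + j)) •
      (sgn (idxPar I * (i + j)) • g c.dom (vf X) (vf Y) -
        sgn (i * j) • (g c.dom (vf (c.frame I)) (vf Y) * act (vf X) (c.coord I))) =
      sgn (idxPar I) • g c.dom (vf X) (vf Y) -
        act (vf X) (c.coord I) * g c.dom (vf (c.frame I)) (vf Y) := fun I => by
    rw [M.supercomm (hg.even c.dom (c.frame I) Y) (act_mem X (c.coord_mem I)), smul_sub, smul_smul,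
      smul_smul, smul_smul, sgn_mul_sgn, sgn_mul_sgn, sgn_mul_sgn]
    have e1 : idxPar I * (idxPar I + i + j) + idxPar I * (i + j) = idxPar I := by
      rw [add_assoc, mul_add, add_assoc, add_self_parity, add_zero, idxPar_mul_self]
    have e2 : idxPar I * (idxPar I + i + j) + i * j + (idxPar I + j) * (i + idxPar I) = 0 := by
      generalize idxPar I = k
      clear e1 X Y
      revert i j k; decide
    rw [e1, e2, sgn_zero, one_smul]
  rw [Finset.sum_congr rfl fun I _ => e I, Finset.sum_sub_distrib, ← Finset.sum_smul, sum_sgn_idxPar]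
  have e3 : ∑ I, act (vf X) (c.coord I) * g c.dom (vf (c.frame I)) (vf Y) = g c.dom (vf X) (vf Y) := by
    conv_rhs => rw [eq_sum_frame c (vf X), hg.sum_left]
    exact Finset.sum_congr rfl fun I _ => (hg.smul_left _ _ _ _).symm
  rw [e3]; module

/-- The Ricci tensor in the chart of the product, as a section over the cylinder. -/
def prodRicci (D : AffineConnection (lineProd M q n)) (c : SuperChart M q n) {i j : ZMod 2}
    (X : Der (lineProd M q n) (cyl q n c.dom) i) (Y : Der (lineProd M q n) (cyl q n c.dom) j) :
    (lineProd M q n).sec (cyl q n c.dom) := ricci D (prodChart c) X Y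

/-- Separates the time index in the trace, and replaces the product frame by ∂_t and lifts. -/
theorem prodRicci_eq (hT : IsPartialT T) (c : SuperChart M q n) {i j : ZMod 2}
    (X : Der (lineProd M q n) (cyl q n c.dom) i) (Y : Der (lineProd M q n) (cyl q n c.dom) j) :
    prodRicci D c X Y =
      (1 / 2 : ℝ) • act (curvature D (hT.der (cyl q n c.dom)) X (vf Y) +
        sgn (i * j) • curvature D (hT.der (cyl q n c.dom)) Y (vf X)) (timeSec _) +
      ∑ I : Fin q ⊕ Fin n, sgn (idxPar I * (idxPar I + i + j)) • (1 / 2 : ℝ) •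
        act (curvature D (liftDer q n (c.frame I)) X (vf Y) +
          sgn (i * j) • curvature D (liftDer q n (c.frame I)) Y (vf X)) (pull le_rfl (c.coord I)) := by
  unfold prodRicci ricci
  refine (sum_prodIdx _).trans (congrArg₂ (· + ·) ?_ (Finset.sum_congr rfl fun I _ => ?_))
  · rw [prodChart_coord_zero]
    have e : ∀ {j : ZMod 2} (X : Der (lineProd M q n) (cyl q n c.dom) j) Z,
        curvature (U := cyl q n c.dom) D ((prodChart c).frame (Sum.inl 0)) X Z =
          curvature D (hT.der (cyl q n c.dom)) X Z := fun X Z =>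
      curvature_congr D rfl rfl (hT.frame_zero c) rfl Z
    have e0 : sgn (idxPar (Sum.inl 0 : Fin (q + 1) ⊕ Fin n) * (idxPar (Sum.inl 0 :
        Fin (q + 1) ⊕ Fin n) + i + j)) = 1 := by rw [idxPar, zero_mul, sgn_zero]
    rw [e0, one_smul]
    refine congrArg (fun Z : VF (lineProd M q n) (cyl q n c.dom) => (1 / 2 : ℝ) • act Z (timeSec _)) ?_
    exact congrArg₂ (fun A B : VF (lineProd M q n) (cyl q n c.dom) => A + sgn (i * j) • B)
      (e X (vf Y)) (e Y (vf X))
  · rw [prodChart_coord_emb]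
    have e0 : sgn (idxPar (emb I) * (idxPar (emb I) + i + j)) =
      sgn (idxPar I * (idxPar I + i + j)) := by rw [idxPar_emb]
    rw [e0]
    have e : ∀ {j : ZMod 2} (X : Der (lineProd M q n) (cyl q n c.dom) j) Z,
        curvature (U := cyl q n c.dom) D ((prodChart c).frame (emb I)) X Z =
          curvature D (liftDer q n (c.frame I)) X Z := fun X Z =>
      curvature_congr D (idxPar_emb I) rfl (prodChart_frame_eq_lift c I) rfl Z
    refine congrArg (fun Z : VF (lineProd M q n) (cyl q n c.dom) =>
      sgn (idxPar I * (idxPar I + i + j)) • (1 / 2 : ℝ) • act Z (pull le_rfl (c.coord I))) ?_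
    exact congrArg₂ (fun A B : VF (lineProd M q n) (cyl q n c.dom) => A + sgn (i * j) • B)
      (e X (vf Y)) (e Y (vf X))

variable {hT : IsPartialT T}

/-- The time index contributes κ g, the lifted indices the Ricci tensor of `D₂` and β times the
trace of `sum_metric_trace`. The two halves of the symmetrisation agree on the multiples of `g`. -/
theorem HasWarpedForm.ricci_lift (hM : Charted M q n) (hg : IsEvenPairing g)
    (hD₂ : IsLeviCivita g D₂) (H : HasWarpedForm hT g D D₂ c ha hb hφ) {i j : ZMod 2}
    (X : Der M c.dom i) (Y : Der M c.dom j) {κ β : ℝ → ℝ} (hκ : ContDiff ℝ ∞ κ)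
    (eκ : ∀ t, κ t = deriv φ t - φ t - a t * φ t) (hβ : ContDiff ℝ ∞ β)
    (eβ : ∀ t, β t = φ t * b t) :
    prodRicci D c (liftDer q n X) (liftDer q n Y) =
      (tfun κ hκ (cyl q n c.dom) + ((q : ℝ) - n - 1) • tfun β hβ (cyl q n c.dom)) *
        pull le_rfl (g c.dom (vf X) (vf Y)) + pull le_rfl (ricci D₂ c X Y) := by
  rw [prodRicci_eq hT]
  have h1 : act (curvature D (hT.der (cyl q n c.dom)) (liftDer q n X) (vf (liftDer q n Y)) +
      sgn (i * j) • curvature D (hT.der (cyl q n c.dom)) (liftDer q n Y) (vf (liftDer q n X)))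
        (timeSec _) = (2 : ℝ) • (tfun κ hκ _ * pull le_rfl (g c.dom (vf X) (vf Y))) := by
    rw [← lift_vf, ← lift_vf, H.curvature_time_lift hM hg X Y hκ eκ,
      H.curvature_time_lift hM hg Y X hκ eκ, act_add_left, act_smul_left, act_fmul, act_fmul,
      hT.act_time, mul_one, mul_one, hg.symm c.dom Y X, map_smul, mul_smul_comm, smul_smul,
      mul_comm j i, sgn_mul_self, one_smul, two_smul]
  have h2 : ∀ {i j : ZMod 2} (X : Der M c.dom i) (Y : Der M c.dom j) (I : Fin q ⊕ Fin n),
      act (curvature D (liftDer q n (c.frame I)) (liftDer q n X) (vf (liftDer q n Y)))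
        (pull le_rfl (c.coord I)) = pull le_rfl (act (curvature D₂ (c.frame I) X (vf Y)) (c.coord I)) +
          tfun β hβ _ * pull le_rfl (sgn (idxPar I * (i + j)) • g c.dom (vf X) (vf Y) -
            sgn (i * j) • (g c.dom (vf (c.frame I)) (vf Y) * act (vf X) (c.coord I))) := by
    intro i j X Y I
    rw [← lift_vf, H.curvature_lift hg hD₂ _ _ _ hβ eβ, act_add_left, act_sub_left, act_smul_left,
      act_smul_left, act_fmul, act_fmul, act_lift_pull, act_lift_pull, act_lift_pull, act_frame_coord,
      if_pos rfl, map_one, mul_one, map_sub, map_smul, map_smul, map_mul, mul_sub, mul_smul_comm,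
      mul_smul_comm, mul_assoc]
  have h3 : ∀ {i j : ZMod 2} (X : Der M c.dom i) (Y : Der M c.dom j),
      ∑ I : Fin q ⊕ Fin n, sgn (idxPar I * (idxPar I + i + j)) • (tfun β hβ (cyl q n c.dom) *
        pull le_rfl (sgn (idxPar I * (i + j)) • g c.dom (vf X) (vf Y) -
            sgn (i * j) • (g c.dom (vf (c.frame I)) (vf Y) * act (vf X) (c.coord I)))) =
        ((q : ℝ) - n - 1) • (tfun β hβ (cyl q n c.dom) * pull le_rfl (g c.dom (vf X) (vf Y))) := by
    intro i j X Y
    rw [← mul_smul_comm, ← map_smul, ← sum_metric_trace hg c X Y, map_sum, Finset.mul_sum]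
    refine Finset.sum_congr rfl fun I _ => ?_
    rw [map_smul, mul_smul_comm]
  rw [h1, smul_smul, add_mul, add_assoc]
  refine congrArg₂ (· + ·) (by norm_num) ?_
  have h4 : ∀ I : Fin q ⊕ Fin n, sgn (idxPar I * (idxPar I + i + j)) • (1 / 2 : ℝ) •
      act (curvature D (liftDer q n (c.frame I)) (liftDer q n X) (vf (liftDer q n Y)) +
        sgn (i * j) • curvature D (liftDer q n (c.frame I)) (liftDer q n Y) (vf (liftDer q n X)))
        (pull le_rfl (c.coord I)) =
      ((1 / 2 : ℝ) • sgn (idxPar I * (idxPar I + i + j)) • (tfun β hβ (cyl q n c.dom) *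
        pull le_rfl (sgn (idxPar I * (i + j)) • g c.dom (vf X) (vf Y) -
            sgn (i * j) • (g c.dom (vf (c.frame I)) (vf Y) * act (vf X) (c.coord I)))) +
      ((1 / 2 : ℝ) * sgn (i * j)) • sgn (idxPar I * (idxPar I + j + i)) • (tfun β hβ (cyl q n c.dom) *
        pull le_rfl (sgn (idxPar I * (j + i)) • g c.dom (vf Y) (vf X) -
            sgn (j * i) • (g c.dom (vf (c.frame I)) (vf X) * act (vf Y) (c.coord I))))) +
      pull le_rfl (sgn (idxPar I * (idxPar I + i + j)) • (1 / 2 : ℝ) •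
        act (curvature D₂ (c.frame I) X (vf Y) +
          sgn (i * j) • curvature D₂ (c.frame I) Y (vf X)) (c.coord I)) := fun I => by
    rw [act_add_left, act_smul_left, h2, h2, act_add_left, act_smul_left, map_smul, map_smul, map_add,
      map_smul, add_right_comm (idxPar I) j i]
    module
  rw [Finset.sum_congr rfl fun I _ => h4 I, Finset.sum_add_distrib, Finset.sum_add_distrib,
    ← Finset.smul_sum, ← Finset.smul_sum, h3, h3, ← map_sum, hg.symm c.dom Y X, map_smul,
    mul_smul_comm, mul_comm j i, smul_mul_assoc, smul_comm _ (sgn (i * j)), ← smul_smul,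
    smul_smul (sgn (i * j)), sgn_mul_self]
  refine congrArg₂ (· + ·) ?_ rfl
  module

theorem curvature_self_even {N : SuperSpace.{u}} {W : Opens N.carrier} (D : AffineConnection N)
    (X : Der N W 0) (Z : VF N W) : curvature D X X Z = 0 := by
  rw [curvature, vf_bracket_self_even, D.zero_left, mul_zero, sgn_zero, one_smul]
  module

/-- The time index contributes R(∂_t,∂_t)∂_t = 0; every lifted index contributes -κ with the sign of
its parity. -/
theorem HasWarpedForm.ricci_time (hM : Charted M q n) (H : HasWarpedForm hT g D D₂ c ha hb hφ)
    {κ : ℝ → ℝ} (hκ : ContDiff ℝ ∞ κ) (e : ∀ t, κ t = b t + deriv b t + b t * a t) :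
    prodRicci D c (hT.der (cyl q n c.dom)) (hT.der (cyl q n c.dom)) =
      (-((q : ℝ) - n)) • tfun κ hκ (cyl q n c.dom) := by
  rw [prodRicci_eq hT]
  have h1 : ∀ I : Fin q ⊕ Fin n, sgn (idxPar I * (idxPar I + 0 + 0)) • (1 / 2 : ℝ) •
      act (curvature D (liftDer q n (c.frame I)) (hT.der (cyl q n c.dom)) (vf (hT.der _)) +
        sgn (0 * 0) • curvature D (liftDer q n (c.frame I)) (hT.der _) (vf (hT.der _)))
          (pull le_rfl (c.coord I)) = sgn (idxPar I) • (-1 : ℝ) • tfun κ hκ (cyl q n c.dom) := fun I => by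
    rw [H.curvature_lift_time_time hM _ hκ e, add_zero, add_zero, idxPar_mul_self, mul_zero, sgn_zero]
    simp only [act_add_left, act_smul_left, act_fmul, act_lift_pull, act_frame_coord, if_true, map_one,
      mul_one]
    module
  rw [Finset.sum_congr rfl fun I _ => h1 I, ← Finset.sum_smul, sum_sgn_idxPar, curvature_self_even,
    smul_zero, add_zero]
  have h0 : act (0 : VF (lineProd M q n) (cyl q n c.dom)) (timeSec _) = 0 := rfl
  rw [h0]
  module

/-- Every term of the trace vanishes: R(∂_t,X)∂_t is a multiple of X and has no ∂_t-component,
R(∂_I,∂_t)X is a multiple of ∂_t and has no ∂_I-component, and R(∂_I,X)∂_t = 0. -/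
theorem HasWarpedForm.ricci_time_lift (hM : Charted M q n) (hg : IsEvenPairing g)
    (hD₂ : IsLeviCivita g D₂) (H : HasWarpedForm hT g D D₂ c ha hb hφ) {i : ZMod 2}
    (X : Der M c.dom i) {κ κ' : ℝ → ℝ} (hκ : ContDiff ℝ ∞ κ)
    (eκ : ∀ t, κ t = deriv φ t - φ t - a t * φ t) (hκ' : ContDiff ℝ ∞ κ')
    (eκ' : ∀ t, κ' t = b t + deriv b t + b t * a t) :
    prodRicci D c (hT.der (cyl q n c.dom)) (liftDer q n X) = 0 := by
  rw [prodRicci_eq hT]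
  have h1 : act (curvature D (hT.der (cyl q n c.dom)) (hT.der (cyl q n c.dom)) (vf (liftDer q n X)) +
      sgn (0 * i) • curvature D (hT.der (cyl q n c.dom)) (liftDer q n X)
        (vf (hT.der (cyl q n c.dom)))) (timeSec _) = 0 := by
    rw [curvature_self_even, curvature_antisymm D (liftDer q n X),
      H.curvature_lift_time_time hM _ hκ' eκ', neg_eq_smul, act_add_left, act_smul_left, act_smul_left,
      act_smul_left, act_smul_left, act_fmul, act_lift_time]
    simp only [mul_zero, smul_zero, add_zero]
    rfl
  have h2 : ∀ I : Fin q ⊕ Fin n,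
      act (curvature D (liftDer q n (c.frame I)) (hT.der (cyl q n c.dom)) (vf (liftDer q n X)) +
        sgn (0 * i) • curvature D (liftDer q n (c.frame I)) (liftDer q n X)
          (vf (hT.der (cyl q n c.dom)))) (pull le_rfl (c.coord I)) = 0 := fun I => by
    rw [H.curvature_lift_lift_time hg hD₂, smul_zero, add_zero, curvature_antisymm D (hT.der _),
      ← lift_vf, H.curvature_time_lift hM hg _ _ hκ eκ, neg_eq_smul, act_smul_left, act_smul_left,
      act_fmul, hT.act_pull, mul_zero, smul_zero, smul_zero]
  rw [h1, smul_zero, zero_add]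
  exact Finset.sum_eq_zero fun I _ => by rw [h2, smul_zero, smul_zero]

end WarpedRicci

/-! ### Tensoriality and chart independence of the Ricci tensor. -/

section RicciTensor

variable {M : SuperSpace.{u}} {q n : ℕ} {U V : Opens M.carrier} (D : AffineConnection M)

theorem restr_curvature (h : V ≤ U) {i j : ZMod 2} (X : Der M U i) (Y : Der M U j) (Z : VF M U) :
    restr h (curvature D X Y Z) = curvature D (drestr h X) (drestr h Y) (restr h Z) := by
  simp only [curvature, restr_sub, restr_smul, D.res]
  rfl

theorem curvature_add_left {i j : ZMod 2} (X X' : Der M U i) (Y : Der M U j) (Z : VF M U) :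
    curvature D (X + X') Y Z = curvature D X Y Z + curvature D X' Y Z := by
  simp only [curvature, vf_add, vf_bracket_add_left, D.add_left, D.add_right, smul_add]
  module

theorem curvature_add_right {i j : ZMod 2} (X : Der M U i) (Y : Der M U j) (Z Z' : VF M U) :
    curvature D X Y (Z + Z') = curvature D X Y Z + curvature D X Y Z' := by
  simp only [curvature, D.add_right, smul_add]
  module

theorem curvature_add_mid {i j : ZMod 2} (X : Der M U i) (Y Y' : Der M U j) (Z : VF M U) :
    curvature D X (Y + Y') Z = curvature D X Y Z + curvature D X Y' Z := by
  rw [curvature_antisymm D (Y + Y'), curvature_antisymm D Y, curvature_antisymm D Y',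
    curvature_add_left]
  module

/-- The derivative of `f` from the Leibniz rule for ∇_Y cancels the one from the bracket [f X, Y].
-/
theorem curvature_dmul_left {i j l : ZMod 2} {f : M.sec U} (hf : f ∈ M.par U l) (X : Der M U i)
    (Y : Der M U j) (Z : VF M U) :
    curvature D (dmul f hf X) Y Z = fmul f (curvature D X Y Z) := by
  have e : fmul f (vf (bracket X Y)) - sgn ((l + i) * j) • fmul (act (vf Y) f) (vf X) =
      fmul f (vf (bracket X Y)) + (-sgn ((l + i) * j)) • fmul (act (vf Y) f) (vf X) := by module
  rw [curvature, curvature, vf_bracket_dmul_left, e, vf_dmul, D.smul_left, D.smul_left,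
    D.leibniz U Y f _ hf, D.add_left, D.rsmul_left, D.smul_left, D.smul_left, fmul_sub, fmul_sub,
    fmul_smul, smul_add, smul_smul, sgn_mul_sgn]
  have : (l + i) * j + j * l = i * j := by
    rw [add_mul, mul_comm j l, add_right_comm, add_self_parity, zero_add]
  rw [this]
  module

theorem curvature_dmul_mid {i j l : ZMod 2} {f : M.sec U} (hf : f ∈ M.par U l) (X : Der M U i)
    (Y : Der M U j) (Z : VF M U) :
    curvature D X (dmul f hf Y) Z = sgn (i * l) • fmul f (curvature D X Y Z) := by
  rw [curvature_antisymm D (dmul f hf Y), curvature_dmul_left, curvature_antisymm D Y, neg_eq_smul,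
    neg_eq_smul, fmul_smul, fmul_smul]
  rcases parity_cases i with rfl | rfl <;> rcases parity_cases j with rfl | rfl <;>
    rcases parity_cases l with rfl | rfl <;> simp [sgn, add_self_parity] <;> module

set_option maxHeartbeats 1000000 in
theorem curvature_fmul_right {i j l : ZMod 2} {f : M.sec U} (hf : f ∈ M.par U l) (X : Der M U i)
    (Y : Der M U j) (Z : VF M U) :
    curvature D X Y (fmul f Z) = sgn ((i + j) * l) • fmul f (curvature D X Y Z) := by
  have hb : act (vf (bracket X Y)) f =
      act (vf X) (act (vf Y) f) - sgn (i * j) • act (vf Y) (act (vf X) f) := rfl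
  rw [curvature, curvature, D.leibniz U Y f Z hf, D.leibniz U X f Z hf, D.leibniz U _ f Z hf,
    D.add_right, D.add_right, D.rsmul_right, D.rsmul_right, D.leibniz U X _ _ (act_mem Y hf),
    D.leibniz U Y _ _ (act_mem X hf), D.leibniz U X f _ hf, D.leibniz U Y f _ hf, hb, sub_fmul,
    smul_fmul, fmul_sub, fmul_sub, fmul_smul]
  rcases parity_cases i with rfl | rfl <;> rcases parity_cases j with rfl | rfl <;>
    rcases parity_cases l with rfl | rfl <;> simp [sgn, add_self_parity] <;> module

theorem curvature_mem {i j k : ZMod 2} (X : Der M U i) (Y : Der M U j) (Z : Der M U k) :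
    (curvature D X Y (vf Z)).1 ∈ Der M U (i + j + k) := by
  have h1 := D.degree U X (D.dnabla Y Z)
  have h2 := D.degree U Y (D.dnabla X Z)
  have h3 := D.degree U (bracket X Y) Z
  rw [← add_assoc] at h1 h2
  rw [add_comm j i] at h2
  exact Submodule.sub_mem _ (Submodule.sub_mem _ h1 (Submodule.smul_mem _ _ h2)) h3

/-- The operator `Z ↦ R(Z, X) Y` on all vector fields. -/
def curvatureOp {i : ZMod 2} (X : Der M U i) (Y Z : VF M U) : VF M U :=
  curvature D (evenPart Z) X Y + curvature D (oddPart Z) X Y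

theorem curvature_zero_left {i j : ZMod 2} (Y : Der M U j) (Z : VF M U) :
    curvature D (0 : Der M U i) Y Z = 0 := by
  have := curvature_add_left D (0 : Der M U i) 0 Y Z
  rwa [add_zero, left_eq_add] at this

theorem curvatureOp_vf {i k : ZMod 2} (X : Der M U i) (Y : VF M U) (Z : Der M U k) :
    curvatureOp D X Y (vf Z) = curvature D Z X Y := by
  rcases parity_cases k with rfl | rfl
  · rw [curvatureOp, evenPart_vf_zero, oddPart_vf_zero, curvature_zero_left, add_zero]
  · rw [curvatureOp, evenPart_vf_one, oddPart_vf_one, curvature_zero_left, zero_add]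

theorem curvatureOp_add {i : ZMod 2} (X : Der M U i) (Y Z Z' : VF M U) :
    curvatureOp D X Y (Z + Z') = curvatureOp D X Y Z + curvatureOp D X Y Z' := by
  rw [curvatureOp, evenPart_add, oddPart_add, curvature_add_left, curvature_add_left, curvatureOp,
    curvatureOp]
  abel

theorem curvatureOp_fmul {i : ZMod 2} (X : Der M U i) (Y : VF M U) (f : M.sec U) (Z : VF M U) :
    curvatureOp D X Y (fmul f Z) = fmul f (curvatureOp D X Y Z) := by
  induction Z using vf_induction with
  | add Z Z' h h' => rw [fmul_add, curvatureOp_add, h, h', curvatureOp_add, fmul_add]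
  | hom k Z =>
    induction f using sec_induction with
    | add f f' h h' => rw [add_fmul, curvatureOp_add, h, h', add_fmul]
    | hom l f hf => rw [← vf_dmul f hf, curvatureOp_vf, curvatureOp_vf, curvature_dmul_left]

variable {D}

theorem map_sum_fmul {A : VF M U → VF M U} (hadd : ∀ Z Z', A (Z + Z') = A Z + A Z')
    (hf : ∀ f Z, A (fmul f Z) = fmul f (A Z)) {ι : Type*} (s : Finset ι) (f : ι → M.sec U)
    (Z : ι → VF M U) : A (∑ i ∈ s, fmul (f i) (Z i)) = ∑ i ∈ s, fmul (f i) (A (Z i)) :=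
  (map_sum (AddMonoidHom.mk' A hadd) (fun i => fmul (f i) (Z i)) s).trans
    (Finset.sum_congr rfl fun i _ => hf (f i) (Z i))

/-- The supertrace of an operator on vector fields does not depend on the chart. -/
theorem supertrace_eq (c c' : SuperChart M q n) (hc : U ≤ c.dom) (hc' : U ≤ c'.dom)
    {A : VF M U → VF M U} (hadd : ∀ Z Z', A (Z + Z') = A Z + A Z')
    (hf : ∀ f Z, A (fmul f Z) = fmul f (A Z)) (p : ZMod 2)
    (hA : ∀ k (Z : Der M U k), (A (vf Z)).1 ∈ Der M U (k + p)) :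
    ∑ I, sgn (idxPar I * (idxPar I + p)) •
        act (A (vf (drestr hc (c.frame I)))) (M.res hc (c.coord I)) =
      ∑ I, sgn (idxPar I * (idxPar I + p)) •
        act (A (vf (drestr hc' (c'.frame I)))) (M.res hc' (c'.coord I)) := by
  let J : Fin q ⊕ Fin n → Fin q ⊕ Fin n → M.sec U := fun I K =>
    act (vf (drestr hc (c.frame I))) (M.res hc' (c'.coord K))
  let J' : Fin q ⊕ Fin n → Fin q ⊕ Fin n → M.sec U := fun K I =>
    act (vf (drestr hc' (c'.frame K))) (M.res hc (c.coord I))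
  let B : Fin q ⊕ Fin n → Fin q ⊕ Fin n → M.sec U := fun K L =>
    act (A (vf (drestr hc' (c'.frame K)))) (M.res hc' (c'.coord L))
  -- The two Jacobian matrices are inverse to each other.
  have hJJ : ∀ K L, ∑ I, J' K I * J I L = if K = L then 1 else 0 := fun K L => by
    have h1 := vf_eq_sum c hc (vf (drestr hc' (c'.frame K)))
    have h2 := congrArg (fun Z => act Z (M.res hc' (c'.coord L))) h1
    simp only [act_sum, act_fmul] at h2
    rw [← h2]
    exact c'.frame_coord hc' K L
  have h1 : ∀ I, act (A (vf (drestr hc (c.frame I)))) (M.res hc (c.coord I)) =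
      ∑ K, ∑ L, J I K * (B K L * J' L I) := fun I => by
    rw [vf_eq_sum c' hc' (vf (drestr hc (c.frame I))), map_sum_fmul hadd hf, act_sum]
    refine Finset.sum_congr rfl fun K _ => ?_
    rw [act_fmul, vf_eq_sum c' hc' (A (vf (drestr hc' (c'.frame K)))), act_sum, Finset.mul_sum]
    refine Finset.sum_congr rfl fun L _ => ?_
    rw [act_fmul]
  -- Moving `J'` to the front by graded commutativity produces exactly the sign that turns the
  -- weight of `I` into the weight of `L`. Then `hJJ` applies and leaves the diagonal of `B`.
  have h2 : ∀ I K L, sgn (idxPar I * (idxPar I + p)) • (J I K * (B K L * J' L I)) =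
      sgn (idxPar L * (idxPar L + p)) • ((J' L I * J I K) * B K L) := fun I K L => by
    have m1 : J I K ∈ M.par U (idxPar I + idxPar K) :=
      act_mem (drestr hc (c.frame I)) (M.res_mem hc' (c'.coord_mem K))
    have m2 : J' L I ∈ M.par U (idxPar L + idxPar I) :=
      act_mem (drestr hc' (c'.frame L)) (M.res_mem hc (c.coord_mem I))
    have m3 : B K L ∈ M.par U (idxPar K + p + idxPar L) :=
      act_mem ⟨_, hA _ (drestr hc' (c'.frame K))⟩ (M.res_mem hc' (c'.coord_mem L))
    rw [← mul_assoc, M.supercomm (M.mul_mem m1 m3) m2, ← mul_assoc, smul_smul, sgn_mul_sgn]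
    refine congrArg (fun r => sgn r • _) ?_
    generalize idxPar I = x
    generalize idxPar K = y
    generalize idxPar L = z
    clear m1 m2 m3 hA
    revert p x y z
    decide
  rw [Finset.sum_congr rfl fun I _ => by rw [h1 I]]
  simp only [Finset.smul_sum, h2]
  rw [Finset.sum_comm, Finset.sum_congr rfl fun K _ => Finset.sum_comm, Finset.sum_comm]
  refine Finset.sum_congr rfl fun L _ => ?_
  simp only [← Finset.smul_sum, ← Finset.sum_mul, hJJ]
  simp only [ite_mul, one_mul, zero_mul, Finset.sum_ite_eq, Finset.mem_univ, if_true]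
  rfl

variable (D)

/-- The Ricci tensor on an open subset of the domain of a chart. -/
def ricciOn (c : SuperChart M q n) (hU : U ≤ c.dom) {i j : ZMod 2} (X : Der M U i) (Y : Der M U j) :
    M.sec U :=
  ∑ I : Fin q ⊕ Fin n, sgn (idxPar I * (idxPar I + i + j)) • (1 / 2 : ℝ) •
    act (curvature D (drestr hU (c.frame I)) X (vf Y) +
      sgn (i * j) • curvature D (drestr hU (c.frame I)) Y (vf X)) (M.res hU (c.coord I))

theorem res_ricci (c : SuperChart M q n) (hU : U ≤ c.dom) {i j : ZMod 2} (X : Der M c.dom i)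
    (Y : Der M c.dom j) :
    M.res hU (ricci D c X Y) = ricciOn D c hU (drestr hU X) (drestr hU Y) := by
  rw [ricci, map_sum, ricciOn]
  refine Finset.sum_congr rfl fun I _ => ?_
  rw [map_smul, map_smul, res_act, restr_add, restr_smul, restr_curvature, restr_curvature, restr_vf,
    restr_vf]

/-- For fixed X and Y this is the supertrace of the operator Z ↦ ½(R(Z,X)Y ± R(Z,Y)X), which is
linear over the sections. -/
theorem ricciOn_eq (c c' : SuperChart M q n) (hc : U ≤ c.dom) (hc' : U ≤ c'.dom) {i j : ZMod 2}
    (X : Der M U i) (Y : Der M U j) : ricciOn D c hc X Y = ricciOn D c' hc' X Y := by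
  have key : ∀ (c : SuperChart M q n) (hc : U ≤ c.dom), ricciOn D c hc X Y =
      ∑ I : Fin q ⊕ Fin n, sgn (idxPar I * (idxPar I + (i + j))) •
        act ((1 / 2 : ℝ) • (curvatureOp D X (vf Y) (vf (drestr hc (c.frame I))) +
          sgn (i * j) • curvatureOp D Y (vf X) (vf (drestr hc (c.frame I))))) (M.res hc (c.coord I)) := by
    intro c hc
    refine Finset.sum_congr rfl fun I _ => ?_
    rw [curvatureOp_vf, curvatureOp_vf, ← act_smul_left, add_assoc]
  rw [key c hc, key c' hc']
  refine supertrace_eq c c' hc hc' (A := fun Z => (1 / 2 : ℝ) • (curvatureOp D X (vf Y) Z +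
    sgn (i * j) • curvatureOp D Y (vf X) Z)) (fun Z Z' => ?_) (fun f Z => ?_) (i + j) fun k Z => ?_
  · rw [curvatureOp_add, curvatureOp_add]; module
  · rw [curvatureOp_fmul, curvatureOp_fmul, fmul_smul, fmul_add, fmul_smul]
  · rw [curvatureOp_vf, curvatureOp_vf]
    have h1 := curvature_mem D Z X Y
    have h2 := curvature_mem D Z Y X
    rw [add_assoc] at h1 h2
    rw [add_comm j i] at h2
    exact Submodule.smul_mem _ _ (Submodule.add_mem _ h1 (Submodule.smul_mem _ _ h2))

theorem ricciOn_symm (c : SuperChart M q n) (hc : U ≤ c.dom) {i j : ZMod 2}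
    (X : Der M U i) (Y : Der M U j) :
    ricciOn D c hc X Y = sgn (i * j) • ricciOn D c hc Y X := by
  rw [ricciOn, ricciOn, Finset.smul_sum]
  refine Finset.sum_congr rfl fun I _ => ?_
  rw [act_add_left, act_add_left, act_smul_left, act_smul_left, add_right_comm (idxPar I) j i,
    mul_comm j i]
  rcases parity_cases (i * j) with h | h <;> rw [h] <;> simp only [sgn, if_true, one_ne_zero, if_false]
    <;> module

theorem ricciOn_add_left (c : SuperChart M q n) (hc : U ≤ c.dom) {i j : ZMod 2}
    (X X' : Der M U i) (Y : Der M U j) :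
    ricciOn D c hc (X + X') Y = ricciOn D c hc X Y + ricciOn D c hc X' Y := by
  rw [ricciOn, ricciOn, ricciOn, ← Finset.sum_add_distrib]
  refine Finset.sum_congr rfl fun I _ => ?_
  rw [curvature_add_mid, vf_add, curvature_add_right]
  simp only [act_add_left, act_smul_left]
  module

theorem ricciOn_dmul_left (c : SuperChart M q n) (hc : U ≤ c.dom) {i j l : ZMod 2} {f : M.sec U}
    (hf : f ∈ M.par U l) (X : Der M U i) (Y : Der M U j) :
    ricciOn D c hc (dmul f hf X) Y = f * ricciOn D c hc X Y := by
  rw [ricciOn, ricciOn, Finset.mul_sum]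
  refine Finset.sum_congr rfl fun I _ => ?_
  rw [curvature_dmul_mid, vf_dmul, curvature_fmul_right _ hf]
  simp only [act_add_left, act_smul_left, act_fmul, mul_smul_comm, mul_add, smul_add, smul_smul,
    sgn_mul_sgn]
  generalize act (curvature D (drestr hc (c.frame I)) X (vf Y)) (M.res hc (c.coord I)) = A
  generalize act (curvature D (drestr hc (c.frame I)) Y (vf X)) (M.res hc (c.coord I)) = B
  generalize idxPar I = k
  rcases parity_cases i with rfl | rfl <;> rcases parity_cases j with rfl | rfl <;>
    rcases parity_cases l with rfl | rfl <;> rcases parity_cases k with rfl | rfl <;>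
    simp [sgn, add_self_parity]

/-- The Einstein condition can be checked on the natural frames of an atlas. -/
theorem isEinstein_of_frame {g : Pairing M} (hg : IsEvenPairing g) {k : ℝ} {ι : Type*}
    (C : ι → SuperChart M q n) (hC : ∀ x, ∃ i, x ∈ (C i).dom)
    (h : ∀ i I J, ricci D (C i) ((C i).frame I) ((C i).frame J) =
      k • g (C i).dom (vf ((C i).frame I)) (vf ((C i).frame J))) : IsEinstein q n g D k := by
  have loc : ∀ (a : ι) (U : Opens M.carrier) (hU : U ≤ (C a).dom) {i j : ZMod 2} (X : Der M U i)
      (Y : Der M U j), ricciOn D (C a) hU X Y = k • g U (vf X) (vf Y) := by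
    intro a U hU
    -- Linearity extends the equation from the frame to all first arguments. Graded symmetry then
    -- exchanges the arguments, so that the step can be applied a second time.
    have step : ∀ {j : ZMod 2} (Y : Der M U j), (∀ I, ricciOn D (C a) hU
        (drestr hU ((C a).frame I)) Y = k • g U (vf (drestr hU ((C a).frame I))) (vf Y)) →
        ∀ {i : ZMod 2} (X : Der M U i), ricciOn D (C a) hU X Y = k • g U (vf X) (vf Y) := by
      intro j Y hY i X
      induction X using der_induction_frame (C a) hU with
      | zero i =>
        have := ricciOn_add_left D (C a) hU (0 : Der M U i) 0 Y
        rw [add_zero, left_eq_add] at this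
        rw [this, vf_zero, hg.zero_left, smul_zero]
      | add i X X' hX hX' => rw [ricciOn_add_left, hX, hX', vf_add, hg.add_left, smul_add]
      | frame l I f hf => rw [ricciOn_dmul_left, hY, vf_dmul, hg.smul_left, mul_smul_comm]
    intro i j X Y
    refine step Y (fun I => ?_) X
    rw [ricciOn_symm, step _ (fun J => ?_) Y, hg.symm U _ Y, smul_comm]
    have := congrArg (M.res hU) (h a J I)
    rw [res_ricci, map_smul, hg.res] at this
    exact this
  intro c i j X Y
  -- An arbitrary chart is compared with the atlas on overlaps, where `ricciOn_eq` makes the Ricci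
  -- tensors coincide.
  refine sec_ext_cover (fun a => (C a).dom) (fun x _ => hC x) fun a => ?_
  rw [res_ricci, ricciOn_eq D c (C a) inf_le_left inf_le_right, loc, map_smul, hg.res]
  rfl

end RicciTensor

/-! ### The semi-symmetric connection; non-vanishing of the metric. -/

section SemiSymmetric

variable {M : SuperSpace.{u}} {U : Opens M.carrier}

theorem rmul_fmul (f : M.sec U) (X : VF M U) (s : M.sec U) :
    rmul (fmul f X) s = fmul f (rmul X s) := by
  induction X using vf_induction with
  | add X Y hX hY => rw [fmul_add, add_rmul, hX, hY, add_rmul, fmul_add]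
  | hom i X =>
    induction f using sec_induction with
    | add f f' hf hf' => rw [add_fmul, add_rmul, hf, hf', add_fmul]
    | hom l f hf =>
      induction s using sec_induction with
      | add s s' hs hs' => rw [rmul_add, hs, hs', rmul_add, fmul_add]
      | hom m s hs =>
        rw [← vf_dmul f hf, rmul_hom _ hs, rmul_hom _ hs, vf_dmul, fmul_fmul, fmul_smul, fmul_fmul,
          supercomm_fmul hs hf, smul_smul, sgn_mul_sgn]
        have : (l + i) * m + m * l = i * m := by
          rw [add_mul, mul_comm m l, add_right_comm, add_self_parity, zero_add]
        rw [this]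

theorem rmul_mul {i l : ZMod 2} (X : Der M U i) {f : M.sec U} (hf : f ∈ M.par U l) (s : M.sec U) :
    rmul (vf X) (f * s) = sgn (i * l) • fmul f (rmul (vf X) s) := by
  induction s using sec_induction with
  | add s s' hs hs' => rw [mul_add, rmul_add, hs, hs', rmul_add, fmul_add, smul_add]
  | hom m s hs =>
    rw [rmul_hom _ (M.mul_mem hf hs), rmul_hom _ hs, fmul_smul, fmul_fmul, smul_smul, sgn_mul_sgn,
      mul_add]

/-- The connection `D_X Y + (-1)^{|X||Y|} g(Y, P) X`. -/
def semiSymmetric {g : Pairing M} (hg : IsEvenPairing g) (D : AffineConnection M)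
    (P : Der M ⊤ 0) : AffineConnection M where
  nabla U X Y := D.nabla U X Y + rmul X (g U Y (restr le_top (vf P)))
  res h X Y := by rw [restr_add, D.res, restr_rmul, hg.res, restr_restr]
  degree U i j X Y := by
    rw [restr_vf, rmul_hom X (hg.even U Y _)]
    exact Submodule.add_mem _ (D.degree U X Y)
      (Submodule.smul_mem _ _ (fmul_mem (by ring) (hg.even U Y _) X.2))
  add_left U X Y Z := by rw [D.add_left, add_rmul]; abel
  add_right U X Y Z := by rw [D.add_right, hg.add_left, rmul_add]; abel
  smul_left U f X Y := by rw [D.smul_left, rmul_fmul, fmul_add]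
  leibniz U i j X f Y hf := by
    rw [D.leibniz U X f Y hf, hg.smul_left, rmul_mul X hf, fmul_add, smul_add, add_assoc]

theorem semiSymmetric_apply {g : Pairing M} (hg : IsEvenPairing g) (D : AffineConnection M)
    (P : Der M ⊤ 0) {i j : ZMod 2} (X : Der M U i) (Y : Der M U j) :
    (semiSymmetric hg D P).nabla U (vf X) (vf Y) = D.nabla U (vf X) (vf Y) +
      sgn (i * j) • fmul (g U (vf Y) (restr le_top (vf P))) (vf X) := by
  have h := hg.even U Y (drestr le_top P)
  rw [add_zero] at h
  exact congrArg (_ + ·) (rmul_hom X h)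

variable {q n : ℕ}

theorem ricci_symm (D : AffineConnection M) (c : SuperChart M q n) {i j : ZMod 2}
    (X : Der M c.dom i) (Y : Der M c.dom j) : ricci D c X Y = sgn (i * j) • ricci D c Y X := by
  have h1 := res_ricci D c le_rfl X Y
  have h2 := res_ricci D c le_rfl Y X
  rw [M.res_id] at h1 h2
  rw [h1, h2]
  exact ricciOn_symm D c le_rfl X Y

/-- Evaluation at the point `x` separates constants. -/
theorem algebraMap_sec_injective (c : SuperChart M q n) {x : M.carrier} (hx : x ∈ c.dom) :
    Function.Injective (algebraMap ℝ (M.sec c.dom)) := by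
  have hy : c.map x ∈ c.map.target ∧ c.map.symm (c.map x) ∈ c.dom :=
    ⟨c.map.map_source hx, c.map.map_target (c.map.map_source hx)⟩
  intro r s h
  have h1 := congrArg (evalAt c c.dom (c.map x) hy) h
  rw [AlgHom.commutes, AlgHom.commutes] at h1
  exact (algebraMap ℝ (Grassmann n)).injective h1

/-- A zero Gram matrix with at least one row cannot be invertible over a ring in which 0 ≠ 1, and
evaluation at `x` shows that the sections form such a ring. -/
theorem exists_metric_ne_zero {g : Pairing M} {c : SuperChart M q n} (hc : NondegenerateIn g c)
    {x : M.carrier} (hx : x ∈ c.dom) (hqn : 0 < q + n) :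
    ∃ I J, g c.dom (vf (c.frame I)) (vf (c.frame J)) ≠ 0 := by
  by_contra! h0
  obtain ⟨B, hB, -⟩ := hc
  have : Nonempty (Fin q ⊕ Fin n) := by
    rw [← Fintype.card_pos_iff]; simpa using hqn
  obtain ⟨I⟩ := this
  have h1 := hB I I
  simp only [h0, zero_mul, Finset.sum_const_zero, if_true] at h1
  have h2 : algebraMap ℝ (M.sec c.dom) 0 = algebraMap ℝ (M.sec c.dom) 1 := by
    rw [map_zero, map_one]; exact h1
  exact zero_ne_one (algebraMap_sec_injective c hx h2)

end SemiSymmetric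

/-! ### The Einstein equation on lifts and on ∂_t. -/

section WarpedEinstein

variable {M : SuperSpace.{u}} {q n : ℕ} {g : Pairing M} {T : VF (lineProd M q n) ⊤}
  {c : SuperChart M q n} {D D' : AffineConnection (lineProd M q n)} {D₂ : AffineConnection M}
  {h : ℝ → ℝ}

theorem deriv_logDeriv (hh : ContDiff ℝ ∞ h) (h0 : ∀ t, h t ≠ 0) (t : ℝ) :
    deriv (fun t => deriv h t / h t - 1) t =
      deriv (deriv h) t / h t - (deriv h t / h t) ^ 2 := by
  have d1 := ((contDiff_deriv hh).differentiable (by simp) t).hasDerivAt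
  have d0 := (hh.differentiable (by simp) t).hasDerivAt
  rw [((d1.fun_div d0 (h0 t)).sub_const 1).deriv]
  field_simp [h0 t]

theorem deriv_mul_deriv (hh : ContDiff ℝ ∞ h) (t : ℝ) :
    deriv (fun t => h t * deriv h t) t = deriv h t * deriv h t + h t * deriv (deriv h) t := by
  have d1 := ((contDiff_deriv hh).differentiable (by simp) t).hasDerivAt
  have d0 := (hh.differentiable (by simp) t).hasDerivAt
  exact (d0.fun_mul d1).deriv

/-- The Einstein equation of a warped product on the lifts of vector fields. -/
theorem prodRicci_lift_eq_iff (hM : Charted M q n) (hT : IsPartialT T) (hg : IsEvenPairing g)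
    (hh : ContDiff ℝ ∞ h) (h0 : ∀ t, h t ≠ 0) (hc : NondegenerateIn g c)
    (hD : IsLeviCivita (warped q n h g) D) (hD₂ : IsLeviCivita g D₂)
    (hD' : ∀ (U : Opens (lineProd M q n).carrier) {i j : ZMod 2} (X : Der (lineProd M q n) U i)
      (Y : Der (lineProd M q n) U j), D'.nabla U (vf X) (vf Y) = D.nabla U (vf X) (vf Y) +
        sgn (i * j) • fmul (warped q n h g U (vf Y) (restr le_top T)) (vf X))
    (lam : ℝ) {i j : ZMod 2} (X : Der M c.dom i) (Y : Der M c.dom j) :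
    prodRicci D' c (liftDer q n X) (liftDer q n Y) =
        lam • warped q n h g _ (vf (liftDer q n X)) (vf (liftDer q n Y)) ↔
      ∀ t, ricci D₂ c X Y = (lam * h t ^ 2 - deriv (deriv h) t * h t -
        ((q : ℝ) - n - 1) * deriv h t ^ 2 + ((q : ℝ) - n) * h t * deriv h t) •
          g c.dom (vf X) (vf Y) := by
  have hh' := contDiff_deriv hh
  have H := hasWarpedForm hM hT hg hh h0 hc hD hD₂ hD'
  -- For φ = h h', a = h'/h and b = h'/h - 1, this function is φ' - φ - a φ, and the next one is φ
  -- b.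
  have hκ : ContDiff ℝ ∞ fun t => h t * deriv (deriv h) t - h t * deriv h t :=
    (hh.mul (contDiff_deriv hh')).sub (hh.mul hh')
  have hβ : ContDiff ℝ ∞ fun t => deriv h t ^ 2 - h t * deriv h t := (hh'.pow 2).sub (hh.mul hh')
  rw [H.ricci_lift hM hg hD₂ X Y hκ (fun t => by
      rw [deriv_mul_deriv hh]; field_simp [h0 t]; ring) hβ (fun t => by field_simp [h0 t]),
    ← lift_vf, ← lift_vf, warped_lift_lift hg hh]
  -- All slices of the cylinder are the domain of `c`, so at each time the equation becomes one
  -- between sections over `c.dom`, in which `t` enters through real coefficients.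
  have ev : ∀ t, (((tfun (fun t => h t * deriv (deriv h) t - h t * deriv h t) hκ (cyl q n c.dom) +
      ((q : ℝ) - n - 1) • tfun (fun t => deriv h t ^ 2 - h t * deriv h t) hβ (cyl q n c.dom)) *
        pull le_rfl (g c.dom (vf X) (vf Y)) + pull le_rfl (ricci D₂ c X Y)).1 t =
      (lam • (tfun (fun t => h t ^ 2) (hh.pow 2) (cyl q n c.dom) *
        pull le_rfl (g c.dom (vf X) (vf Y)))).1 t) ↔
      (algebraMap ℝ (M.sec c.dom) (h t * deriv (deriv h) t - h t * deriv h t) + ((q : ℝ) - n - 1) •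
        algebraMap ℝ (M.sec c.dom) (deriv h t ^ 2 - h t * deriv h t)) * g c.dom (vf X) (vf Y) +
          ricci D₂ c X Y =
        lam • (algebraMap ℝ (M.sec c.dom) (h t ^ 2) * g c.dom (vf X) (vf Y)) := fun t => by
    refine Iff.of_eq (congrArg₂ Eq ?_ ?_)
    · exact congrArg₂ (fun a b => (algebraMap ℝ (M.sec c.dom) (h t * deriv (deriv h) t -
        h t * deriv h t) + ((q : ℝ) - n - 1) • algebraMap ℝ (M.sec c.dom) (deriv h t ^ 2 -
          h t * deriv h t)) * a + b) (M.res_id (g c.dom (vf X) (vf Y))) (M.res_id (ricci D₂ c X Y))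
    · exact congrArg (fun a => lam • (algebraMap ℝ (M.sec c.dom) (h t ^ 2) * a))
        (M.res_id (g c.dom (vf X) (vf Y)))
  have fin : ∀ t, ((algebraMap ℝ (M.sec c.dom) (h t * deriv (deriv h) t - h t * deriv h t) +
      ((q : ℝ) - n - 1) • algebraMap ℝ (M.sec c.dom) (deriv h t ^ 2 - h t * deriv h t)) *
        g c.dom (vf X) (vf Y) + ricci D₂ c X Y =
        lam • (algebraMap ℝ (M.sec c.dom) (h t ^ 2) * g c.dom (vf X) (vf Y))) ↔
      ricci D₂ c X Y = (lam * h t ^ 2 - deriv (deriv h) t * h t -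
        ((q : ℝ) - n - 1) * deriv h t ^ 2 + ((q : ℝ) - n) * h t * deriv h t) •
          g c.dom (vf X) (vf Y) := fun t => by
    rw [add_mul, smul_mul_assoc, ← Algebra.smul_def, ← Algebra.smul_def, ← Algebra.smul_def,
      ← eq_sub_iff_add_eq']
    refine Eq.congr_right ?_
    module
  exact ⟨fun e t => (fin t).1 ((ev t).1 (congrArg (fun s => s.1 t) e)),
    fun e => prodSec_ext fun t => (ev t).2 ((fin t).2 (e t))⟩

/-- The Ricci tensor of a warped product on `∂_t`. -/
theorem prodRicci_time_time (hM : Charted M q n) (hT : IsPartialT T) (hg : IsEvenPairing g)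
    (hh : ContDiff ℝ ∞ h) (h0 : ∀ t, h t ≠ 0) (hc : NondegenerateIn g c)
    (hD : IsLeviCivita (warped q n h g) D) (hD₂ : IsLeviCivita g D₂)
    (hD' : ∀ (U : Opens (lineProd M q n).carrier) {i j : ZMod 2} (X : Der (lineProd M q n) U i)
      (Y : Der (lineProd M q n) U j), D'.nabla U (vf X) (vf Y) = D.nabla U (vf X) (vf Y) +
        sgn (i * j) • fmul (warped q n h g U (vf Y) (restr le_top T)) (vf X)) :
    ∃ hκ : ContDiff ℝ ∞ fun t => deriv (deriv h) t / h t - 1,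
      prodRicci D' c (hT.der (cyl q n c.dom)) (hT.der (cyl q n c.dom)) =
        (-((q : ℝ) - n)) • tfun (fun t => deriv (deriv h) t / h t - 1) hκ (cyl q n c.dom) ∧
      ∀ {i : ZMod 2} (X : Der M c.dom i),
        prodRicci D' c (hT.der (cyl q n c.dom)) (liftDer q n X) = 0 := by
  have hh' := contDiff_deriv hh
  have H := hasWarpedForm hM hT hg hh h0 hc hD hD₂ hD'
  have hκ : ContDiff ℝ ∞ fun t => deriv (deriv h) t / h t - 1 :=
    ((contDiff_deriv hh').div hh h0).sub contDiff_const
  have hκ' : ContDiff ℝ ∞ fun t => h t * deriv (deriv h) t - h t * deriv h t :=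
    (hh.mul (contDiff_deriv hh')).sub (hh.mul hh')
  -- This is b + b' + b a for b = h'/h - 1 and a = h'/h; the terms in h'/h and in its square cancel.
  have e : ∀ t, deriv (deriv h) t / h t - 1 = (deriv h t / h t - 1) +
      deriv (fun t => deriv h t / h t - 1) t + (deriv h t / h t - 1) * (deriv h t / h t) := fun t => by
    rw [deriv_logDeriv hh h0]; ring
  refine ⟨hκ, H.ricci_time hM hκ e, fun X => H.ricci_time_lift hM hg hD₂ X hκ' (fun t => ?_) hκ e⟩
  rw [deriv_mul_deriv hh]; field_simp [h0 t]; ring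

end WarpedEinstein

/-! ### Comparison of the Einstein equations of product and factor. -/

section Einstein

variable {M : SuperSpace.{u}} {q n : ℕ} {g : Pairing M} {T : VF (lineProd M q n) ⊤}
  {D D' : AffineConnection (lineProd M q n)} {D₂ : AffineConnection M} {h : ℝ → ℝ}

theorem lineProd_smul_tfun_eq_iff {c : SuperChart M q n} {x : M.carrier} (hx : x ∈ c.dom)
    {κ : ℝ → ℝ} (hκ : ContDiff ℝ ∞ κ) (a lam : ℝ) :
    (-a) • tfun κ hκ (cyl q n c.dom) = lam • (-1 : (lineProd M q n).sec (cyl q n c.dom)) ↔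
      ∀ t, a * κ t = lam := by
  have ev : ∀ t, (((-a) • tfun κ hκ (cyl q n c.dom)).1 t =
      (lam • (-1 : (lineProd M q n).sec (cyl q n c.dom))).1 t) ↔ a * κ t = lam := fun t => by
    have e : ((-a) • algebraMap ℝ (M.sec c.dom) (κ t) = lam • (-1 : M.sec c.dom)) ↔
        a * κ t = lam := by
      rw [smul_neg, neg_smul, neg_inj, ← Algebra.algebraMap_eq_smul_one, Algebra.smul_def,
        ← map_mul]
      exact (algebraMap_sec_injective c hx).eq_iff
    exact e
  exact ⟨fun e t => (ev t).1 (congrArg (fun s => s.1 t) e), fun e => prodSec_ext fun t => (ev t).2 (e t)⟩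

/-- The Einstein equation of a warped product, read on the factors. -/
theorem isEinstein_warped_iff (hM : Charted M q n) (hne : Nonempty M.carrier) (hqn : 0 < q + n)
    (hT : IsPartialT T) (hg : IsRiemannianMetric q n g) (hh : ContDiff ℝ ∞ h) (h0 : ∀ t, h t ≠ 0)
    (hD : IsLeviCivita (warped q n h g) D) (hD₂ : IsLeviCivita g D₂)
    (hD' : ∀ (U : Opens (lineProd M q n).carrier) {i j : ZMod 2} (X : Der (lineProd M q n) U i)
      (Y : Der (lineProd M q n) U j), D'.nabla U (vf X) (vf Y) = D.nabla U (vf X) (vf Y) +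
        sgn (i * j) • fmul (warped q n h g U (vf Y) (restr le_top T)) (vf X)) (lam : ℝ) :
    IsEinstein (q + 1) n (warped q n h g) D' lam ↔
      ∃ c₀ : ℝ, IsEinstein q n g D₂ c₀ ∧
        (∀ t, ((q : ℝ) - n) * (deriv (deriv h) t / h t - 1) = lam) ∧
        ∀ t, lam * h t ^ 2 - deriv (deriv h) t * h t - ((q : ℝ) - n - 1) * deriv h t ^ 2 +
          ((q : ℝ) - n) * h t * deriv h t = c₀ := by
  have hgp := hg.isEvenPairing
  have lift_iff : ∀ (c : SuperChart M q n) {i j : ZMod 2} (X : Der M c.dom i) (Y : Der M c.dom j), _ :=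
    fun c i j X Y => prodRicci_lift_eq_iff hM hT hgp hh h0 (hg.nondegenerateIn c) hD hD₂ hD' lam X Y
  have time := fun c : SuperChart M q n =>
    prodRicci_time_time hM hT hgp hh h0 (hg.nondegenerateIn c) hD hD₂ hD'
  constructor
  · intro E
    have E₂ : ∀ (c : SuperChart M q n) {i j : ZMod 2} (X : Der M c.dom i) (Y : Der M c.dom j), _ :=
      fun c i j X Y => (lift_iff c X Y).1 (E (prodChart c) (liftDer q n X) (liftDer q n Y))
    obtain ⟨x⟩ := hne
    obtain ⟨c, hx⟩ := hM x
    -- The constant c₀ is the value at t = 0.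
    refine ⟨_, fun c i j X Y => E₂ c X Y 0, ?_, fun t => ?_⟩
    · obtain ⟨hκ, e, -⟩ := time c
      refine (lineProd_smul_tfun_eq_iff hx hκ _ lam).1 (e.symm.trans ?_)
      rw [← hT.warped_self hgp hh]
      exact E (prodChart c) (hT.der (cyl q n c.dom)) (hT.der (cyl q n c.dom))
    -- The Ricci tensor of `D₂` does not depend on time, so the values of the factor at `t` and at 0
    -- multiply a non-zero entry of the metric to the same section.
    · obtain ⟨I, J, hIJ⟩ := exists_metric_ne_zero (hg.nondegenerateIn c) hx hqn
      have e := (E₂ c (c.frame I) (c.frame J) t).symm.trans (E₂ c (c.frame I) (c.frame J) 0)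
      rw [← sub_eq_zero, ← sub_smul] at e
      exact sub_eq_zero.1 ((smul_eq_zero.1 e).resolve_right hIJ)
  · rintro ⟨c₀, E₂, hlam, hc₀⟩
    have hw := warped_isEvenPairing (q := q) (n := n) hgp hh
    refine isEinstein_of_frame D' hw (fun c : SuperChart M q n => prodChart c)
      (fun x => hM x.2) fun c => ?_
    have zero_zero : prodRicci D' c (hT.der (cyl q n c.dom)) (hT.der (cyl q n c.dom)) =
        lam • warped q n h g _ (vf (hT.der (cyl q n c.dom))) (vf (hT.der (cyl q n c.dom))) := by
      obtain ⟨hκ, e, -⟩ := time c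
      rw [e, hT.warped_self hgp hh]
      refine prodSec_ext fun t => ?_
      have e : (-((q : ℝ) - n)) • algebraMap ℝ (M.sec c.dom) (deriv (deriv h) t / h t - 1) =
          lam • (-1 : M.sec c.dom) := by
        rw [smul_neg, neg_smul, ← Algebra.algebraMap_eq_smul_one, Algebra.smul_def, ← map_mul,
          hlam t]
      exact e
    have zero_lift : ∀ {i : ZMod 2} (X : Der M c.dom i),
        prodRicci D' c (hT.der (cyl q n c.dom)) (liftDer q n X) =
        lam • warped q n h g _ (vf (hT.der (cyl q n c.dom))) (vf (liftDer q n X)) := fun X => by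
      obtain ⟨hκ, -, e⟩ := time c
      rw [e, ← lift_vf, hT.warped_lift' hgp hh, smul_zero]
    have lift_zero : ∀ {i : ZMod 2} (X : Der M c.dom i),
        prodRicci D' c (liftDer q n X) (hT.der (cyl q n c.dom)) =
        lam • warped q n h g _ (vf (liftDer q n X)) (vf (hT.der (cyl q n c.dom))) := fun X => by
      refine (ricci_symm D' (prodChart c) _ _).trans ?_
      refine (congrArg _ (zero_lift X)).trans ?_
      rw [hw.symm _ (liftDer q n X) (hT.der _), smul_comm]
      rfl
    have lift_lift : ∀ {i j : ZMod 2} (X : Der M c.dom i) (Y : Der M c.dom j),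
        prodRicci D' c (liftDer q n X) (liftDer q n Y) =
        lam • warped q n h g _ (vf (liftDer q n X)) (vf (liftDer q n Y)) := fun X Y =>
      (lift_iff c X Y).2 fun t => by rw [hc₀ t]; exact E₂ c X Y
    have fz := hT.frame_zero c
    have fe : ∀ I, vf ((prodChart c).frame (emb I)) = vf (liftDer q n (c.frame I)) := fun I =>
      (prodChart_frame_eq_lift c I).trans (lift_vf _)
    -- The product frame and the lifts agree as vector fields, but the parities in their types are
    -- only propositionally equal.
    have key : ∀ {i i' j j' : ZMod 2} {X : Der (lineProd M q n) (prodChart c).dom i}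
        {X' : Der (lineProd M q n) (cyl q n c.dom) i'}
        {Y : Der (lineProd M q n) (prodChart c).dom j}
        {Y' : Der (lineProd M q n) (cyl q n c.dom) j'}, i = i' → j = j' → vf X = vf X' →
        vf Y = vf Y' → prodRicci D' c X' Y' = lam • warped q n h g _ (vf X') (vf Y') →
        ricci D' (prodChart c) X Y = lam • warped q n h g (prodChart c).dom (vf X) (vf Y) := by
      intro i i' j j' X X' Y Y' hi hj hX hY e
      subst hi hj
      obtain rfl := vf_injective hX
      obtain rfl := vf_injective hY
      exact e
    refine forall_prodIdx (forall_prodIdx ?_ fun J => ?_) fun I => forall_prodIdx ?_ fun J => ?_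
    · exact key rfl rfl fz fz zero_zero
    · exact key rfl (idxPar_emb J) fz (fe J) (zero_lift _)
    · exact key (idxPar_emb I) rfl (fe I) fz (lift_zero _)
    · exact key (idxPar_emb I) (idxPar_emb J) (fe I) (fe J) (lift_lift _ _)

end Einstein

end SuperGeom

end

theorem theorem4p3 (M₂ : SuperGeom.SuperSpace.{u}) (q n : ℕ)
    (hM : SuperGeom.IsSupermanifold M₂ q n) (hne : Nonempty M₂.carrier) (hqn : 0 < q + n)
    (g₂ : SuperGeom.Pairing M₂) (hg : SuperGeom.IsRiemannianMetric q n g₂)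
    (h : ℝ → ℝ) (hh : ContDiff ℝ ∞ h) (h0 : ∀ t, h t ≠ 0) (lam : ℝ) :
    (∃ D : SuperGeom.AffineConnection (SuperGeom.lineProd M₂ q n),
      SuperGeom.IsSemiSymmetricNonMetric (SuperGeom.warped q n h g₂)
        (SuperGeom.partialT M₂ q n) D ∧
      SuperGeom.IsEinstein (q + 1) n (SuperGeom.warped q n h g₂) D lam) ↔
    ∃ c₀ : ℝ,
      (∃ D₂ : SuperGeom.AffineConnection M₂,
        SuperGeom.IsLeviCivita g₂ D₂ ∧ SuperGeom.IsEinstein q n g₂ D₂ c₀) ∧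
      (∀ t, ((q : ℝ) - n) * (deriv (deriv h) t / h t - 1) = lam) ∧
      ∀ t, lam * h t ^ 2 - deriv (deriv h) t * h t - ((q : ℝ) - n - 1) * deriv h t ^ 2 +
        ((q : ℝ) - n) * h t * deriv h t = c₀ := by
  have hM' : SuperGeom.Charted M₂ q n := hM.exists_chart
  have hT := SuperGeom.isPartialT_partialT hM'
  have hn : SuperGeom.LocallyNondegenerate q n g₂ := fun x =>
    (hM.exists_chart x).imp fun c hx => ⟨hx, hg.nondegenerateIn c⟩
  have hw := SuperGeom.warped_isEvenPairing (q := q) (n := n) hg.isEvenPairing hh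
  constructor
  · rintro ⟨D', ⟨D, hD, hD'⟩, E⟩
    -- The hypothesis only provides connections on the product; the Levi-Civita connection of the
    -- factor has to be constructed.
    obtain ⟨D₂, hD₂⟩ := SuperGeom.exists_isLeviCivita hg.isEvenPairing hn
    obtain ⟨c₀, E₂, h2, h3⟩ :=
      (SuperGeom.isEinstein_warped_iff hM' hne hqn hT hg hh h0 hD hD₂ hD' lam).1 E
    exact ⟨c₀, ⟨D₂, hD₂, E₂⟩, h2, h3⟩
  · rintro ⟨c₀, ⟨D₂, hD₂, E₂⟩, h2, h3⟩
    -- Conversely, the Levi-Civita connection of the warped metric comes from its non-degeneracy in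
    -- product charts, and adding the semi-symmetric term gives the required connection.
    obtain ⟨D, hD⟩ := SuperGeom.exists_isLeviCivita hw
      (SuperGeom.warped_locallyNondegenerate hT hg.isEvenPairing hh h0 hn)
    have hD' := fun U {i j} => SuperGeom.semiSymmetric_apply (U := U) (i := i) (j := j) hw D
      ⟨(SuperGeom.partialT M₂ q n).1, hT.even⟩
    exact ⟨_, ⟨D, hD, hD'⟩,
      (SuperGeom.isEinstein_warped_iff hM' hne hqn hT hg hh h0 hD hD₂ hD' lam).2
        ⟨c₀, E₂, h2, h3⟩⟩
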